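/- Let $n\ge 2$ and $S=\{0,s_1,\dots,s_n,1,\infty\}$, a set of $n+3$ labels. Let $\overline{\mathcal M}_{0,S}$ be the moduli space of stable $S$-labelled curves of genus $0$ (complex points), $\mathcal M_{0,S}$ its open stratum of irreducible curves, and for a 2-partition $S=S'\sqcup S''$ with $|S'|,|S''|\ge 2$ (a stable partition) let $D_{S'|S''}$ be the corresponding boundary divisor. (Concretely, $\overline{\mathcal M}_{0,S}$ is the closure of the image of $\mathcal M_{0,S}$ under all cross-ratios of ordered quadruples of distinct labels in the product of the corresponding copies of $\mathbf P^1(\mathbf C)$, with the induced topology and complex structure, and $D_{S'|S''}$ is the locus where, for all distinct $a,b\in S'$ and distinct $c,d\in S''$, the forgetful map to $\overline{\mathcal M}_{0,\{a,b,c,d\}}$ takes the boundary value $ab|cd$.) For $1\le i\le n$ let $t_i$ be the coordinate $t_{s_i}$, lifted from $\overline{\mathcal M}_{0,\{0,1,\infty,s_i\}}\cong\mathbf P^1$, that takes the values $0,1,\infty$ at $s_i0|1\infty$, $s_i1|0\infty$, $s_i\infty|01$. Let $\rho$ be the cyclic order $0<s_1<\dots<s_n<1<\infty<0$, let $\mathcal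 M^\rho_{0,S}(\mathbf R)\subset\mathcal M_{0,S}$ be the cell of configurations on $\mathbf P^1(\mathbf R)$ lying in the (unoriented) cyclic order $\rho$, let $\Delta^0_n=\{0<t_1<\dots<t_n<1\}\subset\mathbf R^n$, let $\Phi:\Delta_n^0\to\mathcal M_{0,S}$ send $(t_1,\dots,t_n)$ to the class of $(0,t_1,\dots,t_n,1,\infty)$, let $\overline\Phi_n$ be the closure of $\Phi(\Delta^0_n)$ in $\overline{\mathcal M}_{0,S}$, and let $B=B(\rho)$ be the union of the $D_{S'|S''}$ over the stable partitions obtained by breaking the circle, on which $S$ is placed in the order $\rho$, into two arcs. Let $\varepsilon=(\varepsilon_1,\dots,\varepsilon_n)\in\{0,1\}^n$, $\varepsilon_i=\varepsilon_{s_i}$, and let $\Omega(\varepsilon)=\bigwedge_{i=1}^n \frac{dt_i}{t_i-\varepsilon_i}$. Put $S(0)=\{s_i:\varepsilon_i=0\}$, $S(1)=\{s_i:\varepsilon_i=1\}$, $S(\infty)=\{s_1,\dots,s_n\}$, and let $A=A(\varepsilon)$ be the union of the $D_{S'|S''}$ over the stable partitions one part of which is $\{\alpha\}\cup T$ with $\alpha\in\{0,1,\infty\}$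 and $\emptyset\ne T\subseteq S(\alpha)$. Assume $\varepsilon_1=1$ and $\varepsilon_n=0$. Then: 1. $\Phi(\Delta^0_n)=\mathcal M^\rho_{0,S}(\mathbf R)$, and $A$ does not meet the boundary $\overline{\mathcal M^\rho_{0,S}(\mathbf R)}\setminus\mathcal M^\rho_{0,S}(\mathbf R)$ of this cell. 2. $\Omega(\varepsilon)$ is holomorphic on $\overline{\mathcal M}_{0,S}-A$: every point of $\overline{\mathcal M}_{0,S}-A$ lies in a holomorphic chart in which $\Omega(\varepsilon)|_{\mathcal M_{0,S}}$ extends to a holomorphic $n$-form. 3. $\overline\Phi_n$ determines a relative cycle for the pair $(\overline{\mathcal M}_{0,S}-A,\;B-B\cap A)$: one has $\overline\Phi_n\subset\overline{\mathcal M}_{0,S}-A$ and $\overline\Phi_n\setminus\Phi(\Delta^0_n)\subset B-B\cap A$, and there is an integral singular (cubical) $n$-chain $c$ in $\overline{\mathcal M}_{0,S}-A$ whose boundary is, modulo degenerate cubes, a chain in $B-B\cap A$, and which is a subdivision of $\overline\Phi_n$ oriented by $dt_1\wedge\dots\wedge dt_n$; that is, $c$ is a sum with coefficients $\pm1$ of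 smooth cubes whose images together are $\overline\Phi_n$, which map the open cube injectively into $\Phi(\Delta_n^0)$, with pairwise disjoint images of the open cubes, and with coefficients equal to the sign of the Jacobian determinant (nowhere zero on the open cube) in the coordinates $t_1,\dots,t_n$. 4. For every such relative cycle $c$ the integrals below converge absolutely and $$\int_c\Omega(\varepsilon)=\int_{\Delta^0_n}\frac{dt_1}{t_1-\varepsilon_1}\cdots\frac{dt_n}{t_n-\varepsilon_n}.$$ Moreover, if $n=n_1+\dots+n_m$ with $n_j\ge1$ is the composition such that $\varepsilon_i=1$ precisely for $i\in\{1,n_1+1,\dots,n_1+\dots+n_{m-1}+1\}$, then the series below converges absolutely and $$\zeta(n_1,\dots,n_m)=\sum_{0<k_1<\dots<k_m}\frac1{k_1^{n_1}\cdots k_m^{n_m}}=(-1)^m\int_c\Omega(\varepsilon).$$ -/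

import Mathlib

open Set Filter Topology MeasureTheory
open scoped unitInterval ContDiff

noncomputable section

namespace ZetaModuli

/-! ### The projective line and cross-ratios -/

/-- The projective line `P¹(ℂ) = ℂ ∪ {∞}`. -/
abbrev P1 : Type := OnePoint ℂ

/-- Homogeneous coordinates: `z ↦ (z : 1)`, `∞ ↦ (1 : 0)`. -/
def hom (z : P1) : ℂ × ℂ := OnePoint.elim z (1, 0) (fun w => (w, 1))

/-- The bracket `[z, w]`: the determinant of the homogeneous coordinates.
For finite `z, w` it is `z - w`; it vanishes exactly when `z = w`. -/
def bracket (z w : P1) : ℂ := (hom z).1 * (hom w).2 - (hom w).1 * (hom z).2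

/-- The cross-ratio `(a - c)(b - d) / ((a - d)(b - c))` of four distinct points of `P¹(ℂ)`. -/
def crossRatio (a b c d : P1) : ℂ :=
  (bracket a c * bracket b d) / (bracket a d * bracket b c)

/-- The finite value of a point of `P¹(ℂ)` (the value at `∞` is irrelevant). -/
def finVal (z : P1) : ℂ := OnePoint.elim z 0 id

/-! ### The moduli space of stable `S`-labelled curves of genus zero -/

/-- The point of `∏ P¹(ℂ)`, the product over all ordered quadruples of distinct labels, given by
all the cross-ratios of a configuration of distinct points of `P¹(ℂ)`. For a quadruple `q` the
factor `P¹(ℂ)` is the moduli space of stable curves labelled by `q`, and the component at `q` is the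
forgetful map. Configurations have the same image iff they agree up to `Aut P¹`. -/
def crossRatios {S : Type} (x : S ↪ P1) : (Fin 4 ↪ S) → P1 :=
  fun q => ((crossRatio (x (q 0)) (x (q 1)) (x (q 2)) (x (q 3)) : ℂ) : P1)

/-- The space `M̄_{0,S}(ℂ)`, for a finite label set `S`. The product of all forgetful maps to the moduli spaces of stable
curves with four labels (each of them a projective line with the cross-ratio as coordinate) is a
closed embedding of `M̄_{0,S}`; as `M_{0,S}` is dense, `M̄_{0,S}(ℂ)` is the closure of the
image of `M_{0,S}(ℂ)`. It carries the subspace topology. -/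
def Mbar (S : Type) : Type :=
  closure (Set.range (crossRatios : (S ↪ P1) → ((Fin 4 ↪ S) → P1)))

instance (S : Type) : TopologicalSpace (Mbar S) :=
  inferInstanceAs (TopologicalSpace
    (closure (Set.range (crossRatios : (S ↪ P1) → ((Fin 4 ↪ S) → P1)))))

/-- The cross-ratio of four labels, as a map `M̄_{0,S}(ℂ) → P¹(ℂ)`. -/
def Mbar.cr {S : Type} (p : Mbar S) (q : Fin 4 ↪ S) : P1 := p.1 q

/-- The class in `M_{0,S}(ℂ) ⊆ M̄_{0,S}(ℂ)` of a configuration of distinct points. -/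
def Mbar.ofConfig {S : Type} (x : S ↪ P1) : Mbar S :=
  ⟨crossRatios x, subset_closure ⟨x, rfl⟩⟩

/-- The open stratum `M_{0,S}(ℂ)`. -/
def openStratum (S : Type) : Set (Mbar S) := Set.range Mbar.ofConfig

/-- A 2-partition `P | Pᶜ` is stable if both parts have at least two elements. -/
def IsStablePartition {S : Type} (P : Set S) : Prop := P.Nontrivial ∧ Pᶜ.Nontrivial

/-- The boundary divisor of the stable partition `P | Pᶜ`: the stable curves with a node that
separates `P` from `Pᶜ`. These are the points that become the boundary point `ab|cd` of the moduli
space with labels `a, b, c, d` (where the cross-ratio of `a, b, c, d` is `1`), for all `a, b` in `P`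
and `c, d` in `Pᶜ`. -/
def boundaryDivisor {S : Type} (P : Set S) : Set (Mbar S) :=
  {p | ∀ q : Fin 4 ↪ S, q 0 ∈ P → q 1 ∈ P → q 2 ∉ P → q 3 ∉ P → p.cr q = ((1 : ℂ) : P1)}

/-- Holomorphic charts of `M̄_{0,S}(ℂ)`, as a complex submanifold of a product of projective lines:
homeomorphisms between open sets of `M̄_{0,S}(ℂ)` and of `ℂⁿ` that are holomorphic in both
directions. Near a point `p` the ambient coordinates are the cross-ratios that are finite at `p`
(as quadruples are ordered, a cross-ratio and its inverse both occur). -/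
structure IsHolomorphicChart {S : Type} {n : ℕ}
    (φ : OpenPartialHomeomorph (Mbar S) (Fin n → ℂ)) : Prop where
  analytic_symm : ∀ z ∈ φ.target, ∀ q : Fin 4 ↪ S, (φ.symm z).cr q ≠ OnePoint.infty →
    AnalyticAt ℂ (fun w => finVal ((φ.symm w).cr q)) z
  analytic : ∀ p ∈ φ.source, ∃ (m : ℕ) (q : Fin m → (Fin 4 ↪ S)) (F : (Fin m → ℂ) → (Fin n → ℂ)),
    (∀ a, p.cr (q a) ≠ OnePoint.infty) ∧
    AnalyticAt ℂ F (fun a => finVal (p.cr (q a))) ∧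
    ∀ᶠ p' in 𝓝 p, φ p' = F (fun a => finVal (p'.cr (q a)))

/-! ### Labels `0, s₁, …, sₙ, 1, ∞`, the cyclic order `ρ`, and the real cell -/

/-- The label set `S = {0, s₁, …, sₙ, 1, ∞}`; `s i` is `s_{i+1}`. -/
inductive Label (n : ℕ) : Type
  | zero : Label n
  | s (i : Fin n) : Label n
  | one : Label n
  | infty : Label n

/-- The position of a label in the cyclic order `ρ : 0 < s₁ < … < sₙ < 1 < ∞ (< 0)`,
cut open between `∞` and `0`. -/
def Label.pos {n : ℕ} : Label n → ℕ
  | .zero => 0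
  | .s i => i + 1
  | .one => n + 1
  | .infty => n + 2

/-- `P` is one of the two arcs obtained by breaking the circle, with the labels put on it in the
order `ρ`, at two places. One of the arcs avoids the cut between `∞` and `0`, so that it is an
interval of positions. -/
def IsArc {n : ℕ} (P : Set (Label n)) : Prop :=
  ∃ a b : ℕ, P = {l | a ≤ l.pos ∧ l.pos ≤ b} ∨ Pᶜ = {l | a ≤ l.pos ∧ l.pos ≤ b}

/-- The divisor `B(ρ)`. -/
def divB (n : ℕ) : Set (Mbar (Label n)) :=
  {p | ∃ P : Set (Label n), IsStablePartition P ∧ IsArc P ∧ p ∈ boundaryDivisor P}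

/-- The open cell `M^ρ_{0,S}(ℝ)`: the configurations on the real projective line that lie on it in
the unoriented cyclic order `ρ`. After a real projective transformation all points are finite, and
increase from the label `0` to the label `∞`. -/
def realCell (n : ℕ) : Set (Mbar (Label n)) :=
  {p | ∃ (r : Label n → ℝ) (x : Label n ↪ P1), (∀ l l', l.pos < l'.pos → r l < r l') ∧
    (∀ l, x l = ((r l : ℂ) : P1)) ∧ p = Mbar.ofConfig x}

/-- The open simplex `0 < t₁ < … < tₙ < 1`. -/
def openSimplex (n : ℕ) : Set (Fin n → ℝ) := {t | StrictMono t ∧ ∀ i, 0 < t i ∧ t i < 1}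

/-- The points `0, t₁, …, tₙ, 1, ∞` of the projective line. -/
def simplexPoint {n : ℕ} (t : Fin n → ℝ) : Label n → P1
  | .zero => ((0 : ℂ) : P1)
  | .s i => ((t i : ℂ) : P1)
  | .one => ((1 : ℂ) : P1)
  | .infty => OnePoint.infty

theorem simplexPoint_injective {n : ℕ} {t : Fin n → ℝ} (ht : t ∈ openSimplex n) :
    Function.Injective (simplexPoint t) := by
  have h0 : ∀ i, t i ≠ 0 := fun i => (ht.2 i).1.ne'
  have h1 : ∀ i, t i ≠ 1 := fun i => (ht.2 i).2.ne
  intro a b hab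
  cases a <;> cases b <;>
    simp_all [simplexPoint, ht.1.injective.eq_iff, eq_comm]

/-- The map `Φ : Δ⁰ₙ → M_{0,S}(ℂ)`. -/
def Phi {n : ℕ} (t : openSimplex n) : Mbar (Label n) :=
  Mbar.ofConfig ⟨simplexPoint t.1, simplexPoint_injective t.2⟩

/-! ### The form `Ω(ε)` and the divisor `A(ε)` -/

/-- The quadruple `(sᵢ, 1, 0, ∞)`. -/
def tQuad {n : ℕ} (i : Fin n) : Fin 4 ↪ Label n where
  toFun := ![.s i, .one, .zero, .infty]
  inj' := by
    intro a b hab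
    fin_cases a <;> fin_cases b <;> simp_all

/-- The coordinate `t_{sᵢ}`: the cross-ratio that takes the values `0, 1, ∞` where `sᵢ` meets
`0, 1, ∞`. It is finite on the open stratum. -/
def tCoord {n : ℕ} (i : Fin n) (p : Mbar (Label n)) : ℂ := finVal (p.cr (tQuad i))

/-- The coefficient of the pull-back `f^* Ω(ε)` with respect to `dw₁ ∧ … ∧ dwₙ`, where
`Ω(ε) = ⋀ᵢ dtᵢ / (tᵢ - εᵢ)`, under a map `f` from `𝕜ⁿ` (`𝕜` is `ℝ` or `ℂ`), at a point where `f`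
takes values in the open stratum. -/
def omegaCoeff (𝕜 : Type) [NontriviallyNormedField 𝕜] [NormedAlgebra 𝕜 ℂ] {n : ℕ}
    (ε : Fin n → Fin 2) (f : (Fin n → 𝕜) → Mbar (Label n)) (w : Fin n → 𝕜) : ℂ :=
  Matrix.det (Matrix.of fun i j : Fin n =>
    fderiv 𝕜 (fun v => tCoord i (f v)) w (Pi.single j 1) / (tCoord i (f w) - ((ε i : ℕ) : ℂ)))

/-- `Ω(ε)`, a form on the open stratum, is holomorphic at `p`: in a holomorphic chart around `p`
its coefficient extends to a holomorphic function (the extension is unique, as the open stratum is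
dense). -/
def IsHolomorphicOmegaAt {n : ℕ} (ε : Fin n → Fin 2) (p : Mbar (Label n)) : Prop :=
  ∃ φ : OpenPartialHomeomorph (Mbar (Label n)) (Fin n → ℂ),
    IsHolomorphicChart φ ∧ p ∈ φ.source ∧
    ∃ g : (Fin n → ℂ) → ℂ, AnalyticOnNhd ℂ g φ.target ∧
      ∀ z ∈ φ.target, φ.symm z ∈ openStratum (Label n) → g z = omegaCoeff ℂ ε φ.symm z

/-- The sets `S(0)`, `S(1)`, `S(∞)` (and the empty set for the other labels). -/
def typeSet {n : ℕ} (ε : Fin n → Fin 2) : Label n → Set (Label n)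
  | .zero => {l | ∃ i, l = .s i ∧ ε i = 0}
  | .one => {l | ∃ i, l = .s i ∧ ε i = 1}
  | .infty => {l | ∃ i, l = .s i}
  | .s _ => ∅

/-- The partition `P | Pᶜ` has some type `α ∈ {0, 1, ∞}` with respect to `ε`: one of its parts is
`{α} ∪ T` with `T` a non-empty subset of `S(α)`. -/
def HasType {n : ℕ} (ε : Fin n → Fin 2) (P : Set (Label n)) : Prop :=
  ∃ (α : Label n) (T : Set (Label n)), T.Nonempty ∧ T ⊆ typeSet ε α ∧
    (P = insert α T ∨ Pᶜ = insert α T)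

/-- The divisor `A(ε)`. -/
def divA {n : ℕ} (ε : Fin n → Fin 2) : Set (Mbar (Label n)) :=
  {p | ∃ P : Set (Label n), IsStablePartition P ∧ HasType ε P ∧ p ∈ boundaryDivisor P}

/-! ### Singular cubical chains -/

/-- Singular `k`-cubes in `X`. -/
abbrev SingularCube (X : Type) [TopologicalSpace X] (k : ℕ) : Type := C(Fin k → I, X)

/-- Integral singular cubical `k`-chains. -/
abbrev CubicalChain (X : Type) [TopologicalSpace X] (k : ℕ) : Type := SingularCube X k →₀ ℤ

/-- The face of a singular cube on which the `i`-th coordinate is `e`. -/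
def face {X : Type} [TopologicalSpace X] {k : ℕ} (i : Fin (k + 1)) (e : I)
    (τ : SingularCube X (k + 1)) : SingularCube X k :=
  τ.comp ⟨fun y => i.insertNth e y, by fun_prop⟩

/-- The cubical boundary operator. -/
def bdry {X : Type} [TopologicalSpace X] : (k : ℕ) → CubicalChain X k → CubicalChain X (k - 1)
  | 0, _ => 0
  | k + 1, c => c.sum fun τ a => a • ∑ i : Fin (k + 1), (-1 : ℤ) ^ (i : ℕ) •
      (Finsupp.single (face i 1 τ) (1 : ℤ) - Finsupp.single (face i 0 τ) (1 : ℤ))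

/-- A cube is degenerate if it does not depend on one of its coordinates. -/
def IsDegenerate {X : Type} [TopologicalSpace X] {k : ℕ} (τ : SingularCube X k) : Prop :=
  ∃ i : Fin k, ∀ y y' : Fin k → I, (∀ j, j ≠ i → y j = y' j) → τ y = τ y'

/-- `c` is a relative cycle of the pair `(U, V)`: a singular chain in `U` whose boundary is, up to
degenerate cubes, a chain in `V`. -/
def IsRelativeCycle {X : Type} [TopologicalSpace X] {k : ℕ} (U V : Set X)
    (c : CubicalChain X k) : Prop :=
  (∀ τ ∈ c.support, Set.range τ ⊆ U) ∧
    ∀ τ ∈ (bdry k c).support, Set.range τ ⊆ V ∨ IsDegenerate τ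

/-- A singular cube as a function on `ℝᵏ` (constant along the fibres of the retraction onto the
unit cube), so that it can be differentiated. -/
def cubeFun {X : Type} [TopologicalSpace X] {k : ℕ} (τ : SingularCube X k) (y : Fin k → ℝ) : X :=
  τ fun j => Set.projIcc 0 1 zero_le_one (y j)

/-- The open unit cube in `ℝᵏ`. -/
def openCube (k : ℕ) : Set (Fin k → ℝ) := {y | ∀ j, 0 < y j ∧ y j < 1}

/-- Smoothness (up to the boundary of the cube) of a singular cube in the manifold
`M̄_{0,S}(ℂ)`. -/
def IsSmoothCube {S : Type} {k : ℕ} (τ : SingularCube (Mbar S) k) : Prop :=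
  ∀ y ∈ Set.Icc (0 : Fin k → ℝ) 1, ∀ q : Fin 4 ↪ S, (cubeFun τ y).cr q ≠ OnePoint.infty →
    ContDiffWithinAt ℝ ∞ (fun w => finVal ((cubeFun τ w).cr q)) (Set.Icc 0 1) y

/-- The Jacobian determinant, in the real coordinates `t₁, …, tₙ` of the cell, of a cube whose
interior lies in the cell. -/
def tJacobian {n : ℕ} (τ : SingularCube (Mbar (Label n)) n) (y : Fin n → ℝ) : ℝ :=
  Matrix.det (Matrix.of fun i j : Fin n =>
    fderiv ℝ (fun v => (tCoord i (cubeFun τ v)).re) y (Pi.single j 1))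

/-- The chain `c` is a subdivision of the closed cell, the closure of `Φ(Δ⁰ₙ)`, oriented by
`dt₁ ∧ … ∧ dtₙ`: it is a sum, with coefficients `±1`, of smooth cubes that cover the closed cell,
whose interiors are embedded in the open cell without overlaps, and whose coefficients are the
orientation signs. -/
structure IsCellSubdivision {n : ℕ} (c : CubicalChain (Mbar (Label n)) n) : Prop where
  smooth : ∀ τ ∈ c.support, IsSmoothCube τ
  mapsTo : ∀ τ ∈ c.support, Set.MapsTo (cubeFun τ) (openCube n) (Set.range (Phi (n := n)))
  injOn : ∀ τ ∈ c.support, Set.InjOn (cubeFun τ) (openCube n)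
  disjoint : ∀ τ ∈ c.support, ∀ τ' ∈ c.support, τ ≠ τ' →
    Disjoint (cubeFun τ '' openCube n) (cubeFun τ' '' openCube n)
  cover : (⋃ τ ∈ c.support, Set.range τ) = closure (Set.range (Phi (n := n)))
  sign : ∀ τ ∈ c.support, ∀ y ∈ openCube n, c τ = (SignType.sign (tJacobian τ y) : ℤ)

/-- The integral of `Ω(ε)` over a singular chain of smooth cubes whose interiors lie in the open
stratum. -/
def chainIntegral {n : ℕ} (ε : Fin n → Fin 2) (c : CubicalChain (Mbar (Label n)) n) : ℂ :=
  c.sum fun τ a => (a : ℂ) * ∫ y in openCube n, omegaCoeff ℝ ε (cubeFun τ) y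

/-! ### Multiple zeta values -/

/-- `z` is the multiple zeta value `ζ(e₁, …, eₘ) = ∑_{0 < k₁ < … < kₘ} ∏ⱼ kⱼ^(-eⱼ)`. -/
def IsMultipleZeta {m : ℕ} (e : Fin m → ℕ) (z : ℂ) : Prop :=
  HasSum (fun k : {k : Fin m → ℕ // StrictMono k ∧ ∀ j, 0 < k j} =>
    ∏ j, 1 / ((k.1 j : ℕ) : ℂ) ^ e j) z

/-- `ε` is the word of the composition `n = n₁ + … + nₘ`: `εᵢ = 1` precisely for
`i ∈ {1, n₁ + 1, …, n₁ + … + n_{m-1} + 1}` (here indices start at `0`). -/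
def IsWordOf {n : ℕ} (ε : Fin n → Fin 2) (e : Composition n) : Prop :=
  ∀ i : Fin n, ε i = 1 ↔ ∃ j : Fin e.length, (i : ℕ) = e.sizeUpTo j

end ZetaModuli

end

open ZetaModuli

/-! Everything rests on explicit local coordinates. Put the label `∞` at infinity. Near a stable
curve `p` one can choose cross-ratios as coordinates such that each difference of two finite points
is a monomial in them times a polynomial that does not vanish at `p`; the coordinate `X k` divides
exactly the differences inside a cluster `C k`, and two clusters are nested or disjoint. Such a
family is a `DifSystem`. Nestedness forbids monomials that remain in both numerator and denominator
of a cross-ratio, so all cross-ratios extend continuously to `P¹` wherever the other factors are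
nonzero. The coordinates (`TreeModel`) come from induction on the number of points: near `p` some
pair `a, c` is closest up to bounded factors, because finitely many closed conditions cover the
dense open stratum; remove `c`, and put it back next to `a` with one new coordinate. This gives
holomorphic charts in which `X k = 0` lies in the divisor of `C k`, and shows that every point off
the open stratum lies on a boundary divisor.

In a chart `tᵢ - εᵢ` is a quotient of two differences, so `Ω(ε)` is a unit times `∏ 1 / X k` times
the determinant of a polynomial matrix. If `C k` has no type, `X k` divides a row or a column
(`TreeModel.X_dvd_det_omegaMatrix`): either some `sᵢ` falls into the one of `0, 1` that is not its
pole, and `dtᵢ` vanishes there, or none of the differences involved vanishes. The poles are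
therefore confined to `A`.

On the cell, the cross-ratio of an alternating quadruple is at most `0`, and this persists in the
closure; hence a divisor that meets the closed cell comes from an arc. An arc of type `0` contains
`s₁`, one of type `1` contains `sₙ`, and none has type `∞`. The conditions on the first and last
letters thus keep the closed cell away from `A`.

For the cycle, order the `n + 1` gaps of `0, t₁, …, tₙ, 1` by size and write each gap as a product
of parameters in `[0, 1]`. Each permutation gives a cube (`gapCube`), again through a `DifSystem`,
whose remaining factors are positive on the whole closed cube. Faces at `1` cancel between
permutations that differ by an adjacent transposition, faces at `0` lie in the boundary of the cell,
and the orientation is the sign of the permutation.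

For an arbitrary subdivision the integral follows by change of variables, since what the open cubes
miss is a null set. The simplex integral is computed in `ENNReal` with Tonelli and the geometric
series: a letter `1` strictly raises the summation index, a letter `0` repeats it. Convergence comes
from a domination by `1 / √m` that every letter preserves up to the factor `3`. -/

namespace ZetaModuli

/-! ### Continuity on the projective line -/

/-- The point of `P¹(ℂ)` with homogeneous coordinates `(a : b)`. -/
noncomputable def toP1 (a b : ℂ) : P1 := if b = 0 then OnePoint.infty else ((a / b : ℂ) : P1)

theorem toP1_of_ne {a b : ℂ} (hb : b ≠ 0) : toP1 a b = ((a / b : ℂ) : P1) := if_neg hb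

theorem toP1_ne_infty {a b : ℂ} : toP1 a b ≠ OnePoint.infty ↔ b ≠ 0 := by
  unfold toP1
  split_ifs with h <;> simp [h]

/-- No case `b ≠ 0` is needed: for `b = 0` both sides have the default value `0`. -/
theorem finVal_toP1 (a b : ℂ) : finVal (toP1 a b) = a / b := by
  unfold toP1
  split_ifs with h
  · simp [h, finVal]
  · rfl

@[simp] theorem finVal_coe (a : ℂ) : finVal (a : P1) = a := rfl

theorem continuousAt_toP1 {X : Type*} [TopologicalSpace X] {f g : X → ℂ} {x : X}
    (hf : ContinuousAt f x) (hg : ContinuousAt g x) (h : f x ≠ 0 ∨ g x ≠ 0) :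
    ContinuousAt (fun y => toP1 (f y) (g y)) x := by
  by_cases hgx : g x = 0
  · have hfx : f x ≠ 0 := h.resolve_right (by simp [hgx])
    have hv : toP1 (f x) (g x) = OnePoint.infty := if_pos hgx
    unfold ContinuousAt
    dsimp only
    rw [hv, OnePoint.hasBasis_nhds_infty.tendsto_right_iff]
    rintro s ⟨-, hs⟩
    obtain ⟨R, hR⟩ := hs.isBounded.subset_closedBall 0
    -- The quotient is outside the ball of radius `R` when `R * ‖g‖ < ‖f‖`, a condition that still
    -- makes sense where `g` vanishes.
    have hlt : ∀ᶠ y in 𝓝 x, R * ‖g y‖ < ‖f y‖ := by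
      have h1 : ContinuousAt (fun y => R * ‖g y‖) x := continuousAt_const.mul hg.norm
      exact h1.eventually_lt hf.norm (by simpa [hgx] using hfx)
    filter_upwards [hlt] with y hy
    by_cases hgy : g y = 0
    · right; simp [toP1, hgy]
    · left
      rw [toP1_of_ne hgy]
      refine ⟨_, fun hmem => ?_, rfl⟩
      have := hR hmem
      rw [mem_closedBall_zero_iff, norm_div, div_le_iff₀ (norm_pos_iff.2 hgy)] at this
      exact absurd hy (not_lt.2 this)
  · have : (fun y => toP1 (f y) (g y)) =ᶠ[𝓝 x] fun y => ((f y / g y : ℂ) : P1) := by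
      filter_upwards [hg.eventually_ne hgx] with y hy
      exact toP1_of_ne hy
    rw [continuousAt_congr this]
    exact OnePoint.continuous_coe.continuousAt.comp (hf.div hg hgx)

theorem continuousAt_finVal {x : P1} (hx : x ≠ OnePoint.infty) : ContinuousAt finVal x := by
  obtain ⟨y, rfl⟩ := OnePoint.ne_infty_iff_exists.1 hx
  rw [OnePoint.continuousAt_coe]
  exact continuousAt_id

/-! ### Points of the moduli space -/

instance (S : Type) : T2Space (Mbar S) :=
  inferInstanceAs (T2Space (closure (Set.range (crossRatios : (S ↪ P1) → ((Fin 4 ↪ S) → P1)))))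

theorem Mbar.ext {S : Type} {p p' : Mbar S} (h : ∀ q, p.cr q = p'.cr q) : p = p' :=
  Subtype.ext (funext h)

theorem Mbar.continuous_cr {S : Type} (q : Fin 4 ↪ S) : Continuous fun p : Mbar S => p.cr q :=
  (continuous_apply q).comp continuous_subtype_val

theorem dense_openStratum (S : Type) : Dense (openStratum S) := by
  intro p
  have h : IsInducing (fun p : Mbar S => p.cr) := ⟨rfl⟩
  rw [h.closure_eq_preimage_closure_image]
  have : (fun p : Mbar S => p.cr) '' openStratum S
      = Set.range (crossRatios : (S ↪ P1) → ((Fin 4 ↪ S) → P1)) := by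
    rw [openStratum, ← Set.range_comp]
    rfl
  simp only [mem_preimage, this]
  exact p.2

theorem Mbar.isOpen_cr_ne_infty {S : Type} (q : Fin 4 ↪ S) :
    IsOpen {p : Mbar S | p.cr q ≠ OnePoint.infty} :=
  (OnePoint.isClosed_infty.preimage (Mbar.continuous_cr q)).isOpen_compl

theorem Mbar.continuousAt_finVal_cr {S : Type} {q : Fin 4 ↪ S} {p : Mbar S}
    (h : p.cr q ≠ OnePoint.infty) : ContinuousAt (fun p' : Mbar S => finVal (p'.cr q)) p :=
  ContinuousAt.comp (f := fun p' : Mbar S => p'.cr q) (continuousAt_finVal h)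
    (Mbar.continuous_cr q).continuousAt

/-- A closed ball is compact in `ℂ`, so it stays closed in `P¹`. Hence a bound on a cross-ratio
passes to limits and keeps them finite. -/
theorem isClosed_norm_le (R : ℝ) : IsClosed {x : P1 | ∃ w : ℂ, x = (w : P1) ∧ ‖w‖ ≤ R} := by
  have : {x : P1 | ∃ w : ℂ, x = (w : P1) ∧ ‖w‖ ≤ R}
      = ((↑) : ℂ → P1) '' Metric.closedBall 0 R := by
    ext x
    simp only [mem_ofPred_eq, mem_image, mem_closedBall_zero_iff]
    exact ⟨fun ⟨w, h, h'⟩ => ⟨w, h', h.symm⟩, fun ⟨w, h, h'⟩ => ⟨w, h'.symm, h⟩⟩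
  rw [this]
  exact ((isCompact_closedBall (0 : ℂ) R).image OnePoint.continuous_coe).isClosed

/-- The ordered quadruple of four distinct labels. -/
def mkQuad {S : Type} (a b c d : S) (hab : a ≠ b) (hac : a ≠ c) (had : a ≠ d) (hbc : b ≠ c)
    (hbd : b ≠ d) (hcd : c ≠ d) : Fin 4 ↪ S where
  toFun := ![a, b, c, d]
  inj' := by
    intro i j hij
    fin_cases i <;> fin_cases j <;> simp_all

/-! ### Labels -/

variable {n : ℕ}

noncomputable instance : DecidableEq (Label n) := Classical.decEq _

theorem Label.pos_injective : Function.Injective (Label.pos (n := n)) := by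
  intro a b h
  cases a <;> cases b <;> simp only [Label.pos] at h <;> first | rfl | (try omega)
  · rename_i i j
    have : i = j := Fin.ext (by omega)
    rw [this]

theorem Label.pos_lt (a : Label n) : a.pos < n + 3 := by
  cases a <;> simp only [Label.pos] <;> omega

/-- The labels, in the order `ρ` cut open between `∞` and `0`. -/
noncomputable def labelEquiv (n : ℕ) : Label n ≃ Fin (n + 3) :=
  Equiv.ofBijective (fun a => ⟨a.pos, a.pos_lt⟩) <| by
    refine ⟨fun a b h => Label.pos_injective (by simpa using h), fun k => ?_⟩
    obtain ⟨k, hk⟩ := k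
    rcases Nat.eq_zero_or_pos k with h0 | h0
    · exact ⟨.zero, Fin.ext h0.symm⟩
    · by_cases h1 : k ≤ n
      · exact ⟨.s ⟨k - 1, by omega⟩, Fin.ext (by simp [Label.pos]; omega)⟩
      · by_cases h2 : k = n + 1
        · exact ⟨.one, Fin.ext h2.symm⟩
        · exact ⟨.infty, Fin.ext (by simp [Label.pos]; omega)⟩

noncomputable instance : Fintype (Label n) := Fintype.ofEquiv _ (labelEquiv n).symm

theorem card_label : Fintype.card (Label n) = n + 3 := by
  rw [Fintype.card_congr (labelEquiv n), Fintype.card_fin]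

/-! ### Brackets of configurations with the label `∞` at infinity -/

section dif

variable {R : Type*} [CommRing R]

/-- The bracket of the points with labels `a` and `b`, where the point with label `∞` is at infinity
and the finite points are given by `z`. -/
noncomputable def dif (z : Label n → R) (a b : Label n) : R :=
  if a = .infty then (if b = .infty then 0 else 1) else if b = .infty then -1 else z a - z b

theorem dif_fin (z : Label n → R) {a b : Label n} (ha : a ≠ .infty) (hb : b ≠ .infty) :
    dif z a b = z a - z b := by simp [dif, ha, hb]

theorem dif_infty_right (z : Label n → R) {a : Label n} (ha : a ≠ .infty) :
    dif z a .infty = -1 := by simp [dif, ha]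

theorem dif_infty_left (z : Label n → R) {a : Label n} (ha : a ≠ .infty) :
    dif z .infty a = 1 := by simp [dif, ha]

/-- The Plücker relation covers `∞` too, because `dif` is the determinant of the homogeneous
coordinates `(z, 1)` and `(1, 0)`. -/
theorem dif_plucker (z : Label n → R) (a b c d : Label n) :
    dif z a c * dif z b d - dif z a d * dif z b c = dif z a b * dif z c d := by
  unfold dif
  split_ifs <;> ring

theorem map_dif {R' : Type*} [CommRing R'] (f : R →+* R') (z : Label n → R) (a b : Label n) :
    f (dif z a b) = dif (fun l => f (z l)) a b := by
  unfold dif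
  split_ifs <;> simp

end dif

/-- The point with label `a`. -/
noncomputable def zPoint (z : Label n → ℂ) (a : Label n) : P1 :=
  if a = .infty then OnePoint.infty else ((z a : ℂ) : P1)

theorem bracket_zPoint (z : Label n → ℂ) (a b : Label n) :
    bracket (zPoint z a) (zPoint z b) = dif z a b := by
  unfold zPoint dif
  split_ifs <;> simp [bracket, hom]

theorem bracket_self (x : P1) : bracket x x = 0 := by
  simp [bracket]

theorem bracket_ne_zero {x y : P1} (h : x ≠ y) : bracket x y ≠ 0 := by
  induction x using OnePoint.rec <;> induction y using OnePoint.rec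
  · exact absurd rfl h
  · simp [bracket, hom]
  · simp [bracket, hom]
  · rename_i a b
    have : a ≠ b := fun e => h (by rw [e])
    simpa [bracket, hom, sub_eq_zero] using this

/-- The configuration with the label `∞` at infinity and the finite points given by `z`. -/
noncomputable def zConfig (z : Label n → ℂ) (h : ∀ a b, a ≠ b → dif z a b ≠ 0) : Label n ↪ P1 where
  toFun := zPoint z
  inj' := by
    intro a b hab
    by_contra hne
    apply h a b hne
    rw [← bracket_zPoint, hab, bracket_self]

theorem cr_ofConfig_zConfig (z : Label n → ℂ) (h : ∀ a b, a ≠ b → dif z a b ≠ 0)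
    (q : Fin 4 ↪ Label n) : (Mbar.ofConfig (zConfig z h)).cr q =
      ((dif z (q 0) (q 2) * dif z (q 1) (q 3) / (dif z (q 0) (q 3) * dif z (q 1) (q 2)) : ℂ)
        : P1) := by
  change ((crossRatio (zPoint z (q 0)) (zPoint z (q 1)) (zPoint z (q 2)) (zPoint z (q 3)) : ℂ)
    : P1) = _
  rw [crossRatio, bracket_zPoint, bracket_zPoint, bracket_zPoint, bracket_zPoint]

/-- Each label occurs once in the numerator and once in the denominator of a cross-ratio, so the
factors cancel. -/
theorem ofConfig_eq_of_scaling {x y : Label n ↪ P1} (c : Label n → ℂ) (k : ℂ) (hk : k ≠ 0)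
    (hc : ∀ a, c a ≠ 0)
    (h : ∀ a b, a ≠ b → bracket (y a) (y b) = k * c a * c b * bracket (x a) (x b)) :
    Mbar.ofConfig x = Mbar.ofConfig y := by
  apply Mbar.ext
  intro q
  change ((crossRatio _ _ _ _ : ℂ) : P1) = ((crossRatio _ _ _ _ : ℂ) : P1)
  congr 1
  have hq : ∀ i j : Fin 4, i ≠ j → q i ≠ q j := fun i j hij e => hij (q.injective e)
  unfold crossRatio
  rw [h _ _ (hq 0 2 (by decide)), h _ _ (hq 1 3 (by decide)), h _ _ (hq 0 3 (by decide)),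
    h _ _ (hq 1 2 (by decide))]
  have b1 := bracket_ne_zero (fun e => hq 0 3 (by decide) (x.injective e))
  have b2 := bracket_ne_zero (fun e => hq 1 2 (by decide) (x.injective e))
  have := hc (q 0)
  have := hc (q 1)
  have := hc (q 2)
  have := hc (q 3)
  field_simp

/-- The coordinate on the projective line for which the points with labels `a₀, b₀, ∞` are at
`0, 1, ∞`. -/
noncomputable def normalized (x : Label n ↪ P1) (a₀ b₀ l : Label n) : ℂ :=
  bracket (x l) (x a₀) * bracket (x b₀) (x .infty) /
    (bracket (x l) (x .infty) * bracket (x b₀) (x a₀))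

/-- A change of coordinate on the projective line rescales brackets by a factor for each point and a
common constant. Here the factor is `1 / [x a, x ∞]`, and the identity is a Plücker relation. -/
theorem dif_normalized (x : Label n ↪ P1) {a₀ b₀ : Label n} (hab : a₀ ≠ b₀) (ha : a₀ ≠ .infty)
    (hb : b₀ ≠ .infty) : ∃ (c : Label n → ℂ) (k : ℂ), k ≠ 0 ∧ (∀ a, c a ≠ 0) ∧ ∀ a b, a ≠ b →
      dif (normalized x a₀ b₀) a b = k * c a * c b * bracket (x a) (x b) := by
  have hx : ∀ {a b}, a ≠ b → bracket (x a) (x b) ≠ 0 :=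
    fun h => bracket_ne_zero (fun e => h (x.injective e))
  have h1 := hx ha
  have h2 := hx hb
  have h3 := hx hab.symm
  set k : ℂ := bracket (x b₀) (x .infty) / bracket (x b₀) (x a₀) * bracket (x a₀) (x .infty)
    with hk
  have hk0 : k ≠ 0 := mul_ne_zero (div_ne_zero h2 h3) h1
  refine ⟨fun a => if a = .infty then -1 / k else 1 / bracket (x a) (x .infty), k, hk0, ?_, ?_⟩
  · intro a
    dsimp only
    split_ifs with h
    · exact div_ne_zero (by simp) hk0
    · exact div_ne_zero one_ne_zero (hx h)
  · intro a b hne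
    dsimp only
    have hanti : ∀ u v : P1, bracket u v = - bracket v u := fun u v => by unfold bracket; ring
    by_cases hai : a = .infty
    · subst hai
      rw [dif_infty_left _ hne.symm, if_pos rfl, if_neg hne.symm, hanti (x .infty)]
      have := hx hne.symm
      field_simp
    · by_cases hbi : b = .infty
      · subst hbi
        rw [dif_infty_right _ hne, if_pos rfl, if_neg hne]
        have := hx hne
        field_simp
      · rw [dif_fin _ hai hbi, if_neg hai, if_neg hbi, hk]
        unfold normalized
        have h4 := hx hai
        have h5 := hx hbi
        have hpl : bracket (x a) (x a₀) * bracket (x b) (x .infty)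
            - bracket (x b) (x a₀) * bracket (x a) (x .infty)
            = bracket (x a) (x b) * bracket (x a₀) (x .infty) := by
          unfold bracket; ring
        field_simp
        linear_combination hpl

theorem ofConfig_eq_normalized (x : Label n ↪ P1) {a₀ b₀ : Label n} (hab : a₀ ≠ b₀)
    (ha : a₀ ≠ .infty) (hb : b₀ ≠ .infty) :
    ∃ h : ∀ a b, a ≠ b → dif (normalized x a₀ b₀) a b ≠ 0,
      Mbar.ofConfig x = Mbar.ofConfig (zConfig (normalized x a₀ b₀) h) := by
  obtain ⟨c, k, hk, hc, h⟩ := dif_normalized x hab ha hb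
  refine ⟨fun a b hne => ?_, ?_⟩
  · rw [h a b hne]
    exact mul_ne_zero (mul_ne_zero (mul_ne_zero hk (hc a)) (hc b))
      (bracket_ne_zero (fun e => hne (x.injective e)))
  · refine ofConfig_eq_of_scaling c k hk hc fun a b hne => ?_
    rw [← h a b hne]
    exact bracket_zPoint _ a b

theorem exists_normalized {p : Mbar (Label n)} (hp : p ∈ openStratum (Label n)) {a₀ b₀ : Label n}
    (hab : a₀ ≠ b₀) (ha : a₀ ≠ .infty) (hb : b₀ ≠ .infty) :
    ∃ (z : Label n → ℂ) (h : ∀ a b, a ≠ b → dif z a b ≠ 0),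
      z a₀ = 0 ∧ z b₀ = 1 ∧ p = Mbar.ofConfig (zConfig z h) := by
  obtain ⟨x, rfl⟩ := hp
  obtain ⟨h, he⟩ := ofConfig_eq_normalized x hab ha hb
  refine ⟨_, h, ?_, ?_, he⟩
  · simp [normalized, bracket_self]
  · have h2 := bracket_ne_zero (fun e => hb (x.injective e))
    have h3 := bracket_ne_zero (fun e => hab.symm (x.injective e))
    unfold normalized
    field_simp

/-- The value `1` is excluded by Plücker: numerator minus denominator is the product of the two
remaining brackets. -/
theorem cr_openStratum {p : Mbar (Label n)} (hp : p ∈ openStratum (Label n))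
    (q : Fin 4 ↪ Label n) : p.cr q ≠ OnePoint.infty ∧ p.cr q ≠ ((0 : ℂ) : P1) ∧
      p.cr q ≠ ((1 : ℂ) : P1) := by
  obtain ⟨z, h, -, -, rfl⟩ := exists_normalized hp (a₀ := .zero) (b₀ := .one) (by simp) (by simp)
    (by simp)
  have hq : ∀ i j : Fin 4, i ≠ j → dif z (q i) (q j) ≠ 0 :=
    fun i j hij => h _ _ fun e => hij (q.injective e)
  rw [cr_ofConfig_zConfig]
  have h02 := hq 0 2 (by decide)
  have h13 := hq 1 3 (by decide)
  have h03 := hq 0 3 (by decide)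
  have h12 := hq 1 2 (by decide)
  have h01 := hq 0 1 (by decide)
  have h23 := hq 2 3 (by decide)
  refine ⟨OnePoint.coe_ne_infty _, ?_, ?_⟩
  · rw [Ne, OnePoint.coe_eq_coe, div_eq_zero_iff]
    simp [h02, h13, h03, h12]
  · rw [Ne, OnePoint.coe_eq_coe, div_eq_one_iff_eq (mul_ne_zero h03 h12), ← sub_eq_zero,
      dif_plucker]
    exact mul_ne_zero h01 h23

end ZetaModuli

/-! ### Families of configurations with monomial differences -/

namespace ZetaModuli

variable {n : ℕ}

open Classical in
/-- A family of configurations that depends polynomially on `n` parameters, such that the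
differences of the points are monomials up to factors `P a b`. The parameter `j` divides the
difference of `a` and `b` if `r j a b`. -/
structure DifSystem (n : ℕ) where
  z : Label n → MvPolynomial (Fin n) ℂ
  r : Fin n → Label n → Label n → Prop
  P : Label n → Label n → MvPolynomial (Fin n) ℂ
  symm : ∀ {j a b}, r j a b → r j b a
  trans : ∀ {j a b c}, r j a b → r j b c → r j a c
  nest : ∀ {j k a b c}, r j a b → r k a c → r j a c ∨ r k a b
  factor : ∀ {a b}, a ≠ b → dif z a b = (∏ j with r j a b, MvPolynomial.X j) * P a b

namespace DifSystem

open MvPolynomial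

variable (Y : DifSystem n)

open Classical in
/-- The exponent of the parameter `j` in the difference of `a` and `b`. -/
noncomputable def e (j : Fin n) (a b : Label n) : ℕ := if Y.r j a b then 1 else 0

open Classical in
theorem prod_filter_eq (a b : Label n) :
    (∏ j with Y.r j a b, (X j : MvPolynomial (Fin n) ℂ)) = ∏ j, X j ^ Y.e j a b := by
  rw [Finset.prod_filter]
  refine Finset.prod_congr rfl fun j _ => ?_
  unfold e
  split_ifs <;> simp

/-- Numerator of the cross-ratio of `a, b, c, d`. -/
noncomputable def num (a b c d : Label n) : MvPolynomial (Fin n) ℂ :=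
  (∏ j, X j ^ ((Y.e j a c + Y.e j b d) - (Y.e j a d + Y.e j b c))) * (Y.P a c * Y.P b d)

/-- Denominator of the cross-ratio of `a, b, c, d`. -/
noncomputable def den (a b c d : Label n) : MvPolynomial (Fin n) ℂ :=
  (∏ j, X j ^ ((Y.e j a d + Y.e j b c) - (Y.e j a c + Y.e j b d))) * (Y.P a d * Y.P b c)

theorem num_den {a b c d : Label n} (hac : a ≠ c) (had : a ≠ d) (hbc : b ≠ c) (hbd : b ≠ d) :
    dif Y.z a c * dif Y.z b d * Y.den a b c d = dif Y.z a d * dif Y.z b c * Y.num a b c d := by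
  rw [Y.factor hac, Y.factor hbd, Y.factor had, Y.factor hbc]
  simp only [prod_filter_eq, num, den]
  -- Truncated subtraction keeps only the excess on either side, and `x + (y - x) = y + (x - y)` in
  -- `ℕ`.
  have : (∏ j, (X j : MvPolynomial (Fin n) ℂ) ^ Y.e j a c) * (∏ j, X j ^ Y.e j b d) *
      (∏ j, X j ^ ((Y.e j a d + Y.e j b c) - (Y.e j a c + Y.e j b d)))
      = (∏ j, X j ^ Y.e j a d) * (∏ j, X j ^ Y.e j b c) *
      (∏ j, X j ^ ((Y.e j a c + Y.e j b d) - (Y.e j a d + Y.e j b c))) := by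
    simp only [← Finset.prod_mul_distrib, ← pow_add]
    refine Finset.prod_congr rfl fun j _ => ?_
    congr 1
    omega
  linear_combination (Y.P a c * Y.P b d * (Y.P a d * Y.P b c)) * this

/-- The parameters where the factors `P a b` do not vanish. -/
def U : Set (Fin n → ℂ) := {u | ∀ a b, a ≠ b → eval u (Y.P a b) ≠ 0}

theorem continuous_eval (p : MvPolynomial (Fin n) ℂ) : Continuous fun u : Fin n → ℂ => eval u p :=
  MvPolynomial.continuous_eval p

theorem isOpen_U : IsOpen Y.U := by
  simp only [U, ofPred_forall]
  refine isOpen_iInter_of_finite fun a => isOpen_iInter_of_finite fun b =>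
    isOpen_iInter_of_finite fun _ => ?_
  exact isOpen_ne_fun (continuous_eval _) continuous_const

/-- Exponents are `0` or `1`. If, say, `a d` were related as well, an excess would require both `a
c` and `b d`; transitivity would then add `b c` and destroy it. -/
theorem e_eq_zero_or {a b c d : Label n} (j : Fin n)
    (h : Y.e j a d + Y.e j b c < Y.e j a c + Y.e j b d) :
    ¬ Y.r j a d ∧ ¬ Y.r j b c ∧ (Y.r j a c ∨ Y.r j b d) := by
  unfold e at h
  by_cases h1 : Y.r j a d <;> by_cases h2 : Y.r j b c <;> by_cases h3 : Y.r j a c <;>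
    by_cases h4 : Y.r j b d <;> simp only [h1, h2, h3, h4, if_true, if_false] at h ⊢ <;>
    first
    | omega
    | (simp; done)
    | exact absurd (Y.trans (Y.trans h4 (Y.symm h1)) h3) h2
    | exact absurd (Y.trans h3 (Y.trans (Y.symm h2) h4)) h1

/-- This is where nestedness enters: a parameter left over in the numerator and one left over in the
denominator would have clusters that cross. -/
theorem not_both {a b c d : Label n} {j k : Fin n}
    (hj : Y.e j a d + Y.e j b c < Y.e j a c + Y.e j b d)
    (hk : Y.e k a c + Y.e k b d < Y.e k a d + Y.e k b c) : False := by
  obtain ⟨h1, h2, h3⟩ := Y.e_eq_zero_or j hj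
  obtain ⟨h4, h5, h6⟩ := Y.e_eq_zero_or (a := a) (b := b) (c := d) (d := c) k hk
  rcases h3 with h3 | h3 <;> rcases h6 with h6 | h6
  · exact (Y.nest h3 h6).elim h1 h4
  · exact (Y.nest (Y.symm h3) (Y.symm h6)).elim (fun h => h2 (Y.symm h)) fun h => h4 (Y.symm h)
  · exact (Y.nest (Y.symm h3) (Y.symm h6)).elim (fun h => h1 (Y.symm h)) fun h => h5 (Y.symm h)
  · exact (Y.nest h3 h6).elim h2 h5

theorem num_ne_zero_or_den_ne_zero {u : Fin n → ℂ} (hu : u ∈ Y.U) {a b c d : Label n}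
    (hac : a ≠ c) (had : a ≠ d) (hbc : b ≠ c) (hbd : b ≠ d) :
    eval u (Y.num a b c d) ≠ 0 ∨ eval u (Y.den a b c d) ≠ 0 := by
  by_cases h : ∃ j, Y.e j a d + Y.e j b c < Y.e j a c + Y.e j b d
  · right
    obtain ⟨j, hj⟩ := h
    rw [den, Finset.prod_eq_one, one_mul, map_mul]
    · exact mul_ne_zero (hu _ _ had) (hu _ _ hbc)
    · intro k _
      rw [Nat.sub_eq_zero_of_le, pow_zero]
      by_contra hk
      exact Y.not_both hj (not_le.1 hk)
  · left
    rw [num, Finset.prod_eq_one, one_mul, map_mul]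
    · exact mul_ne_zero (hu _ _ hac) (hu _ _ hbd)
    · intro k _
      rw [Nat.sub_eq_zero_of_le, pow_zero]
      by_contra hk
      exact h ⟨k, not_le.1 hk⟩

/-- All the cross-ratios, as functions of the parameters. -/
noncomputable def crs (u : Fin n → ℂ) (q : Fin 4 ↪ Label n) : P1 :=
  toP1 (eval u (Y.num (q 0) (q 1) (q 2) (q 3))) (eval u (Y.den (q 0) (q 1) (q 2) (q 3)))

theorem quad_ne (q : Fin 4 ↪ Label n) {i j : Fin 4} (h : i ≠ j) : q i ≠ q j :=
  fun e => h (q.injective e)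

theorem num_ne_zero_or_den_ne_zero_quad {u : Fin n → ℂ} (hu : u ∈ Y.U) (q : Fin 4 ↪ Label n) :
    eval u (Y.num (q 0) (q 1) (q 2) (q 3)) ≠ 0 ∨ eval u (Y.den (q 0) (q 1) (q 2) (q 3)) ≠ 0 :=
  Y.num_ne_zero_or_den_ne_zero hu (quad_ne q (by decide)) (quad_ne q (by decide))
    (quad_ne q (by decide)) (quad_ne q (by decide))

theorem continuousAt_crs {u : Fin n → ℂ} (hu : u ∈ Y.U) : ContinuousAt Y.crs u := by
  rw [continuousAt_pi]
  intro q
  exact continuousAt_toP1 (continuous_eval _).continuousAt (continuous_eval _).continuousAt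
    (Y.num_ne_zero_or_den_ne_zero_quad hu q)

/-- The configuration with parameters `u`. -/
noncomputable def zv (u : Fin n → ℂ) (a : Label n) : ℂ := eval u (Y.z a)

theorem eval_dif (u : Fin n → ℂ) (a b : Label n) : eval u (dif Y.z a b) = dif (Y.zv u) a b :=
  map_dif (eval u) Y.z a b

theorem dif_zv_ne_zero {u : Fin n → ℂ} (hu : u ∈ Y.U) (h0 : ∀ j, u j ≠ 0) (a b : Label n)
    (hab : a ≠ b) : dif (Y.zv u) a b ≠ 0 := by
  rw [← eval_dif, Y.factor hab, map_mul, map_prod]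
  refine mul_ne_zero (Finset.prod_ne_zero_iff.2 fun j _ => ?_) (hu a b hab)
  simpa using h0 j

theorem crs_eq {u : Fin n → ℂ} (hu : u ∈ Y.U) (h : ∀ a b, a ≠ b → dif (Y.zv u) a b ≠ 0) :
    Y.crs u = (Mbar.ofConfig (zConfig (Y.zv u) h)).cr := by
  funext q
  rw [cr_ofConfig_zConfig]
  have h02 := h _ _ (quad_ne q (show (0 : Fin 4) ≠ 2 by decide))
  have h13 := h _ _ (quad_ne q (show (1 : Fin 4) ≠ 3 by decide))
  have h03 := h _ _ (quad_ne q (show (0 : Fin 4) ≠ 3 by decide))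
  have h12 := h _ _ (quad_ne q (show (1 : Fin 4) ≠ 2 by decide))
  have key := congrArg (eval u) (Y.num_den (quad_ne q (show (0 : Fin 4) ≠ 2 by decide))
    (quad_ne q (show (0 : Fin 4) ≠ 3 by decide)) (quad_ne q (show (1 : Fin 4) ≠ 2 by decide))
    (quad_ne q (show (1 : Fin 4) ≠ 3 by decide)))
  simp only [map_mul, eval_dif] at key
  have hden : eval u (Y.den (q 0) (q 1) (q 2) (q 3)) ≠ 0 := by
    intro h0
    rw [h0, mul_zero, eq_comm, mul_eq_zero] at key
    have hn := key.resolve_left (mul_ne_zero h03 h12)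
    exact (Y.num_ne_zero_or_den_ne_zero_quad hu q).elim (fun h => h hn) (fun h => h h0)
  rw [crs, toP1_of_ne hden, OnePoint.coe_eq_coe, div_eq_div_iff hden (mul_ne_zero h03 h12)]
  linear_combination -key

theorem dense_ne_zero : Dense {u : Fin n → ℂ | ∀ j, u j ≠ 0} := by
  have := dense_pi (Set.univ : Set (Fin n)) (s := fun _ => ({0}ᶜ : Set ℂ))
    fun j _ => dense_compl_singleton 0
  refine this.mono fun u hu j => ?_
  simpa using hu j (mem_univ j)

/-- Where no parameter vanishes the family consists of honest configurations, and these parameters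
are dense in `U`. -/
theorem crs_mem {u : Fin n → ℂ} (hu : u ∈ Y.U) :
    Y.crs u ∈ closure (Set.range (crossRatios : (Label n ↪ P1) → ((Fin 4 ↪ Label n) → P1))) := by
  have h1 : u ∈ closure (Y.U ∩ {u : Fin n → ℂ | ∀ j, u j ≠ 0}) :=
    dense_ne_zero.open_subset_closure_inter Y.isOpen_U hu
  have h2 := (Y.continuousAt_crs hu).continuousWithinAt.mem_closure_image h1
  refine closure_mono ?_ h2
  rintro _ ⟨v, ⟨hv, hv0⟩, rfl⟩
  rw [Y.crs_eq hv (Y.dif_zv_ne_zero hv hv0)]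
  exact ⟨_, rfl⟩

/-- The family of stable curves with parameters in `U`. -/
noncomputable def psi (u : Y.U) : Mbar (Label n) := ⟨Y.crs u, Y.crs_mem u.2⟩

theorem continuous_psi : Continuous Y.psi := by
  refine Continuous.subtype_mk ?_ _
  rw [continuous_iff_continuousAt]
  intro u
  exact (Y.continuousAt_crs u.2).comp continuous_subtype_val.continuousAt

theorem psi_eq (u : Y.U) (h : ∀ a b, a ≠ b → dif (Y.zv u) a b ≠ 0) :
    Y.psi u = Mbar.ofConfig (zConfig (Y.zv u) h) :=
  Mbar.ext fun q => congrFun (Y.crs_eq u.2 h) q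

/-- On the locus of finite values, the cross-ratios are quotients of polynomials. -/
theorem analyticAt_crs {u : Fin n → ℂ} (q : Fin 4 ↪ Label n)
    (h : Y.crs u q ≠ OnePoint.infty) : AnalyticAt ℂ (fun v => finVal (Y.crs v q)) u := by
  simp only [crs, finVal_toP1]
  exact (AnalyticOnNhd.eval_mvPolynomial _ u (mem_univ _)).div
    (AnalyticOnNhd.eval_mvPolynomial _ u (mem_univ _)) (toP1_ne_infty.1 h)

/-- If the difference of `a` and `b` contains a parameter that is zero and does not occur in the
other differences, then the cross-ratio is `1`. -/
theorem crs_eq_one {u : Fin n → ℂ} (hu : u ∈ Y.U) {j : Fin n} (hj : u j = 0) (q : Fin 4 ↪ Label n)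
    (h01 : Y.r j (q 0) (q 1)) (h02 : ¬ Y.r j (q 0) (q 2)) (h03 : ¬ Y.r j (q 0) (q 3)) :
    Y.crs u q = ((1 : ℂ) : P1) := by
  have n01 := quad_ne q (show (0 : Fin 4) ≠ 1 by decide)
  have n02 := quad_ne q (show (0 : Fin 4) ≠ 2 by decide)
  have n03 := quad_ne q (show (0 : Fin 4) ≠ 3 by decide)
  have n12 := quad_ne q (show (1 : Fin 4) ≠ 2 by decide)
  have n13 := quad_ne q (show (1 : Fin 4) ≠ 3 by decide)
  have n23 := quad_ne q (show (2 : Fin 4) ≠ 3 by decide)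
  generalize ha : q 0 = a at *
  generalize hb : q 1 = b at *
  generalize hc : q 2 = c at *
  generalize hd : q 3 = d at *
  have h12 : ¬ Y.r j b c := fun h => h02 (Y.trans h01 h)
  have h13 : ¬ Y.r j b d := fun h => h03 (Y.trans h01 h)
  -- Numerator and denominator have the same monomial: an excess of `k` relates one of `a, b` to one
  -- of `c, d`; comparison with `j` through `nest` then relates `a` and `b` by `k`, which cancels
  -- the excess.
  have heq : ∀ k, Y.e k a c + Y.e k b d = Y.e k a d + Y.e k b c := by
    intro k
    by_contra hne
    rcases lt_or_gt_of_ne hne with hlt | hlt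
    · obtain ⟨h1, h2, h3⟩ := Y.e_eq_zero_or (a := a) (b := b) (c := d) (d := c) k hlt
      rcases h3 with h3 | h3
      · exact (Y.nest h01 h3).elim h03 fun h => h2 (Y.trans (Y.symm h) h3)
      · exact (Y.nest (Y.symm h01) h3).elim h12 fun h => h1 (Y.trans (Y.symm h) h3)
    · obtain ⟨h1, h2, h3⟩ := Y.e_eq_zero_or (a := a) (b := b) (c := c) (d := d) k hlt
      rcases h3 with h3 | h3
      · exact (Y.nest h01 h3).elim h02 fun h => h2 (Y.trans (Y.symm h) h3)
      · exact (Y.nest (Y.symm h01) h3).elim h13 fun h => h1 (Y.trans (Y.symm h) h3)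
  have hnum : Y.num a b c d = Y.P a c * Y.P b d := by
    rw [num, Finset.prod_eq_one, one_mul]
    intro k _
    rw [heq k, Nat.sub_self, pow_zero]
  have hden : Y.den a b c d = Y.P a d * Y.P b c := by
    rw [den, Finset.prod_eq_one, one_mul]
    intro k _
    rw [heq k, Nat.sub_self, pow_zero]
  -- the Plücker relation, divided by the common monomial
  have hle : ∀ k, Y.e k a c + Y.e k b d ≤ Y.e k a b + Y.e k c d := by
    intro k
    by_contra hlt
    obtain ⟨h1, h2, h3⟩ := Y.e_eq_zero_or (a := a) (b := d) (c := c) (d := b) k (by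
      have : Y.e k d b = Y.e k b d := by
        unfold e; congr 1; exact propext ⟨Y.symm, Y.symm⟩
      have : Y.e k d c = Y.e k c d := by
        unfold e; congr 1; exact propext ⟨Y.symm, Y.symm⟩
      omega)
    rcases h3 with h3 | h3
    · exact (Y.nest h01 h3).elim h02 h1
    · exact (Y.nest (Y.symm h01) (Y.symm h3)).elim h13 fun h => h1 (Y.symm h)
  -- After division, the right side of the Plücker relation still contains `X j`, hence vanishes at
  -- `u`.
  have hlt : Y.e j a c + Y.e j b d < Y.e j a b + Y.e j c d := by
    simp [e, h01, h02, h13]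
  have hpl := dif_plucker Y.z a b c d
  rw [Y.factor n02, Y.factor n13, Y.factor n03, Y.factor n12, Y.factor n01, Y.factor n23] at hpl
  simp only [prod_filter_eq] at hpl
  have hM0 : (∏ k, (X k : MvPolynomial (Fin n) ℂ) ^ (Y.e k a c + Y.e k b d)) ≠ 0 :=
    Finset.prod_ne_zero_iff.2 fun k _ => pow_ne_zero _ (X_ne_zero k)
  have hpoly : Y.P a c * Y.P b d - Y.P a d * Y.P b c =
      (∏ k, (X k : MvPolynomial (Fin n) ℂ) ^ ((Y.e k a b + Y.e k c d) - (Y.e k a c + Y.e k b d)))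
        * (Y.P a b * Y.P c d) := by
    apply mul_left_cancel₀ hM0
    have e1 : (∏ k, (X k : MvPolynomial (Fin n) ℂ) ^ (Y.e k a c + Y.e k b d))
        = (∏ k, X k ^ Y.e k a c) * ∏ k, X k ^ Y.e k b d := by
      simp only [← Finset.prod_mul_distrib, ← pow_add]
    have e2 : (∏ k, (X k : MvPolynomial (Fin n) ℂ) ^ (Y.e k a c + Y.e k b d))
        = (∏ k, X k ^ Y.e k a d) * ∏ k, X k ^ Y.e k b c := by
      simp only [← Finset.prod_mul_distrib, ← pow_add, heq]
    have e3 : (∏ k, (X k : MvPolynomial (Fin n) ℂ) ^ (Y.e k a c + Y.e k b d)) *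
        (∏ k, (X k : MvPolynomial (Fin n) ℂ) ^ ((Y.e k a b + Y.e k c d) -
          (Y.e k a c + Y.e k b d)))
        = (∏ k, X k ^ Y.e k a b) * ∏ k, X k ^ Y.e k c d := by
      simp only [← Finset.prod_mul_distrib, ← pow_add]
      refine Finset.prod_congr rfl fun k _ => ?_
      congr 1
      have := hle k
      omega
    linear_combination hpl + (Y.P a c * Y.P b d) * e1 - (Y.P a d * Y.P b c) * e2
      - (Y.P a b * Y.P c d) * e3
  have hev := congrArg (eval u) hpoly
  have hz : eval u (∏ k, (X k : MvPolynomial (Fin n) ℂ) ^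
      ((Y.e k a b + Y.e k c d) - (Y.e k a c + Y.e k b d))) = 0 := by
    rw [map_prod]
    refine Finset.prod_eq_zero (Finset.mem_univ j) ?_
    rw [map_pow, eval_X, hj, zero_pow (by omega)]
  rw [map_mul, hz, zero_mul, map_sub, map_mul, map_mul, sub_eq_zero] at hev
  have hne : eval u (Y.P a d) * eval u (Y.P b c) ≠ 0 := mul_ne_zero (hu _ _ n03) (hu _ _ n12)
  rw [crs, ha, hb, hc, hd, hnum, hden, map_mul, map_mul, toP1_of_ne hne, hev, div_self hne]

end DifSystem

end ZetaModuli

namespace ZetaModuli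

variable {n : ℕ}

open MvPolynomial

/-! ### Coordinates adapted to a stable curve -/

theorem eq_zero_of_openStratum {S : Type} {f : Mbar S → ℂ} {p : Mbar S} (hf : ContinuousAt f p)
    (h : ∀ p' ∈ openStratum S, f p' = 0) : f p = 0 := by
  by_contra hne
  obtain ⟨p', hp', h0⟩ := ((dense_openStratum S).inter_nhds_nonempty (hf.eventually_ne hne))
  exact h0 (h p' hp')

theorem cr_zConfig_of_infty {x : Label n → ℂ} (hx : ∀ a b, a ≠ b → dif x a b ≠ 0)
    {q : Fin 4 ↪ Label n} (hq : q 1 = .infty) : (Mbar.ofConfig (zConfig x hx)).cr q =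
      (((x (q 0) - x (q 2)) / (x (q 0) - x (q 3)) : ℂ) : P1) := by
  have h0 : q 0 ≠ .infty := hq ▸ DifSystem.quad_ne q (by decide)
  have h2 : q 2 ≠ .infty := hq ▸ DifSystem.quad_ne q (by decide)
  have h3 : q 3 ≠ .infty := hq ▸ DifSystem.quad_ne q (by decide)
  rw [cr_ofConfig_zConfig, hq, dif_infty_left _ h2, dif_infty_left _ h3, mul_one, mul_one,
    dif_fin _ h0 h2, dif_fin _ h0 h3]

/-- The label `c` is at least as close to `a` as any other label of `A`, up to bounded factors,
near the stable curve `p`. -/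
def IsClosest (p : Mbar (Label n)) (A : Finset (Label n)) (a c : Label n) : Prop :=
  (∀ q : Fin 4 ↪ Label n, q 0 = a → q 1 = .infty → q 2 = c → q 3 ∈ A →
    p.cr q ≠ OnePoint.infty) ∧
  ∀ q : Fin 4 ↪ Label n, q 0 ∈ A → q 1 = .infty → q 2 = a → q 3 = c → p.cr q ≠ OnePoint.infty

/-- On the open stratum take a pair at minimal distance. The resulting bounds on cross-ratios are
closed conditions, and there are finitely many pairs, so the bounds for one of the pairs hold at
`p`. -/
theorem exists_isClosest (p : Mbar (Label n)) (A : Finset (Label n)) (hA : .infty ∉ A)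
    (hcard : 2 ≤ A.card) : ∃ a ∈ A, ∃ c ∈ A, a ≠ c ∧ IsClosest p A a c := by
  -- Minimality bounds the first kind of ratio by `1`; the second kind costs a triangle inequality,
  -- whence `2`.
  let B : Set P1 := {x : P1 | ∃ w : ℂ, x = (w : P1) ∧ ‖w‖ ≤ 2}
  have hB : IsClosed B := isClosed_norm_le 2
  have hBi : ∀ x ∈ B, x ≠ OnePoint.infty := by
    rintro _ ⟨w, rfl, -⟩
    exact OnePoint.coe_ne_infty w
  let K : Label n × Label n → Set (Mbar (Label n)) := fun ac =>
    (⋂ q ∈ {q : Fin 4 ↪ Label n | q 0 = ac.1 ∧ q 1 = .infty ∧ q 2 = ac.2 ∧ q 3 ∈ A},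
      {p | p.cr q ∈ B}) ∩
    ⋂ q ∈ {q : Fin 4 ↪ Label n | q 0 ∈ A ∧ q 1 = .infty ∧ q 2 = ac.1 ∧ q 3 = ac.2},
      {p | p.cr q ∈ B}
  have hK : ∀ ac, IsClosed (K ac) := fun ac =>
    (isClosed_biInter fun q _ => hB.preimage (Mbar.continuous_cr q)).inter
      (isClosed_biInter fun q _ => hB.preimage (Mbar.continuous_cr q))
  have hclosed : IsClosed (⋃ ac ∈ A.offDiag, K ac) :=
    isClosed_biUnion_finset fun ac _ => hK ac
  have hsub : openStratum (Label n) ⊆ ⋃ ac ∈ A.offDiag, K ac := by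
    intro p' hp'
    obtain ⟨x, hx, -, -, rfl⟩ := exists_normalized hp' (a₀ := .zero) (b₀ := .one) (by simp)
      (by simp) (by simp)
    have hne : A.offDiag.Nonempty := by
      obtain ⟨a, ha, b, hb, hab⟩ := Finset.one_lt_card.1 hcard
      exact ⟨(a, b), by simp [ha, hb, hab]⟩
    obtain ⟨⟨a, c⟩, hac, hmin⟩ :=
      A.offDiag.exists_min_image (fun ac => ‖x ac.1 - x ac.2‖) hne
    rw [Finset.mem_offDiag] at hac
    obtain ⟨ha, hc, hne⟩ := hac
    have hfin : ∀ {l}, l ∈ A → l ≠ .infty := fun hl e => hA (e ▸ hl)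
    have hsubne : ∀ {l l'}, l ∈ A → l' ∈ A → l ≠ l' → x l - x l' ≠ 0 := by
      intro l l' hl hl' h
      rw [← dif_fin x (hfin hl) (hfin hl')]
      exact hx _ _ h
    simp only [mem_iUnion]
    refine ⟨(a, c), by simp [ha, hc, hne], ?_, ?_⟩
    · simp only [mem_iInter]
      rintro q ⟨h0, h1, h2, h3⟩
      refine ⟨_, cr_zConfig_of_infty hx h1, ?_⟩
      dsimp only at h0 h2 hne ha hc
      have hne3 : a ≠ q 3 := h0 ▸ DifSystem.quad_ne q (by decide)
      have hm := hmin (a, q 3) (by simp [ha, h3, hne3])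
      rw [h0, h2, norm_div, div_le_iff₀ (norm_pos_iff.2 (hsubne ha h3 hne3))]
      dsimp only at hm
      linarith [norm_nonneg (x a - x (q 3))]
    · simp only [mem_iInter]
      rintro q ⟨h0, h1, h2, h3⟩
      refine ⟨_, cr_zConfig_of_infty hx h1, ?_⟩
      dsimp only at h3 h2 hne ha hc
      have hne3 : q 0 ≠ c := h3 ▸ DifSystem.quad_ne q (by decide)
      have hm := hmin (q 0, c) (by simp [hc, h0, hne3])
      rw [h2, h3, norm_div, div_le_iff₀ (norm_pos_iff.2 (hsubne h0 hc hne3))]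
      dsimp only at hm
      have : x (q 0) - x a = (x (q 0) - x c) - (x a - x c) := by ring
      rw [this]
      have := norm_sub_le (x (q 0) - x c) (x a - x c)
      linarith
  have hp : p ∈ ⋃ ac ∈ A.offDiag, K ac :=
    hclosed.closure_subset_iff.2 hsub (dense_openStratum _ p)
  simp only [mem_iUnion] at hp
  obtain ⟨⟨a, c⟩, hac, h1, h2⟩ := hp
  rw [Finset.mem_offDiag] at hac
  simp only [mem_iInter] at h1 h2
  exact ⟨a, hac.1, c, hac.2.1, hac.2.2, fun q e0 e1 e2 e3 => hBi _ (h1 q ⟨e0, e1, e2, e3⟩),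
    fun q e0 e1 e2 e3 => hBi _ (h2 q ⟨e0, e1, e2, e3⟩)⟩

/-- Coordinates, indexed by `V`, for the finite labels in `A`, adapted to the stable curve `p`. The
coordinate `k` is the cross-ratio of the quadruple `q k`, and vanishes where the labels in the
cluster `C k` come together. The difference of two points is the product of the coordinates whose
clusters contain both, times a polynomial that does not vanish at `p`. The point `w a` is closest to
`a`. -/
structure TreeModel (p : Mbar (Label n)) (A : Finset (Label n)) (V : Finset (Fin n)) where
  z : Label n → MvPolynomial (Fin n) ℂ
  C : Fin n → Finset (Label n)
  q : Fin n → (Fin 4 ↪ Label n)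
  a₀ : Label n
  b₀ : Label n
  w : Label n → Label n
  sg : Label n → ℂ
  a₀_ne_b₀ : a₀ ≠ b₀
  a₀_ne : a₀ ≠ .infty
  b₀_ne : b₀ ≠ .infty
  infty_notMem : .infty ∉ A
  card_eq : A.card = V.card + 2
  C_subset : ∀ k, C k ⊆ A
  C_eq_empty : ∀ k, k ∉ V → C k = ∅
  C_nontrivial : ∀ k ∈ V, (C k).Nontrivial
  C_proper : ∀ k, ∃ b ∈ A, b ∉ C k
  laminar : ∀ {j k a b c}, a ∈ C j → b ∈ C j → a ∈ C k → c ∈ C k → c ∈ C j ∨ b ∈ C k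
  w_mem : ∀ a ∈ A, w a ∈ A ∧ w a ≠ a
  sg_ne : ∀ a, sg a ≠ 0
  partner : ∀ a ∈ A, z (w a) - z a = MvPolynomial.C (sg a) * ∏ j with a ∈ C j, X j
  factor : ∀ a ∈ A, ∀ b ∈ A, a ≠ b → ∃ P, z a - z b = (∏ j with a ∈ C j ∧ b ∈ C j, X j) * P ∧
    ∀ u : Fin n → ℂ, (∀ k ∈ V, u k = finVal (p.cr (q k))) → eval u P ≠ 0
  q_one : ∀ k ∈ V, q k 1 = .infty
  q_eq : ∀ k ∈ V, z (q k 0) - z (q k 2) = X k * (z (q k 0) - z (q k 3))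
  q_mem : ∀ k ∈ V, q k 0 ∈ A ∧ q k 2 ∈ A ∧ q k 3 ∈ A
  cr_ne : ∀ k ∈ V, p.cr (q k) ≠ OnePoint.infty
  recon : ∀ x : Label n → ℂ, (∀ a b, a ≠ b → dif x a b ≠ 0) → x a₀ = 0 → x b₀ = 1 →
    ∀ u : Fin n → ℂ, (∀ k ∈ V, u k = (x (q k 0) - x (q k 2)) / (x (q k 0) - x (q k 3))) →
    ∀ l ∈ A, eval u (z l) = x l

theorem exists_treeModel_pair (p : Mbar (Label n)) {a b : Label n} (hab : a ≠ b)
    (ha : a ≠ .infty) (hb : b ≠ .infty) : Nonempty (TreeModel p {a, b} ∅) := by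
  refine ⟨{
    z := fun l => if l = b then 1 else 0
    C := fun _ => ∅
    -- Arbitrary: no coordinate is in use yet.
    q := tQuad
    a₀ := a
    b₀ := b
    w := fun l => if l = a then b else a
    sg := fun l => if l = a then 1 else -1
    a₀_ne_b₀ := hab
    a₀_ne := ha
    b₀_ne := hb
    infty_notMem := by simp [ha.symm, hb.symm]
    card_eq := by simp [hab]
    C_subset := by simp
    C_eq_empty := by simp
    C_nontrivial := by simp
    C_proper := by simp
    laminar := by simp
    w_mem := by simp [hab, hab.symm]
    sg_ne := fun l => by split_ifs <;> simp
    partner := by simp [hab, hab.symm]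
    factor := ?_
    q_one := by simp
    q_eq := by simp
    q_mem := by simp
    cr_ne := by simp
    recon := by
      intro x hx hxa hxb u _ l hl
      simp only [Finset.mem_insert, Finset.mem_singleton] at hl
      rcases hl with rfl | rfl
      · simp [hab, hxa]
      · simp [hxb] }⟩
  intro l hl l' hl' hne
  refine ⟨_, by simp; rfl, fun u _ => ?_⟩
  simp only [Finset.mem_insert, Finset.mem_singleton] at hl hl'
  rcases hl with rfl | rfl <;> rcases hl' with rfl | rfl
  · exact absurd rfl hne
  · simp [hab]
  · simp [hab]
  · exact absurd rfl hne

/-- Put `c` at `z a + X k * (z (w a) - z a)`. The difference of `w a` and `a` is a constant times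
the product of all coordinates whose clusters contain `a`, so the new difference is that product
times `X k`, and `{a, c}` becomes an innermost cluster. The new coordinate is finite at `p` because
`c` is closest to `a`. -/
theorem TreeModel.insert_label {p : Mbar (Label n)} {A : Finset (Label n)} {V : Finset (Fin n)}
    (T : TreeModel p A V) {a c : Label n} {k : Fin n} (ha : a ∈ A) (hcA : c ∉ A)
    (hc : c ≠ .infty) (hk : k ∉ V) (hcl : IsClosest p (insert c A) a c) :
    Nonempty (TreeModel p (insert c A) (insert k V)) := by
  have hne : ∀ {l}, l ∈ A → l ≠ c := fun hl e => hcA (e ▸ hl)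
  have hfin : ∀ {l}, l ∈ A → l ≠ .infty := fun hl e => T.infty_notMem (e ▸ hl)
  have hac : a ≠ c := hne ha
  obtain ⟨hwA, hwa⟩ := T.w_mem a ha
  have hCk : T.C k = ∅ := T.C_eq_empty k hk
  let z' : Label n → MvPolynomial (Fin n) ℂ :=
    Function.update T.z c (T.z a + X k * (T.z (T.w a) - T.z a))
  have z'A : ∀ {l}, l ∈ A → z' l = T.z l := fun hl => Function.update_of_ne (hne hl) _ _
  have z'c : z' c = T.z a + X k * (T.z (T.w a) - T.z a) := Function.update_self ..
  -- The label `c` joins every old cluster that contains `a`.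
  let tw : Label n → Label n := fun l => if l = c then a else l
  have twA : ∀ {l}, l ∈ A → tw l = l := fun hl => if_neg (hne hl)
  have twc : tw c = a := if_pos rfl
  let C' : Fin n → Finset (Label n) := fun j =>
    (insert c A).filter fun l => tw l ∈ T.C j ∨ (j = k ∧ (l = a ∨ l = c))
  have memA : ∀ {l} j, l ∈ A → (l ∈ C' j ↔ l ∈ T.C j ∨ (j = k ∧ l = a)) := by
    intro l j hl
    simp only [C', Finset.mem_filter, Finset.mem_insert, hl, or_true, true_and, twA hl, hne hl,
      or_false]
  have memc : ∀ j, c ∈ C' j ↔ a ∈ T.C j ∨ j = k := by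
    intro j
    simp [C', twc]
  let qk : Fin 4 ↪ Label n := mkQuad a .infty c (T.w a) (hfin ha) hac hwa.symm hc.symm
    (hfin hwA).symm (hne hwA).symm
  have qk0 : qk 0 = a := rfl
  have qk1 : qk 1 = .infty := rfl
  have qk2 : qk 2 = c := rfl
  have qk3 : qk 3 = T.w a := rfl
  let q' : Fin n → (Fin 4 ↪ Label n) := Function.update T.q k qk
  have q'V : ∀ {j}, j ∈ V → q' j = T.q j := fun {j} hj =>
    Function.update_of_ne (show j ≠ k from fun e => hk (e ▸ hj)) _ _
  have q'k : q' k = qk := Function.update_self ..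
  -- From now on `a` and `c` are each other's closest points.
  let w' : Label n → Label n := Function.update (Function.update T.w a c) c a
  have w'c : w' c = a := Function.update_self ..
  have w'a : w' a = c := by
    simp only [w']
    rw [Function.update_of_ne hac, Function.update_self]
  have w'A : ∀ {l}, l ∈ A → l ≠ a → w' l = T.w l := fun hl hla => by
    simp only [w']
    rw [Function.update_of_ne (hne hl), Function.update_of_ne hla]
  let sg' : Label n → ℂ := Function.update T.sg c (-T.sg a)
  have sg'c : sg' c = -T.sg a := Function.update_self ..
  have sg'A : ∀ {l}, l ∈ A → sg' l = T.sg l := fun hl => Function.update_of_ne (hne hl) _ _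
  have hpart := T.partner a ha
  -- monomials
  have filtA : ∀ {l l'}, l ∈ A → l' ∈ A → l ≠ l' →
      (Finset.univ.filter fun j => l ∈ C' j ∧ l' ∈ C' j)
        = Finset.univ.filter fun j => l ∈ T.C j ∧ l' ∈ T.C j := by
    intro l l' hl hl' hll
    ext j
    simp only [Finset.mem_filter, Finset.mem_univ, true_and, memA j hl, memA j hl']
    by_cases hj : j = k
    · subst hj
      simp only [hCk, Finset.notMem_empty, false_or, true_and, false_and, iff_false]
      rintro ⟨rfl, rfl⟩
      exact hll rfl
    · simp [hj]
  have filtc : ∀ {b}, b ∈ A → b ≠ a → (Finset.univ.filter fun j => c ∈ C' j ∧ b ∈ C' j)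
        = Finset.univ.filter fun j => a ∈ T.C j ∧ b ∈ T.C j := by
    intro b hb hba
    ext j
    simp only [Finset.mem_filter, Finset.mem_univ, true_and, memA j hb, memc j]
    by_cases hj : j = k
    · subst hj
      simp [hCk, hba]
    · simp [hj]
  have filta : (Finset.univ.filter fun j => a ∈ C' j)
      = insert k (Finset.univ.filter fun j => a ∈ T.C j) := by
    ext j
    simp only [Finset.mem_filter, Finset.mem_univ, true_and, memA j ha, Finset.mem_insert]
    tauto
  have filtcc : (Finset.univ.filter fun j => c ∈ C' j)
      = insert k (Finset.univ.filter fun j => a ∈ T.C j) := by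
    ext j
    simp only [Finset.mem_filter, Finset.mem_univ, true_and, memc j, Finset.mem_insert]
    tauto
  have filtca : (Finset.univ.filter fun j => c ∈ C' j ∧ a ∈ C' j)
      = insert k (Finset.univ.filter fun j => a ∈ T.C j) := by
    ext j
    simp only [Finset.mem_filter, Finset.mem_univ, true_and, memc j, memA j ha, Finset.mem_insert]
    tauto
  have hkn : k ∉ Finset.univ.filter fun j => a ∈ T.C j := by simp [hCk]
  have recon' : ∀ x : Label n → ℂ, (∀ a b, a ≠ b → dif x a b ≠ 0) → x T.a₀ = 0 → x T.b₀ = 1 →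
      ∀ u : Fin n → ℂ,
      (∀ j ∈ insert k V, u j = (x (q' j 0) - x (q' j 2)) / (x (q' j 0) - x (q' j 3))) →
      ∀ l ∈ insert c A, eval u (z' l) = x l := by
    intro x hx hx0 hx1 u hu
    have hA : ∀ l ∈ A, eval u (T.z l) = x l := T.recon x hx hx0 hx1 u fun j hj => by
      rw [hu j (Finset.mem_insert_of_mem hj), q'V hj]
    intro l hl
    rcases Finset.mem_insert.1 hl with rfl | hl
    · rw [z'c, map_add, map_mul, map_sub, eval_X, hA _ ha, hA _ hwA,
        hu k (Finset.mem_insert_self ..), q'k, qk0, qk2, qk3]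
      have : x a - x (T.w a) ≠ 0 := by
        rw [← dif_fin x (hfin ha) (hfin hwA)]
        exact hx _ _ hwa.symm
      field_simp
      ring
    · rw [z'A hl, hA l hl]
  have hfac : ∀ b ∈ A, b ≠ a → ∃ P, z' c - z' b = (∏ j with c ∈ C' j ∧ b ∈ C' j, X j) * P ∧
      ∀ u : Fin n → ℂ, (∀ j ∈ insert k V, u j = finVal (p.cr (q' j))) → eval u P ≠ 0 := by
    intro b hb hba
    obtain ⟨P, hP, hP0⟩ := T.factor a ha b hb hba.symm
    have hsplit : (∏ j with a ∈ T.C j, (X j : MvPolynomial (Fin n) ℂ))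
        = (∏ j with a ∈ T.C j ∧ b ∈ T.C j, X j) * ∏ j with a ∈ T.C j ∧ b ∉ T.C j, X j := by
      rw [← Finset.prod_filter_mul_prod_filter_not
        (Finset.univ.filter fun j => a ∈ T.C j) (fun j => b ∈ T.C j), Finset.filter_filter,
        Finset.filter_filter]
    have hP' : z' c - z' b = (∏ j with c ∈ C' j ∧ b ∈ C' j, X j) *
        (P + X k * MvPolynomial.C (T.sg a) * ∏ j with a ∈ T.C j ∧ b ∉ T.C j, X j) := by
      rw [z'c, z'A hb, filtc hb hba]
      rw [hsplit] at hpart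
      linear_combination hP + X k * hpart
    refine ⟨_, hP', ?_⟩
    generalize P + X k * MvPolynomial.C (T.sg a) * (∏ j with a ∈ T.C j ∧ b ∉ T.C j, X j) = P'
      at hP'
    intro u hu
    -- The cross-ratio `(b - a) / (b - c)`, finite at `p`, times the new factor `P'` equals the old
    -- factor `P`. As `P` is nonzero at `p`, so is `P'`.
    let qb : Fin 4 ↪ Label n := mkQuad b .infty a c (hfin hb) hba (hne hb) (hfin ha).symm hc.symm
      hac
    have qb_ne : p.cr qb ≠ OnePoint.infty :=
      hcl.2 qb (Finset.mem_insert_of_mem hb) rfl rfl rfl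
    -- The coordinates of a variable curve; those not in use are frozen at `u`.
    let uV : Mbar (Label n) → Fin n → ℂ := fun p' j =>
      if j ∈ insert k V then finVal (p'.cr (q' j)) else u j
    have huV : uV p = u := by
      funext j
      by_cases hj : j ∈ insert k V
      · simp only [uV, if_pos hj, hu j hj]
      · simp only [uV, if_neg hj]
    have q'_ne : ∀ j ∈ insert k V, p.cr (q' j) ≠ OnePoint.infty := by
      intro j hj
      rcases Finset.mem_insert.1 hj with rfl | hj
      · rw [q'k]
        exact hcl.1 qk rfl rfl rfl (Finset.mem_insert_of_mem hwA)
      · rw [q'V hj]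
        exact T.cr_ne j hj
    have cuV : ContinuousAt uV p := by
      rw [continuousAt_pi]
      intro j
      by_cases hj : j ∈ insert k V
      · simp only [uV, if_pos hj]
        exact Mbar.continuousAt_finVal_cr (q'_ne j hj)
      · simp only [uV, if_neg hj]
        exact continuousAt_const
    have cev : ∀ Q : MvPolynomial (Fin n) ℂ, ContinuousAt (fun p' => eval (uV p') Q) p :=
      fun Q => (DifSystem.continuous_eval Q).continuousAt.comp cuV
    -- The identity is an elementary division on the open stratum and reaches `p` by continuity.
    have key := eq_zero_of_openStratum
      (f := fun p' => finVal (p'.cr qb) * eval (uV p') P' - eval (uV p') P) (p := p)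
      (((Mbar.continuousAt_finVal_cr qb_ne).mul (cev P')).sub (cev P)) (by
        intro p' hp'
        obtain ⟨x, hx, hx0, hx1, rfl⟩ := exists_normalized hp' T.a₀_ne_b₀ T.a₀_ne T.b₀_ne
        have hrec := recon' x hx hx0 hx1 (uV (Mbar.ofConfig (zConfig x hx))) (by
          intro j hj
          have hj1 : q' j 1 = .infty := by
            rcases Finset.mem_insert.1 hj with rfl | hj
            · rw [q'k]
              rfl
            · rw [q'V hj]
              exact T.q_one j hj
          simp only [uV, if_pos hj, cr_zConfig_of_infty hx hj1, finVal_coe])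
        set v := uV (Mbar.ofConfig (zConfig x hx))
        have e1 := congrArg (eval v) hP'
        have e2 := congrArg (eval v) hP
        rw [filtc hb hba] at e1
        rw [map_mul, map_sub, hrec c (Finset.mem_insert_self ..),
          hrec b (Finset.mem_insert_of_mem hb)] at e1
        rw [← z'A ha, ← z'A hb, map_mul, map_sub, hrec a (Finset.mem_insert_of_mem ha),
          hrec b (Finset.mem_insert_of_mem hb)] at e2
        have hcb : x b - x c ≠ 0 := by
          rw [← dif_fin x (hfin hb) hc]
          exact hx _ _ (hne hb)
        rw [cr_zConfig_of_infty hx (q := qb) rfl, finVal_coe]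
        change (x b - x a) / (x b - x c) * _ - _ = 0
        have hm : eval v (∏ j with a ∈ T.C j ∧ b ∈ T.C j, X j) ≠ 0 := by
          intro h0
          rw [h0, zero_mul] at e1
          exact hcb (by linear_combination -e1)
        have : (x b - x a) * eval v P' = eval v P * (x b - x c) := by
          apply mul_left_cancel₀ hm
          linear_combination (x b - x c) * e2 - (x b - x a) * e1
        rw [div_mul_eq_mul_div, this, mul_div_assoc, div_self hcb]
        ring)
    rw [huV] at key
    intro h0
    rw [h0, mul_zero, zero_sub, neg_eq_zero] at key
    exact hP0 u (fun j hj => by rw [hu j (Finset.mem_insert_of_mem hj), q'V hj]) key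
  have hfca : z' c - z' a = (∏ j with c ∈ C' j ∧ a ∈ C' j, X j) * MvPolynomial.C (T.sg a) := by
    rw [filtca, Finset.prod_insert hkn, z'c, z'A ha]
    linear_combination X k * hpart
  refine ⟨{
    z := z'
    C := C'
    q := q'
    a₀ := T.a₀
    b₀ := T.b₀
    w := w'
    sg := sg'
    a₀_ne_b₀ := T.a₀_ne_b₀
    a₀_ne := T.a₀_ne
    b₀_ne := T.b₀_ne
    infty_notMem := by simp [T.infty_notMem, hc.symm]
    card_eq := by
      rw [Finset.card_insert_of_notMem hcA, Finset.card_insert_of_notMem hk, T.card_eq]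
    C_subset := fun j => Finset.filter_subset _ _
    C_eq_empty := ?_
    C_nontrivial := ?_
    C_proper := ?_
    laminar := ?_
    w_mem := ?_
    sg_ne := ?_
    partner := ?_
    factor := ?_
    q_one := ?_
    q_eq := ?_
    q_mem := ?_
    cr_ne := ?_
    recon := recon' }⟩
  · intro j hj
    rw [Finset.mem_insert, not_or] at hj
    have hj0 := T.C_eq_empty j hj.2
    simp [C', hj0, hj.1]
  · intro j hj
    rcases Finset.mem_insert.1 hj with rfl | hj
    · exact ⟨a, (memA _ ha).2 (Or.inr ⟨rfl, rfl⟩), c, (memc _).2 (Or.inr rfl), hac⟩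
    · obtain ⟨x, hx, y, hy, hxy⟩ := T.C_nontrivial j hj
      exact ⟨x, (memA _ (T.C_subset j hx)).2 (Or.inl hx), y,
        (memA _ (T.C_subset j hy)).2 (Or.inl hy), hxy⟩
  · intro j
    by_cases hj : j = k
    · subst hj
      exact ⟨T.w a, Finset.mem_insert_of_mem hwA, by simp [memA _ hwA, hCk, hwa]⟩
    · obtain ⟨b, hb, hbj⟩ := T.C_proper j
      exact ⟨b, Finset.mem_insert_of_mem hb, by simp [memA _ hb, hbj, hj]⟩
  · intro i j x y t hxi hyi hxj htj
    simp only [C', Finset.mem_filter] at hxi hyi hxj htj ⊢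
    obtain ⟨hxA, hxi⟩ := hxi
    obtain ⟨hyA, hyi⟩ := hyi
    obtain ⟨-, hxj⟩ := hxj
    obtain ⟨htA, htj⟩ := htj
    have htw : ∀ l, l = a ∨ l = c → tw l = a := by
      rintro l (rfl | rfl)
      · exact twA ha
      · exact twc
    have hkk : ∀ l, tw l ∉ T.C k := by simp [hCk]
    by_cases hi : i = k
    · subst hi
      by_cases hj : j = i
      · subst hj
        exact Or.inl ⟨htA, htj⟩
      · right
        have hx' := (hxi.resolve_left (hkk _)).2
        have hy' := (hyi.resolve_left (hkk _)).2
        refine ⟨hyA, Or.inl ?_⟩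
        rw [htw _ hy', ← htw _ hx']
        exact hxj.resolve_right fun h => hj h.1
    · have hxi' := hxi.resolve_right fun h => hi h.1
      have hyi' := hyi.resolve_right fun h => hi h.1
      by_cases hj : j = k
      · subst hj
        left
        have hx' := (hxj.resolve_left (hkk _)).2
        have ht' := (htj.resolve_left (hkk _)).2
        refine ⟨htA, Or.inl ?_⟩
        rw [htw _ ht', ← htw _ hx']
        exact hxi'
      · have hxj := hxj.resolve_right fun h => hj h.1
        have htj := htj.resolve_right fun h => hj h.1
        exact (T.laminar hxi' hyi' hxj htj).imp (fun h => ⟨htA, Or.inl h⟩) fun h => ⟨hyA, Or.inl h⟩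
  · intro l hl
    rcases Finset.mem_insert.1 hl with rfl | hl
    · rw [w'c]
      exact ⟨Finset.mem_insert_of_mem ha, hac⟩
    · by_cases hla : l = a
      · subst hla
        rw [w'a]
        exact ⟨Finset.mem_insert_self .., hac.symm⟩
      · rw [w'A hl hla]
        exact ⟨Finset.mem_insert_of_mem (T.w_mem l hl).1, (T.w_mem l hl).2⟩
  · intro l
    by_cases hl : l = c
    · subst hl
      rw [sg'c]
      exact neg_ne_zero.2 (T.sg_ne a)
    · simp only [sg']
      rw [Function.update_of_ne hl]
      exact T.sg_ne l
  · intro l hl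
    rcases Finset.mem_insert.1 hl with rfl | hl
    · rw [w'c, sg'c, filtcc, Finset.prod_insert hkn, z'c, z'A ha, map_neg]
      linear_combination - X k * hpart
    · by_cases hla : l = a
      · subst hla
        rw [w'a, sg'A hl, filta, Finset.prod_insert hkn, z'c, z'A hl]
        linear_combination X k * hpart
      · rw [w'A hl hla, sg'A hl, z'A hl, z'A (T.w_mem l hl).1, T.partner l hl]
        congr 2
        ext j
        simp [memA j hl, hla]
  · intro x hx y hy hxy
    rcases Finset.mem_insert.1 hx with rfl | hxA <;> rcases Finset.mem_insert.1 hy with rfl | hyA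
    · exact absurd rfl hxy
    · by_cases hya : y = a
      · subst hya
        exact ⟨_, hfca, fun u _ => by rw [eval_C]; exact T.sg_ne y⟩
      · exact hfac y hyA hya
    · by_cases hxa : x = a
      · subst hxa
        refine ⟨-MvPolynomial.C (T.sg x), ?_, fun u _ => by
          rw [map_neg, eval_C]
          exact neg_ne_zero.2 (T.sg_ne x)⟩
        simp only [and_comm (a := x ∈ _)]
        linear_combination -hfca
      · obtain ⟨P, hP, hP0⟩ := hfac x hxA hxa
        refine ⟨-P, ?_, fun u hu => by
          rw [map_neg]
          exact neg_ne_zero.2 (hP0 u hu)⟩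
        simp only [and_comm (a := x ∈ _)]
        linear_combination -hP
    · obtain ⟨P, hP, hP0⟩ := T.factor x hxA y hyA hxy
      refine ⟨P, ?_, fun u hu => hP0 u fun j hj => ?_⟩
      · rw [z'A hxA, z'A hyA, filtA hxA hyA hxy, hP]
      · rw [hu j (Finset.mem_insert_of_mem hj), q'V hj]
  · intro j hj
    rcases Finset.mem_insert.1 hj with rfl | hj
    · rw [q'k]
      rfl
    · rw [q'V hj]
      exact T.q_one j hj
  · intro j hj
    rcases Finset.mem_insert.1 hj with rfl | hj
    · rw [q'k, qk0, qk2, qk3, z'A ha, z'c, z'A hwA]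
      ring
    · obtain ⟨h0, h2, h3⟩ := T.q_mem j hj
      rw [q'V hj, z'A h0, z'A h2, z'A h3]
      exact T.q_eq j hj
  · intro j hj
    rcases Finset.mem_insert.1 hj with rfl | hj
    · rw [q'k]
      exact ⟨Finset.mem_insert_of_mem ha, Finset.mem_insert_self ..,
        Finset.mem_insert_of_mem hwA⟩
    · obtain ⟨h0, h2, h3⟩ := T.q_mem j hj
      rw [q'V hj]
      exact ⟨Finset.mem_insert_of_mem h0, Finset.mem_insert_of_mem h2,
        Finset.mem_insert_of_mem h3⟩
  · intro j hj
    rcases Finset.mem_insert.1 hj with rfl | hj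
    · rw [q'k]
      exact hcl.1 qk rfl rfl rfl (Finset.mem_insert_of_mem hwA)
    · rw [q'V hj]
      exact T.cr_ne j hj

/-- The closest pair is chosen in all of `A` before one of its members is removed; the model of the
smaller set is then extended. -/
theorem exists_treeModel_of_card (p : Mbar (Label n)) (m : ℕ) (hm : m ≤ n) :
    ∀ A : Finset (Label n), .infty ∉ A → A.card = m + 2 →
      ∃ V : Finset (Fin n), V.card = m ∧ Nonempty (TreeModel p A V) := by
  induction m with
  | zero =>
    intro A hA hcard
    obtain ⟨a, b, hab, rfl⟩ := Finset.card_eq_two.1 hcard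
    simp only [Finset.mem_insert, Finset.mem_singleton, not_or] at hA
    exact ⟨∅, rfl, exists_treeModel_pair p hab (Ne.symm hA.1) (Ne.symm hA.2)⟩
  | succ m ih =>
    intro A hA hcard
    obtain ⟨a, ha, c, hc, hac, hcl⟩ := exists_isClosest p A hA (by omega)
    obtain ⟨V, hV, ⟨T⟩⟩ := ih (by omega) (A.erase c) (fun h => hA (Finset.mem_of_mem_erase h))
      (by rw [Finset.card_erase_of_mem hc]; omega)
    obtain ⟨k, hk⟩ : ∃ k, k ∉ V := by
      by_contra h
      push Not at h
      have : V = Finset.univ := Finset.eq_univ_iff_forall.2 h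
      rw [this, Finset.card_univ, Fintype.card_fin] at hV
      omega
    have hins : insert c (A.erase c) = A := Finset.insert_erase hc
    refine ⟨insert k V, by rw [Finset.card_insert_of_notMem hk, hV], ?_⟩
    have := T.insert_label (Finset.mem_erase.2 ⟨hac, ha⟩) (Finset.notMem_erase c A)
      (fun e => hA (e ▸ hc)) hk (by rw [hins]; exact hcl)
    rwa [hins] at this

theorem exists_treeModel (p : Mbar (Label n)) :
    Nonempty (TreeModel p (Finset.univ.erase .infty) Finset.univ) := by
  obtain ⟨V, hV, hT⟩ := exists_treeModel_of_card p n le_rfl (Finset.univ.erase .infty) (by simp)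
    (by rw [Finset.card_erase_of_mem (Finset.mem_univ _), Finset.card_univ, card_label]; omega)
  have : V = Finset.univ := Finset.eq_univ_of_card V (by rw [hV, Fintype.card_fin])
  rwa [this] at hT

end ZetaModuli

namespace ZetaModuli

variable {n : ℕ}

open MvPolynomial

/-! ### Holomorphic charts -/

namespace TreeModel

variable {p : Mbar (Label n)} (T : TreeModel p (Finset.univ.erase .infty) Finset.univ)

theorem mem_of_ne {a : Label n} (ha : a ≠ .infty) : a ∈ (Finset.univ : Finset (Label n)).erase .infty :=
  Finset.mem_erase.2 ⟨ha, Finset.mem_univ a⟩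

theorem infty_notMem_C (k : Fin n) : .infty ∉ T.C k :=
  fun h => T.infty_notMem (T.C_subset k h)

/-- The coordinates of a stable curve. -/
noncomputable def coord (p' : Mbar (Label n)) (k : Fin n) : ℂ := finVal (p'.cr (T.q k))

theorem exists_factor (a b : Label n) (hab : a ≠ b) :
    ∃ P, dif T.z a b = (∏ j with a ∈ T.C j ∧ b ∈ T.C j, X j) * P ∧ eval (T.coord p) P ≠ 0 := by
  by_cases ha : a = .infty
  · subst ha
    refine ⟨1, ?_, by simp⟩
    simp [dif_infty_left _ hab.symm, T.infty_notMem_C]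
  by_cases hb : b = .infty
  · subst hb
    refine ⟨-1, ?_, by simp⟩
    simp [dif_infty_right _ hab, T.infty_notMem_C]
  obtain ⟨P, hP, h0⟩ := T.factor a (mem_of_ne ha) b (mem_of_ne hb) hab
  exact ⟨P, by rw [dif_fin _ ha hb, hP], h0 _ fun k _ => rfl⟩

open Classical in
/-- The family of configurations given by the coordinates. -/
noncomputable def toDifSystem : DifSystem n where
  z := T.z
  r j a b := a ∈ T.C j ∧ b ∈ T.C j
  P a b := if h : a ≠ b then (T.exists_factor a b h).choose else 1
  symm h := ⟨h.2, h.1⟩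
  trans h h' := ⟨h.1, h'.2⟩
  nest h h' := (T.laminar h.1 h.2 h'.1 h'.2).imp (fun hc => ⟨h.1, hc⟩) fun hb => ⟨h'.1, hb⟩
  factor {a b} h := by
    rw [dif_pos h]
    convert (T.exists_factor a b h).choose_spec.1

theorem coord_mem_U : T.coord p ∈ T.toDifSystem.U := by
  intro a b h
  have := (T.exists_factor a b h).choose_spec.2
  simpa only [toDifSystem, dif_pos h]

theorem continuousAt_coord {p' : Mbar (Label n)} (h : ∀ k, p'.cr (T.q k) ≠ OnePoint.infty) :
    ContinuousAt T.coord p' :=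
  continuousAt_pi.2 fun k => Mbar.continuousAt_finVal_cr (h k)

/-- By `recon`, the coordinates determine all points of a configuration normalised by `a₀ ↦ 0`, `b₀
↦ 1`. -/
theorem crs_coord_of_openStratum {p' : Mbar (Label n)} (hp' : p' ∈ openStratum (Label n))
    (hU : T.coord p' ∈ T.toDifSystem.U) : T.toDifSystem.crs (T.coord p') = p'.cr := by
  obtain ⟨x, hx, hx0, hx1, rfl⟩ := exists_normalized hp' T.a₀_ne_b₀ T.a₀_ne T.b₀_ne
  have hrec := T.recon x hx hx0 hx1 (T.coord (Mbar.ofConfig (zConfig x hx))) fun k hk => by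
    rw [coord, cr_zConfig_of_infty hx (T.q_one k hk), finVal_coe]
  have hdif : ∀ a b, dif (T.toDifSystem.zv (T.coord (Mbar.ofConfig (zConfig x hx)))) a b
      = dif x a b := by
    intro a b
    unfold dif
    split_ifs with h1 h2 h2 <;> try rfl
    rw [← hrec a (mem_of_ne h1), ← hrec b (mem_of_ne h2)]
    rfl
  rw [T.toDifSystem.crs_eq hU fun a b h => by rw [hdif]; exact hx a b h]
  funext q
  simp only [cr_ofConfig_zConfig, hdif]

/-- Both sides are continuous and agree on the dense open stratum. -/
theorem crs_coord {p' : Mbar (Label n)} (h : ∀ k, p'.cr (T.q k) ≠ OnePoint.infty)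
    (hU : T.coord p' ∈ T.toDifSystem.U) : T.toDifSystem.crs (T.coord p') = p'.cr := by
  funext q
  have hc := T.continuousAt_coord h
  have h1 : ContinuousAt (fun p'' => T.toDifSystem.crs (T.coord p'') q) p' :=
    ((continuous_apply q).continuousAt.comp (T.toDifSystem.continuousAt_crs hU)).comp hc
  have h2 : ContinuousAt (fun p'' : Mbar (Label n) => p''.cr q) p' :=
    (Mbar.continuous_cr q).continuousAt
  refine tendsto_nhds_unique_of_frequently_eq h1 h2 ?_
  have hev : ∀ᶠ p'' in 𝓝 p', T.coord p'' ∈ T.toDifSystem.U :=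
    hc.eventually_mem (T.toDifSystem.isOpen_U.mem_nhds hU)
  have hfr := mem_closure_iff_frequently.1 (dense_openStratum (Label n) p')
  exact (hfr.and_eventually hev).mono fun p'' h => congrFun (T.crs_coord_of_openStratum h.1 h.2) q

theorem psi_coord {p' : Mbar (Label n)} (h : ∀ k, p'.cr (T.q k) ≠ OnePoint.infty)
    (hU : T.coord p' ∈ T.toDifSystem.U) : T.toDifSystem.psi ⟨T.coord p', hU⟩ = p' :=
  Mbar.ext fun q => congrFun (T.crs_coord h hU) q

theorem dif_z_ne_zero {a b : Label n} (hab : a ≠ b) : dif T.z a b ≠ 0 := by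
  obtain ⟨P, hP, h0⟩ := T.exists_factor a b hab
  rw [hP]
  refine mul_ne_zero (Finset.prod_ne_zero_iff.2 fun j _ => X_ne_zero j) ?_
  rintro rfl
  exact h0 (map_zero _)

/-- By `q_eq` this cross-ratio is `X k` already as a quotient of polynomials, so degenerate
parameters need no separate argument. -/
theorem crs_q {u : Fin n → ℂ} (hu : u ∈ T.toDifSystem.U) (k : Fin n) :
    T.toDifSystem.crs u (T.q k) = (u k : P1) := by
  have h1 := T.q_one k (Finset.mem_univ k)
  have n02 := DifSystem.quad_ne (T.q k) (show (0 : Fin 4) ≠ 2 by decide)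
  have n03 := DifSystem.quad_ne (T.q k) (show (0 : Fin 4) ≠ 3 by decide)
  have n12 := DifSystem.quad_ne (T.q k) (show (1 : Fin 4) ≠ 2 by decide)
  have n13 := DifSystem.quad_ne (T.q k) (show (1 : Fin 4) ≠ 3 by decide)
  have n01 := DifSystem.quad_ne (T.q k) (show (0 : Fin 4) ≠ 1 by decide)
  have key := T.toDifSystem.num_den n02 n03 n12 n13
  have hor := T.toDifSystem.num_ne_zero_or_den_ne_zero_quad hu (T.q k)
  rw [DifSystem.crs]
  rw [h1] at n01 n12 n13 key hor ⊢
  have hz := T.q_eq k (Finset.mem_univ k)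
  rw [← dif_fin _ n01 n12.symm, ← dif_fin _ n01 n13.symm] at hz
  change dif T.z _ _ * dif T.z _ _ * _ = dif T.z _ _ * dif T.z _ _ * _ at key
  rw [dif_infty_left _ n12.symm, dif_infty_left _ n13.symm, hz] at key
  have key2 : X k * T.toDifSystem.den (T.q k 0) .infty (T.q k 2) (T.q k 3)
      = T.toDifSystem.num (T.q k 0) .infty (T.q k 2) (T.q k 3) := by
    apply mul_left_cancel₀ (T.dif_z_ne_zero n03)
    linear_combination key
  rw [← key2, map_mul, eval_X] at hor ⊢
  have hden : eval u (T.toDifSystem.den (T.q k 0) .infty (T.q k 2) (T.q k 3)) ≠ 0 := by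
    rcases hor with h | h
    · exact right_ne_zero_of_mul h
    · exact h
  rw [toP1_of_ne hden, mul_div_assoc, div_self hden, mul_one]

theorem psi_mem_boundaryDivisor (u : T.toDifSystem.U) {k : Fin n} (hk : u.1 k = 0) :
    T.toDifSystem.psi u ∈ boundaryDivisor (T.C k : Set (Label n)) := by
  intro q h0 h1 h2 h3
  exact T.toDifSystem.crs_eq_one u.2 hk q ⟨h0, h1⟩ (fun h => h2 h.2) fun h => h3 h.2

/-- Outside the cluster lie `∞` and the finite label given by `C_proper`. -/
theorem isStablePartition_C (k : Fin n) : IsStablePartition (T.C k : Set (Label n)) := by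
  refine ⟨T.C_nontrivial k (Finset.mem_univ k), ?_⟩
  obtain ⟨b, hb, hbk⟩ := T.C_proper k
  exact ⟨.infty, fun h => T.infty_notMem_C k h, b, hbk, fun e => by
    subst e
    exact T.infty_notMem hb⟩

/-- The inverse of the coordinates. -/
noncomputable def inv (u : Fin n → ℂ) : Mbar (Label n) :=
  open Classical in if h : u ∈ T.toDifSystem.U then T.toDifSystem.psi ⟨u, h⟩ else p

theorem inv_of_mem {u : Fin n → ℂ} (h : u ∈ T.toDifSystem.U) :
    T.inv u = T.toDifSystem.psi ⟨u, h⟩ := dif_pos h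

theorem cr_inv {u : Fin n → ℂ} (h : u ∈ T.toDifSystem.U) (q : Fin 4 ↪ Label n) :
    (T.inv u).cr q = T.toDifSystem.crs u q := by
  rw [T.inv_of_mem h]
  rfl

theorem coord_inv {u : Fin n → ℂ} (h : u ∈ T.toDifSystem.U) : T.coord (T.inv u) = u := by
  funext k
  rw [coord, T.cr_inv h, T.crs_q h, finVal_coe]

/-- The chart with target `W`. -/
noncomputable def chart (W : Set (Fin n → ℂ)) (hW : IsOpen W) (hWU : W ⊆ T.toDifSystem.U) :
    OpenPartialHomeomorph (Mbar (Label n)) (Fin n → ℂ) where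
  toFun := T.coord
  invFun := T.inv
  source := {p' | (∀ k, p'.cr (T.q k) ≠ OnePoint.infty) ∧ T.coord p' ∈ W}
  target := W
  map_source' := fun _ h => h.2
  map_target' := by
    intro u hu
    refine ⟨fun k => ?_, ?_⟩
    · rw [T.cr_inv (hWU hu), T.crs_q (hWU hu)]
      exact OnePoint.coe_ne_infty _
    · rw [T.coord_inv (hWU hu)]
      exact hu
  left_inv' := by
    rintro p' ⟨h, hm⟩
    rw [T.inv_of_mem (hWU hm), T.psi_coord h]
  right_inv' := fun u hu => T.coord_inv (hWU hu)
  open_source := by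
    rw [isOpen_iff_mem_nhds]
    rintro p' ⟨h, hm⟩
    have h1 : ∀ᶠ p'' in 𝓝 p', ∀ k, p''.cr (T.q k) ≠ OnePoint.infty :=
      eventually_all.2 fun k => (Mbar.isOpen_cr_ne_infty (T.q k)).mem_nhds (h k)
    filter_upwards [h1, (T.continuousAt_coord h).eventually_mem (hW.mem_nhds hm)] with p'' a b
    exact ⟨a, b⟩
  open_target := hW
  continuousOn_toFun := fun p' h => (T.continuousAt_coord h.1).continuousWithinAt
  continuousOn_invFun := by
    have : ContinuousOn T.inv T.toDifSystem.U := by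
      rw [continuousOn_iff_continuous_domRestrict]
      have : T.toDifSystem.U.domRestrict T.inv = T.toDifSystem.psi := by
        funext u
        exact T.inv_of_mem u.2
      rw [this]
      exact T.toDifSystem.continuous_psi
    exact this.mono hWU

theorem isHolomorphicChart (W : Set (Fin n → ℂ)) (hW : IsOpen W) (hWU : W ⊆ T.toDifSystem.U) :
    IsHolomorphicChart (T.chart W hW hWU) where
  analytic_symm := by
    intro u hu q hq
    change (T.inv u).cr q ≠ _ at hq
    change AnalyticAt ℂ (fun w => finVal ((T.inv w).cr q)) u
    rw [T.cr_inv (hWU hu)] at hq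
    refine (T.toDifSystem.analyticAt_crs q hq).congr ?_
    filter_upwards [hW.mem_nhds hu] with v hv
    rw [T.cr_inv (hWU hv)]
  analytic := fun p' hp' =>
    -- The coordinates are themselves cross-ratios.
    ⟨n, T.q, id, hp'.1, analyticAt_id, Eventually.of_forall fun p'' => rfl⟩

end TreeModel

/-! ### The boundary as a union of divisors -/

theorem disjoint_boundaryDivisor_openStratum {P : Set (Label n)} (hP : IsStablePartition P)
    {p : Mbar (Label n)} (hp : p ∈ boundaryDivisor P) : p ∉ openStratum (Label n) := by
  intro ho
  obtain ⟨⟨a, ha, b, hb, hab⟩, c, hc, d, hd, hcd⟩ := hP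
  have hne : ∀ {x y}, x ∈ P → y ∈ Pᶜ → x ≠ y := fun hx hy e => hy (e ▸ hx)
  exact (cr_openStratum ho (mkQuad a b c d hab (hne ha hc) (hne ha hd) (hne hb hc) (hne hb hd)
    hcd)).2.2 (hp _ ha hb hc hd)

/-- In adapted coordinates at `p`, either some coordinate vanishes and `p` is on the divisor of its
cluster, or all differences are nonzero and `p` is a configuration. -/
theorem exists_boundaryDivisor {p : Mbar (Label n)} (hp : p ∉ openStratum (Label n)) :
    ∃ P, IsStablePartition P ∧ p ∈ boundaryDivisor P := by
  obtain ⟨T⟩ := exists_treeModel p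
  have hpsi := T.psi_coord (fun k => T.cr_ne k (Finset.mem_univ k)) T.coord_mem_U
  by_cases h : ∃ k, T.coord p k = 0
  · obtain ⟨k, hk⟩ := h
    refine ⟨_, T.isStablePartition_C k, ?_⟩
    have := T.psi_mem_boundaryDivisor ⟨_, T.coord_mem_U⟩ hk
    rwa [hpsi] at this
  · push Not at h
    exfalso
    apply hp
    have hz : ∀ a b, a ≠ b → dif (T.toDifSystem.zv (T.coord p)) a b ≠ 0 :=
      T.toDifSystem.dif_zv_ne_zero T.coord_mem_U h
    have := T.toDifSystem.psi_eq ⟨T.coord p, T.coord_mem_U⟩ hz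
    rw [hpsi] at this
    exact ⟨_, this.symm⟩

end ZetaModuli

namespace ZetaModuli

variable {n : ℕ}

open MvPolynomial

/-! ### Partial derivatives of polynomials -/

theorem exists_hasFDerivAt_eval (f : MvPolynomial (Fin n) ℂ) (u : Fin n → ℂ) :
    ∃ L : (Fin n → ℂ) →L[ℂ] ℂ, HasFDerivAt (fun v : Fin n → ℂ => eval v f) L u ∧
      ∀ v, L v = ∑ k, eval u (pderiv k f) * v k := by
  induction f using MvPolynomial.induction_on with
  | C a =>
    refine ⟨0, ?_, fun v => by simp⟩
    simp only [eval_C]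
    exact hasFDerivAt_const a u
  | add f g hf hg =>
    obtain ⟨L, hL, hL'⟩ := hf
    obtain ⟨L₂, hL₂, hL₂'⟩ := hg
    refine ⟨L + L₂, ?_, fun v => ?_⟩
    · simp only [map_add]
      exact hL.add hL₂
    · rw [add_apply, hL', hL₂', ← Finset.sum_add_distrib]
      refine Finset.sum_congr rfl fun k _ => ?_
      rw [map_add, map_add, add_mul]
  | mul_X f i hf =>
    obtain ⟨L, hL, hL'⟩ := hf
    have hX : HasFDerivAt (fun v : Fin n → ℂ => v i)
        (ContinuousLinearMap.proj i : (Fin n → ℂ) →L[ℂ] ℂ) u := hasFDerivAt_apply i u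
    refine ⟨eval u f • (ContinuousLinearMap.proj i : (Fin n → ℂ) →L[ℂ] ℂ) + u i • L, ?_,
      fun v => ?_⟩
    · simp only [map_mul, eval_X]
      exact hL.mul hX
    · have h2 : ∀ k, eval u (pderiv k (f * X i)) * v k = u i * (eval u (pderiv k f) * v k)
          + if k = i then eval u f * v i else 0 := by
        intro k
        rw [pderiv_mul]
        split_ifs with hk
        · subst hk
          simp only [pderiv_X_self, map_add, map_mul, eval_X, map_one]
          ring
        · simp only [pderiv_X_of_ne (Ne.symm hk), map_add, map_mul, eval_X, map_zero]
          ring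
      simp only [h2, Finset.sum_add_distrib, Finset.sum_ite_eq', Finset.mem_univ, if_true,
        add_apply, smul_apply, ContinuousLinearMap.proj_apply, smul_eq_mul, hL']
      rw [Finset.mul_sum, add_comm]

theorem differentiableAt_eval (f : MvPolynomial (Fin n) ℂ) (u : Fin n → ℂ) :
    DifferentiableAt ℂ (fun v : Fin n → ℂ => eval v f) u := by
  obtain ⟨L, hL, -⟩ := exists_hasFDerivAt_eval f u
  exact hL.differentiableAt

theorem fderiv_eval_apply (f : MvPolynomial (Fin n) ℂ) (u : Fin n → ℂ) (k : Fin n) :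
    fderiv ℂ (fun v : Fin n → ℂ => eval v f) u (Pi.single k 1) = eval u (pderiv k f) := by
  obtain ⟨L, hL, hL'⟩ := exists_hasFDerivAt_eval f u
  rw [hL.fderiv, hL', Finset.sum_eq_single k]
  · simp
  · intro j _ hj
    simp [Pi.single_eq_of_ne hj]
  · simp

/-- The quotient rule. -/
theorem fderiv_div_apply {𝕜 E : Type*} [NontriviallyNormedField 𝕜] [NormedAddCommGroup E]
    [NormedSpace 𝕜 E] {f g : E → 𝕜} {u : E}
    (hf : DifferentiableAt 𝕜 f u) (hg : DifferentiableAt 𝕜 g u) (h0 : g u ≠ 0) (e : E) :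
    fderiv 𝕜 (fun v => f v / g v) u e
      = (fderiv 𝕜 f u e * g u - f u * fderiv 𝕜 g u e) / g u ^ 2 := by
  have hd : DifferentiableAt 𝕜 (fun v => f v / g v) u := by
    simp only [div_eq_mul_inv]
    exact hf.fun_mul (hg.fun_inv h0)
  have hev : f =ᶠ[𝓝 u] fun v => f v / g v * g v := by
    filter_upwards [hg.continuousAt.eventually_ne h0] with v hv
    rw [div_mul_cancel₀ _ hv]
  have := hev.fderiv_eq (𝕜 := 𝕜)
  rw [fderiv_fun_mul hd hg] at this
  rw [this]
  simp only [add_apply, smul_apply, smul_eq_mul]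
  field_simp
  ring

/-- The Euler operator `X k ∂ₖ` multiplies a monomial by its exponent in `X k`; this is how
logarithmic poles become polynomial. -/
theorem X_mul_pderiv_prod (e : Fin n → ℕ) (k : Fin n) :
    X k * pderiv k (∏ j, (X j : MvPolynomial (Fin n) ℂ) ^ e j)
      = (e k : MvPolynomial (Fin n) ℂ) * ∏ j, X j ^ e j := by
  have : (∏ j, (X j : MvPolynomial (Fin n) ℂ) ^ e j)
      = monomial (Finsupp.equivFunOnFinite.symm e) 1 := by
    rw [monomial_eq, map_one, one_mul, Finsupp.prod_fintype _ _ fun _ => pow_zero _]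
    rfl
  rw [this, X_mul_pderiv_monomial]
  simp

/-- Modulo `x` the matrix has a zero column. -/
theorem dvd_det_of_column {R : Type*} [CommRing R] (x : R) (A : Matrix (Fin n) (Fin n) R)
    (k : Fin n) (h : ∀ i, x ∣ A i k) : x ∣ A.det := by
  rw [← Ideal.Quotient.eq_zero_iff_dvd, RingHom.map_det]
  exact Matrix.det_eq_zero_of_column_eq_zero k fun i =>
    (Ideal.Quotient.eq_zero_iff_dvd _ _).2 (h i)

theorem dvd_det_of_row {R : Type*} [CommRing R] (x : R) (A : Matrix (Fin n) (Fin n) R)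
    (i : Fin n) (h : ∀ k, x ∣ A i k) : x ∣ A.det := by
  rw [← Ideal.Quotient.eq_zero_iff_dvd, RingHom.map_det]
  exact Matrix.det_eq_zero_of_row_eq_zero i fun k =>
    (Ideal.Quotient.eq_zero_iff_dvd _ _).2 (h k)

/-! ### The form `Ω(ε)` in coordinates -/

theorem tCoord_zConfig {z : Label n → ℂ} (h : ∀ a b, a ≠ b → dif z a b ≠ 0) (i : Fin n) :
    tCoord i (Mbar.ofConfig (zConfig z h)) = (z (.s i) - z .zero) / (z .one - z .zero) := by
  rw [tCoord, cr_ofConfig_zConfig, finVal_coe]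
  change dif z (.s i) .zero * dif z .one .infty / (dif z (.s i) .infty * dif z .one .zero) = _
  rw [dif_fin _ (by simp) (by simp), dif_infty_right _ (by simp), dif_infty_right _ (by simp),
    dif_fin _ (by simp) (by simp), mul_neg_one, neg_one_mul, neg_div_neg_eq]

/-- The label of the pole of the form `dt / (t - e)` on the affine line. -/
def poleLabel (n : ℕ) (e : Fin 2) : Label n := if e = 0 then .zero else .one

theorem poleLabel_ne_infty (e : Fin 2) : poleLabel n e ≠ .infty := by
  unfold poleLabel; split_ifs <;> simp

theorem poleLabel_ne_s (e : Fin 2) (i : Fin n) : poleLabel n e ≠ .s i := by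
  unfold poleLabel; split_ifs <;> simp

/-- Turns `dtᵢ / (tᵢ - εᵢ)` into the logarithmic derivative of a quotient of two differences,
whatever the letter. -/
theorem tCoord_sub {z : Label n → ℂ} (h : ∀ a b, a ≠ b → dif z a b ≠ 0) (i : Fin n) (e : Fin 2) :
    tCoord i (Mbar.ofConfig (zConfig z h)) - ((e : ℕ) : ℂ)
      = (z (.s i) - z (poleLabel n e)) / (z .one - z .zero) := by
  rw [tCoord_zConfig]
  have h1 : z .one - z .zero ≠ 0 := by
    rw [← dif_fin z (by simp) (by simp)]
    exact h _ _ (by simp)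
  unfold poleLabel
  fin_cases e
  · simp
  · simp
    field_simp
    ring

namespace DifSystem

variable (Y : DifSystem n)

/-- The matrix of `Ω(ε)` in the coordinates, with the denominators removed. -/
noncomputable def omegaMatrix (ε : Fin n → Fin 2) : Matrix (Fin n) (Fin n) (MvPolynomial (Fin n) ℂ) :=
  Matrix.of fun i k =>
    ((Y.e k (.s i) (poleLabel n (ε i)) : MvPolynomial (Fin n) ℂ) - (Y.e k .one .zero : MvPolynomial (Fin n) ℂ)) *
      (Y.P (.s i) (poleLabel n (ε i)) * Y.P .one .zero) +
    X k * (pderiv k (Y.P (.s i) (poleLabel n (ε i))) * Y.P .one .zero -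
      Y.P (.s i) (poleLabel n (ε i)) * pderiv k (Y.P .one .zero))

/-- The monomial part of the difference of `a` and `b`. -/
noncomputable def M (a b : Label n) : MvPolynomial (Fin n) ℂ := ∏ j, X j ^ Y.e j a b

theorem factor' {a b : Label n} (ha : a ≠ .infty) (hb : b ≠ .infty) (hab : a ≠ b) :
    Y.z a - Y.z b = Y.M a b * Y.P a b := by
  rw [← dif_fin _ ha hb, Y.factor hab, prod_filter_eq, M]

/-- Up to denominators, `omegaMatrix` holds the logarithmic derivatives along `X k ∂ₖ` of `(sᵢ -
pole) / (1 - 0)`: the monomials contribute exponents, the factors `P` their derivatives. -/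
theorem omegaMatrix_eq (ε : Fin n → Fin 2) (i k : Fin n) :
    X k * (pderiv k (Y.z (.s i) - Y.z (poleLabel n (ε i))) * (Y.z .one - Y.z .zero) -
      (Y.z (.s i) - Y.z (poleLabel n (ε i))) * pderiv k (Y.z .one - Y.z .zero))
      = Y.M (.s i) (poleLabel n (ε i)) * Y.M .one .zero * Y.omegaMatrix ε i k := by
  rw [Y.factor' (by simp) (poleLabel_ne_infty _) (poleLabel_ne_s _ _).symm,
    Y.factor' (a := .one) (b := .zero) (by simp) (by simp) (by simp), pderiv_mul, pderiv_mul,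
    omegaMatrix, Matrix.of_apply]
  have h1 := X_mul_pderiv_prod (fun j => Y.e j (.s i) (poleLabel n (ε i))) k
  have h2 := X_mul_pderiv_prod (fun j => Y.e j (.one : Label n) .zero) k
  change X k * pderiv k (Y.M _ _) = _ * Y.M _ _ at h1
  change X k * pderiv k (Y.M _ _) = _ * Y.M _ _ at h2
  linear_combination (Y.P (.s i) (poleLabel n (ε i)) * Y.M .one .zero * Y.P .one .zero) * h1
    - (Y.M (.s i) (poleLabel n (ε i)) * Y.P (.s i) (poleLabel n (ε i)) * Y.P .one .zero) * h2

theorem not_X_dvd_M {k : Fin n} {a b : Label n} (h : ¬ Y.r k a b) : ¬ (X k ∣ Y.M a b) := by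
  rw [M, Prime.dvd_finsetProd_iff X_prime]
  rintro ⟨j, -, hj⟩
  have := X_dvd_X.1 (X_prime.dvd_of_dvd_pow hj)
  subst this
  rw [e, if_neg h, pow_zero] at hj
  exact X_prime.not_isUnit (isUnit_of_dvd_one hj)

theorem X_dvd_sub {k : Fin n} {a b : Label n} (ha : a ≠ .infty) (hb : b ≠ .infty) (hab : a ≠ b)
    (h : Y.r k a b) : X k ∣ Y.z a - Y.z b := by
  rw [Y.factor' ha hb hab, M]
  refine Dvd.dvd.mul_right (dvd_trans ?_ (Finset.dvd_prod_of_mem _ (Finset.mem_univ k))) _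
  rw [e, if_pos h, pow_one]

/-- The fields `X l ∂ₗ` are tangent to the divisor `X k = 0`, so they preserve its ideal. -/
theorem X_dvd_X_mul_pderiv {k : Fin n} {f : MvPolynomial (Fin n) ℂ} (h : X k ∣ f) (l : Fin n) :
    X k ∣ X l * pderiv l f := by
  obtain ⟨g, rfl⟩ := h
  rw [pderiv_mul]
  by_cases hl : l = k
  · subst hl
    exact Dvd.intro _ rfl
  · rw [pderiv_X_of_ne (Ne.symm hl), zero_mul, zero_add]
    exact ⟨X l * pderiv l g, by ring⟩

/-- If the labels `sᵢ` and `b` come together where the coordinate `k` vanishes, apart from the pole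
label of `sᵢ`, then the row `i` vanishes there. -/
theorem X_dvd_omegaMatrix_row (ε : Fin n → Fin 2) {i k : Fin n} {b : Label n} (hb : b ≠ .infty)
    (hbs : b ≠ .s i) (hk : Y.r k (.s i) b) (h1 : ¬ Y.r k (.s i) (poleLabel n (ε i)))
    (h2 : ¬ Y.r k .one .zero) (c : ℂ)
    (hc : Y.z b - Y.z (poleLabel n (ε i)) = MvPolynomial.C c * (Y.z .one - Y.z .zero)) (l : Fin n) :
    X k ∣ Y.omegaMatrix ε i l := by
  have hg : X k ∣ Y.z (.s i) - Y.z b := Y.X_dvd_sub (by simp) hb hbs.symm hk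
  have hd := X_dvd_X_mul_pderiv hg l
  have heq := Y.omegaMatrix_eq ε i l
  -- Adding a constant multiple of the denominator to the numerator shifts the quotient by a
  -- constant, so the derivative only sees `sᵢ - b`, which is divisible by `X k`.
  have hf : Y.z (.s i) - Y.z (poleLabel n (ε i))
      = (Y.z (.s i) - Y.z b) + MvPolynomial.C c * (Y.z .one - Y.z .zero) := by
    linear_combination hc
  have : X k ∣ Y.M (.s i) (poleLabel n (ε i)) * Y.M .one .zero * Y.omegaMatrix ε i l := by
    rw [← heq, hf, map_add, pderiv_C_mul]
    have : X l * ((pderiv l (Y.z (.s i) - Y.z b) + MvPolynomial.C c * pderiv l (Y.z .one - Y.z .zero)) * (Y.z .one - Y.z .zero) -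
        ((Y.z (.s i) - Y.z b) + MvPolynomial.C c * (Y.z .one - Y.z .zero)) * pderiv l (Y.z .one - Y.z .zero))
        = X l * pderiv l (Y.z (.s i) - Y.z b) * (Y.z .one - Y.z .zero)
          - (Y.z (.s i) - Y.z b) * (X l * pderiv l (Y.z .one - Y.z .zero)) := by ring
    rw [this]
    exact dvd_sub (hd.mul_right _) (hg.mul_right _)
  -- The two monomials are prime to `X k`, which leaves the matrix entry.
  rcases X_prime.dvd_or_dvd this with h | h
  · rcases X_prime.dvd_or_dvd h with h | h
    · exact absurd h (Y.not_X_dvd_M h1)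
    · exact absurd h (Y.not_X_dvd_M h2)
  · exact h

/-- With all exponents of `X k` zero, the logarithmic derivatives along `X k ∂ₖ` have no constant
part and keep the factor `X k`. -/
theorem X_dvd_omegaMatrix_column (ε : Fin n → Fin 2) {k : Fin n}
    (h1 : ∀ i, ¬ Y.r k (.s i) (poleLabel n (ε i))) (h2 : ¬ Y.r k .one .zero) (i : Fin n) :
    X k ∣ Y.omegaMatrix ε i k := by
  simp only [omegaMatrix, Matrix.of_apply, e, if_neg (h1 i), if_neg h2, Nat.cast_zero, sub_self,
    zero_mul, zero_add]
  exact Dvd.intro _ rfl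

/-- The coefficient of `Ω(ε)` off the boundary. -/
theorem omegaCoeff_eq (ε : Fin n → Fin 2) (f : (Fin n → ℂ) → Mbar (Label n)) {u : Fin n → ℂ}
    (hu : u ∈ Y.U) (h0 : ∀ k, u k ≠ 0)
    (hf : ∀ v (hv : v ∈ Y.U), f v = Y.psi ⟨v, hv⟩) :
    omegaCoeff ℂ ε f u = (∏ k, u k)⁻¹ *
      (∏ i, (eval u (Y.P (.s i) (poleLabel n (ε i))) * eval u (Y.P .one .zero)))⁻¹ *
      eval u (Y.omegaMatrix ε).det := by
  have hopen : IsOpen (Y.U ∩ {v : Fin n → ℂ | ∀ k, v k ≠ 0}) := by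
    refine Y.isOpen_U.inter ?_
    simp only [ofPred_forall]
    exact isOpen_iInter_of_finite fun k => isOpen_ne_fun (continuous_apply k) continuous_const
  have hz := Y.dif_zv_ne_zero hu h0
  have hev : ∀ i, (fun v => tCoord i (f v)) =ᶠ[𝓝 u] fun v =>
      eval v (Y.z (.s i) - Y.z (poleLabel n (ε i))) / eval v (Y.z .one - Y.z .zero)
        + ((ε i : ℕ) : ℂ) := by
    intro i
    filter_upwards [hopen.mem_nhds ⟨hu, h0⟩] with v hv
    have hzv := Y.dif_zv_ne_zero hv.1 hv.2
    rw [hf v hv.1, Y.psi_eq ⟨v, hv.1⟩ hzv, ← sub_eq_iff_eq_add, tCoord_sub, map_sub, map_sub]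
    rfl
  have hne : eval u (Y.z .one - Y.z .zero) ≠ 0 := by
    rw [map_sub]
    have := hz .one .zero (by simp)
    rwa [dif_fin _ (by simp) (by simp)] at this
  have hfi : ∀ i, eval u (Y.z (.s i) - Y.z (poleLabel n (ε i))) ≠ 0 := by
    intro i
    rw [map_sub]
    have := hz (.s i) (poleLabel n (ε i)) (poleLabel_ne_s _ _).symm
    rwa [dif_fin _ (by simp) (poleLabel_ne_infty _)] at this
  have hentry : ∀ i k, fderiv ℂ (fun v => tCoord i (f v)) u (Pi.single k 1) /
      (tCoord i (f u) - ((ε i : ℕ) : ℂ))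
      = (u k)⁻¹ * ((eval u (Y.P (.s i) (poleLabel n (ε i))) * eval u (Y.P .one .zero))⁻¹ *
        eval u (Y.omegaMatrix ε i k)) := by
    intro i k
    have d1 := differentiableAt_eval (Y.z (.s i) - Y.z (poleLabel n (ε i))) u
    have d2 := differentiableAt_eval (Y.z .one - Y.z (.zero : Label n)) u
    rw [(hev i).fderiv_eq, fderiv_add_const, fderiv_div_apply d1 d2 hne, fderiv_eval_apply,
      fderiv_eval_apply]
    have hval : tCoord i (f u) - ((ε i : ℕ) : ℂ) = eval u (Y.z (.s i) - Y.z (poleLabel n (ε i))) /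
        eval u (Y.z .one - Y.z .zero) := by
      have : tCoord i (f u) = _ := (hev i).eq_of_nhds
      rw [this, add_sub_cancel_right]
    rw [hval]
    have key := congrArg (eval u) (Y.omegaMatrix_eq ε i k)
    have f1 := congrArg (eval u) (Y.factor' (a := .s i) (by simp) (poleLabel_ne_infty (ε i))
      (poleLabel_ne_s _ _).symm)
    have f2 := congrArg (eval u) (Y.factor' (a := .one) (b := .zero) (by simp) (by simp) (by simp))
    have g1 := hfi i
    have g2 := hne
    rw [f1, map_mul] at g1
    rw [f2, map_mul] at g2
    have p1 := right_ne_zero_of_mul g1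
    have p2 := right_ne_zero_of_mul g2
    have m1 := left_ne_zero_of_mul g1
    have m2 := left_ne_zero_of_mul g2
    have h0k := h0 k
    simp only [map_mul, map_sub (eval u) (_ * _), eval_X] at key
    rw [map_mul] at f1 f2
    have hfi' := hfi i
    rw [div_div_eq_mul_div]
    rw [← mul_assoc, ← mul_inv, mul_comm ((u k * _)⁻¹), ← div_eq_mul_inv]
    rw [div_mul_eq_mul_div, div_div, div_eq_div_iff (mul_ne_zero (pow_ne_zero _ hne) hfi')
      (mul_ne_zero h0k (mul_ne_zero p1 p2))]
    rw [f1, f2] at *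
    linear_combination (eval u (Y.P (.s i) (poleLabel n (ε i))) * eval u (Y.P .one .zero) *
      (eval u (Y.M .one .zero) * eval u (Y.P .one .zero))) * key
  have hdet : omegaCoeff ℂ ε f u = Matrix.det (Matrix.of fun i k => (u k)⁻¹ *
      Matrix.of (fun i k => (eval u (Y.P (.s i) (poleLabel n (ε i))) * eval u (Y.P .one .zero))⁻¹ *
        (eval u).mapMatrix (Y.omegaMatrix ε) i k) i k) := by
    unfold omegaCoeff
    congr 1
    ext i k
    exact hentry i k
  rw [hdet, Matrix.det_mul_row, Matrix.det_mul_column, ← RingHom.map_det, Finset.prod_inv_distrib,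
    Finset.prod_inv_distrib]
  ring

end DifSystem

/-! ### Holomorphy of the form off `A` -/

namespace TreeModel

variable {p : Mbar (Label n)} (T : TreeModel p (Finset.univ.erase .infty) Finset.univ)

/-- The cases are which of `0, 1` lie in the cluster. Both: its complement is `∞` with some `sᵢ`, a
type. Exactly one: some `sᵢ` in the cluster has its pole at the other one, otherwise the cluster has
a type. Neither: no difference in the form vanishes. -/
theorem X_dvd_det_omegaMatrix (ε : Fin n → Fin 2) {k : Fin n}
    (hk : ¬ HasType ε (T.C k : Set (Label n))) : X k ∣ (T.toDifSystem.omegaMatrix ε).det := by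
  have hinf := T.infty_notMem_C k
  have hr : ∀ a b, T.toDifSystem.r k a b ↔ a ∈ T.C k ∧ b ∈ T.C k := fun a b => Iff.rfl
  obtain ⟨x, hx, y, hy, hxy⟩ := T.C_nontrivial k (Finset.mem_univ k)
  by_cases h0 : Label.zero ∈ T.C k <;> by_cases h1 : Label.one ∈ T.C k
  · exfalso
    apply hk
    obtain ⟨b, hb, hbk⟩ := T.C_proper k
    have hbi : b ≠ .infty := (Finset.mem_erase.1 hb).1
    refine ⟨.infty, (T.C k : Set (Label n))ᶜ \ {.infty}, ⟨b, by simp [hbk, hbi]⟩, ?_, Or.inr ?_⟩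
    · rintro l ⟨hl, hli⟩
      cases l with
      | zero => exact absurd h0 hl
      | one => exact absurd h1 hl
      | infty => exact absurd rfl hli
      | s i => exact ⟨i, rfl⟩
    · rw [insert_sdiff_singleton, insert_eq_of_mem]
      exact hinf
  · have hrow : ∃ i, .s i ∈ T.C k ∧ ε i ≠ 0 := by
      by_contra hcon
      push Not at hcon
      apply hk
      refine ⟨.zero, (T.C k : Set (Label n)) \ {.zero}, ?_, ?_, Or.inl ?_⟩
      · by_cases hx0 : x = .zero
        · exact ⟨y, hy, fun e => hxy (hx0.trans e.symm)⟩
        · exact ⟨x, hx, hx0⟩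
      · rintro l ⟨hl, hli⟩
        cases l with
        | zero => exact absurd rfl hli
        | one => exact absurd hl h1
        | infty => exact absurd hl hinf
        | s i => exact ⟨i, rfl, hcon i hl⟩
      · rw [insert_sdiff_singleton, insert_eq_of_mem]
        exact h0
    obtain ⟨i, hi, hεi⟩ := hrow
    have hp : poleLabel n (ε i) = .one := if_neg hεi
    refine dvd_det_of_row _ _ i fun l => T.toDifSystem.X_dvd_omegaMatrix_row ε (b := .zero)
      (by simp) (by simp) ⟨hi, h0⟩ (by rw [hp, hr]; tauto) (by rw [hr]; tauto) (-1) ?_ l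
    rw [hp]
    simp
  · have hrow : ∃ i, .s i ∈ T.C k ∧ ε i ≠ 1 := by
      by_contra hcon
      push Not at hcon
      apply hk
      refine ⟨.one, (T.C k : Set (Label n)) \ {.one}, ?_, ?_, Or.inl ?_⟩
      · by_cases hx0 : x = .one
        · exact ⟨y, hy, fun e => hxy (hx0.trans e.symm)⟩
        · exact ⟨x, hx, hx0⟩
      · rintro l ⟨hl, hli⟩
        cases l with
        | one => exact absurd rfl hli
        | zero => exact absurd hl h0
        | infty => exact absurd hl hinf
        | s i => exact ⟨i, rfl, hcon i hl⟩
      · rw [insert_sdiff_singleton, insert_eq_of_mem]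
        exact h1
    obtain ⟨i, hi, hεi⟩ := hrow
    have hp : poleLabel n (ε i) = .zero := if_pos (by omega)
    refine dvd_det_of_row _ _ i fun l => T.toDifSystem.X_dvd_omegaMatrix_row ε (b := .one)
      (by simp) (by simp) ⟨hi, h1⟩ (by rw [hp, hr]; tauto) (by rw [hr]; tauto) 1 ?_ l
    rw [hp]
    simp
  · refine dvd_det_of_column _ _ k fun i => T.toDifSystem.X_dvd_omegaMatrix_column ε
      (fun i => ?_) (by rw [hr]; tauto) i
    rw [hr]
    unfold poleLabel
    split_ifs <;> tauto

end TreeModel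

/-- The chart is shrunk so as to avoid `X k = 0` for the clusters that have a type; this keeps `p`,
which is not in `A`. The other factors `1 / X k` are absorbed by the determinant. -/
theorem isHolomorphicOmegaAt (ε : Fin n → Fin 2) {p : Mbar (Label n)} (hp : p ∉ divA ε) :
    IsHolomorphicOmegaAt ε p := by
  classical
  obtain ⟨T⟩ := exists_treeModel p
  let H : Finset (Fin n) := Finset.univ.filter fun k => HasType ε (T.C k : Set (Label n))
  let W : Set (Fin n → ℂ) := T.toDifSystem.U ∩ {u | ∀ k ∈ H, u k ≠ 0}
  have hW : IsOpen W := by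
    refine T.toDifSystem.isOpen_U.inter ?_
    simp only [ofPred_forall]
    exact isOpen_iInter_of_finite fun k => isOpen_iInter_of_finite fun _ =>
      isOpen_ne_fun (continuous_apply k) continuous_const
  have hWU : W ⊆ T.toDifSystem.U := inter_subset_left
  have hfin : ∀ k, p.cr (T.q k) ≠ OnePoint.infty := fun k => T.cr_ne k (Finset.mem_univ k)
  have hpsi := T.psi_coord hfin T.coord_mem_U
  have hpW : T.coord p ∈ W := by
    refine ⟨T.coord_mem_U, fun k hk h0 => hp ?_⟩
    refine ⟨_, T.isStablePartition_C k, (Finset.mem_filter.1 hk).2, ?_⟩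
    have := T.psi_mem_boundaryDivisor ⟨_, T.coord_mem_U⟩ h0
    rwa [hpsi] at this
  -- Distinct variables are coprime, so their product divides the determinant.
  have hdvd : ∏ k ∈ Hᶜ, X k ∣ (T.toDifSystem.omegaMatrix ε).det := by
    refine Finset.prod_dvd_of_isRelPrime ?_ ?_
    · intro j _ k _ hjk
      refine (X_prime.irreducible.isRelPrime_iff_not_dvd).2 fun h => hjk (X_dvd_X.1 h)
    · intro k hk
      refine T.X_dvd_det_omegaMatrix ε fun h => ?_
      rw [Finset.mem_compl] at hk
      exact hk (Finset.mem_filter.2 ⟨Finset.mem_univ k, h⟩)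
  obtain ⟨Q, hQ⟩ := hdvd
  refine ⟨T.chart W hW hWU, T.isHolomorphicChart W hW hWU, ⟨hfin, hpW⟩,
    fun u => eval u Q / ((∏ k ∈ H, u k) * ∏ i, (eval u (T.toDifSystem.P (.s i) (poleLabel n (ε i)))
      * eval u (T.toDifSystem.P .one .zero))), ?_, ?_⟩
  · intro u hu
    have ha : ∀ f : MvPolynomial (Fin n) ℂ, AnalyticAt ℂ (fun v : Fin n → ℂ => eval v f) u :=
      fun f => AnalyticOnNhd.eval_mvPolynomial f u (mem_univ _)
    refine (ha Q).div ?_ ?_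
    · have : (fun u : Fin n → ℂ => (∏ k ∈ H, u k) *
          ∏ i, (eval u (T.toDifSystem.P (.s i) (poleLabel n (ε i)))
            * eval u (T.toDifSystem.P .one .zero)))
          = fun u => eval u ((∏ k ∈ H, X k) * ∏ i, (T.toDifSystem.P (.s i) (poleLabel n (ε i))
            * T.toDifSystem.P .one .zero)) := by
        funext v
        simp [map_prod]
      rw [this]
      exact ha _
    · refine mul_ne_zero (Finset.prod_ne_zero_iff.2 fun k hk => hu.2 k hk)
        (Finset.prod_ne_zero_iff.2 fun i _ => mul_ne_zero (hu.1 _ _ (poleLabel_ne_s _ _).symm)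
          (hu.1 _ _ (by simp)))
  · intro u hu ho
    change T.inv u ∈ _ at ho
    change _ = omegaCoeff ℂ ε T.inv u
    have h0 : ∀ k, u k ≠ 0 := by
      intro k hk
      refine disjoint_boundaryDivisor_openStratum (T.isStablePartition_C k) ?_ ho
      rw [T.inv_of_mem hu.1]
      exact T.psi_mem_boundaryDivisor ⟨u, hu.1⟩ hk
    rw [T.toDifSystem.omegaCoeff_eq ε T.inv hu.1 h0 fun v hv => T.inv_of_mem hv, hQ, map_mul,
      map_prod]
    simp only [eval_X]
    have hsplit := Finset.prod_mul_prod_compl H u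
    have h1 : ∏ k ∈ H, u k ≠ 0 := Finset.prod_ne_zero_iff.2 fun k _ => h0 k
    have h2 : ∏ k ∈ Hᶜ, u k ≠ 0 := Finset.prod_ne_zero_iff.2 fun k _ => h0 k
    rw [← hsplit]
    generalize (∏ i, (eval u (T.toDifSystem.P (.s i) (poleLabel n (ε i)))
      * eval u (T.toDifSystem.P .one .zero))) = Z
    rw [div_eq_mul_inv, mul_inv, mul_inv]
    field_simp

end ZetaModuli

namespace ZetaModuli

variable {n : ℕ}

/-! ### The real cell and its closure -/

theorem bracket_coe (a b : ℂ) : bracket (a : P1) (b : P1) = a - b := by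
  simp [bracket, hom]

theorem dif_congr {R : Type*} [CommRing R] {z z' : Label n → R}
    (h : ∀ a, a ≠ .infty → z a = z' a) (a b : Label n) : dif z a b = dif z' a b := by
  unfold dif
  split_ifs with h1 h2 h2
  · rfl
  · rfl
  · rfl
  · rw [h a h1, h b h2]

theorem ofConfig_zConfig_congr {z z' : Label n → ℂ} (hz : ∀ a b, a ≠ b → dif z a b ≠ 0)
    (hz' : ∀ a b, a ≠ b → dif z' a b ≠ 0) (h : ∀ a, a ≠ .infty → z a = z' a) :
    Mbar.ofConfig (zConfig z hz) = Mbar.ofConfig (zConfig z' hz') := by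
  refine Mbar.ext fun q => ?_
  simp only [cr_ofConfig_zConfig, dif_congr h]

/-- The points `0, t₁, …, tₙ, 1` of the affine line. -/
def simplexZ (t : Fin n → ℂ) : Label n → ℂ
  | .zero => 0
  | .s i => t i
  | .one => 1
  | .infty => 0

theorem zPoint_simplexZ (t : Fin n → ℝ) (l : Label n) :
    zPoint (simplexZ fun i => (t i : ℂ)) l = simplexPoint t l := by
  cases l <;> simp [zPoint, simplexZ, simplexPoint]

theorem dif_simplexZ_ne_zero {t : Fin n → ℝ} (ht : t ∈ openSimplex n) (a b : Label n)
    (hab : a ≠ b) : dif (simplexZ fun i => (t i : ℂ)) a b ≠ 0 := by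
  rw [← bracket_zPoint, zPoint_simplexZ, zPoint_simplexZ]
  exact bracket_ne_zero fun e => hab (simplexPoint_injective ht e)

theorem Phi_eq (t : openSimplex n) :
    Phi t = Mbar.ofConfig (zConfig (simplexZ fun i => (t.1 i : ℂ)) (dif_simplexZ_ne_zero t.2)) := by
  unfold Phi
  congr 1
  ext l
  exact (zPoint_simplexZ t.1 l).symm

theorem tCoord_Phi (t : openSimplex n) (i : Fin n) : tCoord i (Phi t) = (t.1 i : ℂ) := by
  rw [Phi_eq, tCoord_zConfig]
  simp [simplexZ]

theorem Phi_mem_openStratum (t : openSimplex n) : Phi t ∈ openStratum (Label n) := ⟨_, rfl⟩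

/-- A Möbius transformation moves `∞` to a finite point in one direction, and the normalising
cross-ratio sends `0, 1, ∞` back in the other; both preserve the order of the labels. -/
theorem range_Phi : Set.range (Phi (n := n)) = realCell n := by
  apply Subset.antisymm
  · rintro _ ⟨⟨t, ht⟩, rfl⟩
    have htp := fun i => (ht.2 i).1
    -- The transformation `t / (1 + t)`, increasing for `t ≥ 0`, with `1 ↦ 1/2` and `∞ ↦ 1`.
    let r : Label n → ℝ
      | .zero => 0
      | .s i => t i / (1 + t i)
      | .one => 1 / 2
      | .infty => 1
    have hfrac : ∀ {x y : ℝ}, 0 ≤ x → x < y → x / (1 + x) < y / (1 + y) := by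
      intro x y hx hxy
      rw [div_lt_div_iff₀ (by linarith) (by linarith)]
      nlinarith
    have hr : ∀ l l' : Label n, l.pos < l'.pos → r l < r l' := by
      have h0 : ∀ i, 0 < t i / (1 + t i) := fun i => by
        have := htp i
        positivity
      have h1 : ∀ i, t i / (1 + t i) < 1 / 2 := fun i => by
        have := hfrac (htp i).le (ht.2 i).2
        norm_num at this ⊢
        exact this
      intro l l' hl
      cases l <;> cases l' <;> simp only [Label.pos, r] at hl ⊢ <;> try omega
      · exact h0 _
      · norm_num
      · norm_num
      · exact hfrac (htp _).le (ht.1 (Fin.lt_def.2 (by omega)))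
      · exact h1 _
      · exact (h1 _).trans (by norm_num)
      · norm_num
    have hinj : Function.Injective r := by
      intro a b hab
      by_contra hne
      rcases lt_or_gt_of_ne (fun h => hne (Label.pos_injective h)) with h | h
      · exact (hr _ _ h).ne hab
      · exact (hr _ _ h).ne hab.symm
    let x : Label n ↪ P1 := ⟨fun l => ((r l : ℂ) : P1), fun a b hab => by
      have := OnePoint.coe_injective hab
      exact hinj (Complex.ofReal_injective this)⟩
    refine ⟨r, x, hr, fun l => rfl, ?_⟩
    -- The factors `1 / (1 + t)` by which this transformation scales the brackets.
    let c : Label n → ℂ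
      | .zero => 1
      | .s i => 1 / (1 + t i)
      | .one => 1 / 2
      | .infty => 1
    have hti : ∀ i, (1 + t i : ℂ) ≠ 0 := by
      intro i
      have := htp i
      have h2 : (1 + t i : ℝ) ≠ 0 := by positivity
      exact_mod_cast h2
    refine ofConfig_eq_of_scaling c 1 one_ne_zero ?_ ?_
    · intro a
      cases a <;> simp [c, hti]
    · intro a b hab
      have hb : bracket (x a) (x b) = (r a : ℂ) - r b := by
        exact bracket_coe _ _
      rw [hb]
      change _ = _ * bracket (simplexPoint t a) (simplexPoint t b)
      rw [← zPoint_simplexZ, ← zPoint_simplexZ, bracket_zPoint]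
      cases a <;> cases b <;> simp [r, c, dif, simplexZ] at hab ⊢
      all_goals
        try (have h1 := hti ‹_›)
        try field_simp
        try ring1
      rename_i i j
      have h2 := hti i
      field_simp
      ring
  · rintro _ ⟨r, x, hr, hx, rfl⟩
    have hb : ∀ a b, bracket (x a) (x b) = ((r a - r b : ℝ) : ℂ) := by
      intro a b
      rw [hx, hx, bracket_coe, Complex.ofReal_sub]
    let t : Fin n → ℝ := fun i => (r (.s i) - r .zero) * (r .one - r .infty) /
      ((r (.s i) - r .infty) * (r .one - r .zero))
    have h01 : r .zero < r .one := hr _ _ (by simp [Label.pos])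
    have h1i : r .one < r .infty := hr _ _ (by simp [Label.pos])
    have h0s : ∀ i, r .zero < r (.s i) := fun i => hr _ _ (by simp [Label.pos])
    have hs1 : ∀ i, r (.s i) < r .one := fun i => hr _ _ (by simp [Label.pos])
    have hsi : ∀ i, r (.s i) < r .infty := fun i => (hs1 i).trans h1i
    have ht' : ∀ i, t i = (r (.s i) - r .zero) * (r .infty - r .one) /
        ((r .infty - r (.s i)) * (r .one - r .zero)) := by
      intro i
      simp only [t]
      rw [← neg_div_neg_eq]
      congr 1 <;> ring
    have ht : t ∈ openSimplex n := by
      refine ⟨fun i j hij => ?_, fun i => ⟨?_, ?_⟩⟩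
      · have hij' : r (.s i) < r (.s j) := hr _ _ (by simpa [Label.pos] using hij)
        have := h0s i
        have := hsi i
        have := hsi j
        rw [ht', ht', div_lt_div_iff₀ (by nlinarith) (by nlinarith)]
        have key : 0 < (r .infty - r .one) * (r .one - r .zero) * ((r (.s j) - r (.s i)) *
            (r .infty - r .zero)) := by
          apply mul_pos (mul_pos _ _) (mul_pos _ _) <;> linarith
        nlinarith
      · have := h0s i
        have := hsi i
        rw [ht']
        apply div_pos <;> apply mul_pos <;> linarith
      · have := hsi i
        rw [ht', div_lt_one (by apply mul_pos <;> linarith)]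
        have key : 0 < (r .one - r (.s i)) * (r .infty - r .zero) := by
          apply mul_pos <;> linarith [hs1 i]
        nlinarith
    refine ⟨⟨t, ht⟩, ?_⟩
    obtain ⟨h, he⟩ := ofConfig_eq_normalized x (a₀ := .zero) (b₀ := .one) (by simp) (by simp)
      (by simp)
    rw [he, Phi_eq]
    refine ofConfig_zConfig_congr _ _ fun a ha => ?_
    unfold normalized
    simp only [hb]
    cases a with
    | zero => simp [simplexZ]
    | s i =>
      simp only [simplexZ, t]
      push_cast
      rfl
    | one =>
      have e1 : ((r .one - r .infty : ℝ) : ℂ) ≠ 0 := by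
        exact_mod_cast (by linarith : r .one - r .infty ≠ 0)
      have e2 : ((r .one - r .zero : ℝ) : ℂ) ≠ 0 := by
        exact_mod_cast (by linarith : r .one - r .zero ≠ 0)
      simp only [simplexZ]
      field_simp
    | infty => exact absurd rfl ha

theorem tCoord_continuousAt {p : Mbar (Label n)} {i : Fin n}
    (h : p.cr (tQuad i) ≠ OnePoint.infty) : ContinuousAt (tCoord i) p :=
  Mbar.continuousAt_finVal_cr h

/-- The weak inequalities and reality of the coordinates pass to the closure; distinctness of the
points makes the inequalities strict. -/
theorem mem_range_Phi_of_openStratum {p : Mbar (Label n)}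
    (hp : p ∈ closure (Set.range (Phi (n := n)))) (ho : p ∈ openStratum (Label n)) :
    p ∈ Set.range (Phi (n := n)) := by
  let K : Set (Fin n → ℂ) := {w | (∀ i, (w i).im = 0 ∧ 0 ≤ (w i).re ∧ (w i).re ≤ 1) ∧
    ∀ i j, i < j → (w i).re ≤ (w j).re}
  have hK : IsClosed K := by
    have hre : ∀ i, Continuous fun w : Fin n → ℂ => (w i).re := fun i =>
      Complex.continuous_re.comp (continuous_apply i)
    have him : ∀ i, Continuous fun w : Fin n → ℂ => (w i).im := fun i =>
      Complex.continuous_im.comp (continuous_apply i)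
    simp only [K, ofPred_and, ofPred_forall]
    refine IsClosed.inter (isClosed_iInter fun i => ?_) (isClosed_iInter fun i =>
      isClosed_iInter fun j => isClosed_iInter fun _ => isClosed_le (hre i) (hre j))
    exact (isClosed_eq (him i) continuous_const).inter
      ((isClosed_le continuous_const (hre i)).inter (isClosed_le (hre i) continuous_const))
  have hc : ContinuousAt (fun p' : Mbar (Label n) => fun i => tCoord i p') p :=
    continuousAt_pi.2 fun i => tCoord_continuousAt (cr_openStratum ho _).1
  have hmem : (fun i => tCoord i p) ∈ K := by
    refine hK.closure_subset_iff.2 ?_ (hc.continuousWithinAt.mem_closure_image hp)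
    rintro _ ⟨_, ⟨t, rfl⟩, rfl⟩
    refine ⟨fun i => ?_, fun i j hij => ?_⟩
    · dsimp only
      rw [tCoord_Phi, Complex.ofReal_im, Complex.ofReal_re]
      exact ⟨rfl, (t.2.2 i).1.le, (t.2.2 i).2.le⟩
    · dsimp only
      rw [tCoord_Phi, tCoord_Phi, Complex.ofReal_re, Complex.ofReal_re]
      exact (t.2.1 hij).le
  obtain ⟨z, hz, h0, h1, rfl⟩ := exists_normalized ho (a₀ := .zero) (b₀ := .one) (by simp)
    (by simp) (by simp)
  have htz : ∀ i, tCoord i (Mbar.ofConfig (zConfig z hz)) = z (.s i) := by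
    intro i
    rw [tCoord_zConfig, h0, h1]
    simp
  simp only [K, mem_ofPred_eq, htz] at hmem
  have hreal : ∀ i, z (.s i) = ((z (.s i)).re : ℂ) := fun i =>
    Complex.ext (by simp) (by simp [(hmem.1 i).1])
  have hne : ∀ a b, a ≠ b → a ≠ .infty → b ≠ .infty → z a ≠ z b := by
    intro a b hab ha hb e
    apply hz a b hab
    rw [dif_fin _ ha hb, e, sub_self]
  have ht : (fun i => (z (.s i)).re) ∈ openSimplex n := by
    refine ⟨fun i j hij => lt_of_le_of_ne (hmem.2 i j hij) fun e => ?_, fun i =>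
      ⟨lt_of_le_of_ne (hmem.1 i).2.1 fun e => ?_, lt_of_le_of_ne (hmem.1 i).2.2 fun e => ?_⟩⟩
    · refine hne (.s i) (.s j) (by simpa using hij.ne) (by simp) (by simp) ?_
      rw [hreal i, hreal j]
      simpa using e
    · refine hne (.s i) .zero (by simp) (by simp) (by simp) ?_
      dsimp only at e
      rw [hreal i, ← e, h0, Complex.ofReal_zero]
    · refine hne (.s i) .one (by simp) (by simp) (by simp) ?_
      dsimp only at e
      rw [hreal i, e, h1, Complex.ofReal_one]
  refine ⟨⟨_, ht⟩, ?_⟩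
  rw [Phi_eq]
  refine ofConfig_zConfig_congr _ _ fun a ha => ?_
  cases a with
  | zero => exact h0.symm
  | one => exact h1.symm
  | s i => exact (hreal i).symm
  | infty => exact absurd rfl ha

/-! ### Divisors that meet the closed cell -/

/-- Points in alternating position on the circle. -/
theorem cr_ne_one_of_alternating {p : Mbar (Label n)}
    (hp : p ∈ closure (Set.range (Phi (n := n)))) (q : Fin 4 ↪ Label n)
    (h : ((q 0).pos < (q 2).pos ∧ (q 2).pos < (q 1).pos ∧ (q 1).pos < (q 3).pos) ∨
      ((q 2).pos < (q 0).pos ∧ (q 0).pos < (q 3).pos ∧ (q 3).pos < (q 1).pos)) :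
    p.cr q ≠ ((1 : ℂ) : P1) := by
  -- An open neighbourhood of `1` that the cross-ratio, real and nonpositive on the cell, never
  -- enters.
  have hO : IsOpen (((↑) : ℂ → P1) '' {w : ℂ | 0 < w.re}) :=
    OnePoint.isOpen_image_coe.2 (isOpen_lt continuous_const Complex.continuous_re)
  have hcl : IsClosed {p' : Mbar (Label n) | p'.cr q ∉ ((↑) : ℂ → P1) '' {w : ℂ | 0 < w.re}} :=
    (hO.preimage (Mbar.continuous_cr q)).isClosed_compl
  have hsub : Set.range (Phi (n := n)) ⊆
      {p' : Mbar (Label n) | p'.cr q ∉ ((↑) : ℂ → P1) '' {w : ℂ | 0 < w.re}} := by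
    rw [range_Phi]
    rintro _ ⟨r, x, hr, hx, rfl⟩ ⟨w, hw, hwe⟩
    have hb : ∀ a b, bracket (x a) (x b) = ((r a - r b : ℝ) : ℂ) := by
      intro a b
      rw [hx, hx, bracket_coe, Complex.ofReal_sub]
    change (w : P1) = ((crossRatio _ _ _ _ : ℂ) : P1) at hwe
    rw [OnePoint.coe_eq_coe, crossRatio, hb, hb, hb, hb, ← Complex.ofReal_mul,
      ← Complex.ofReal_mul, ← Complex.ofReal_div] at hwe
    rw [hwe, mem_ofPred_eq, Complex.ofReal_re] at hw
    refine absurd hw (not_lt.2 ?_)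
    rcases h with ⟨h1, h2, h3⟩ | ⟨h1, h2, h3⟩
    · have := hr _ _ h1
      have := hr _ _ h2
      have := hr _ _ h3
      apply div_nonpos_of_nonneg_of_nonpos
      · apply mul_nonneg_of_nonpos_of_nonpos <;> linarith
      · apply mul_nonpos_of_nonpos_of_nonneg <;> linarith
    · have := hr _ _ h1
      have := hr _ _ h2
      have := hr _ _ h3
      apply div_nonpos_of_nonneg_of_nonpos
      · apply mul_nonneg <;> linarith
      · apply mul_nonpos_of_nonpos_of_nonneg <;> linarith
  intro h1
  exact hcl.closure_subset_iff.2 hsub hp ⟨1, by simp, h1.symm⟩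

theorem pos_lt_infty {l : Label n} (h : l ≠ .infty) : l.pos < n + 2 := by
  cases l <;> simp [Label.pos] at h ⊢

theorem exists_interval_of_not_alternating {Q : Set (Label n)} (hQ : Q.Nonempty)
    (h : ∀ a ∈ Q, ∀ b ∈ Q, ∀ l ∉ Q, ¬ (a.pos < l.pos ∧ l.pos < b.pos)) :
    ∃ a b : ℕ, Q = {l | a ≤ l.pos ∧ l.pos ≤ b} := by
  obtain ⟨a, ha, hmin⟩ := Set.exists_min_image Q Label.pos (Set.toFinite Q) hQ
  obtain ⟨b, hb, hmax⟩ := Set.exists_max_image Q Label.pos (Set.toFinite Q) hQ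
  refine ⟨a.pos, b.pos, ?_⟩
  ext l
  refine ⟨fun hl => ⟨hmin l hl, hmax l hl⟩, fun ⟨h1, h2⟩ => ?_⟩
  by_contra hl
  refine h a ha b hb l hl ⟨lt_of_le_of_ne h1 fun e => ?_, lt_of_le_of_ne h2 fun e => ?_⟩
  · exact hl (Label.pos_injective e ▸ ha)
  · exact hl (Label.pos_injective e ▸ hb)

/-- If the part without `∞` were not an interval, some label of the other part would lie between two
of its labels. With `∞` they form an alternating quadruple, whose cross-ratio would have to be `1`.
-/
theorem isArc_of_mem_closure {p : Mbar (Label n)} (hp : p ∈ closure (Set.range (Phi (n := n))))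
    {P : Set (Label n)} (hP : IsStablePartition P) (hpP : p ∈ boundaryDivisor P) : IsArc P := by
  have hpos : ∀ {a b : Label n}, a.pos < b.pos → a ≠ b := fun h e => by simp [e] at h
  by_cases hinf : .infty ∈ P
  · obtain ⟨a, b, hab⟩ := exists_interval_of_not_alternating (Q := Pᶜ) hP.2.nonempty (by
        rintro a ha b hb l hl ⟨h1, h2⟩
        have hl : l ∈ P := not_notMem.1 hl
        have h3 : b.pos < (Label.infty : Label n).pos :=
          pos_lt_infty fun e => hb (e ▸ hinf)
        refine cr_ne_one_of_alternating hp (mkQuad l .infty a b (hpos (h2.trans h3)) (hpos h1).symm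
          (hpos h2) (hpos (h1.trans (h2.trans h3))).symm (hpos h3).symm (hpos (h1.trans h2)))
          (Or.inr ⟨h1, h2, h3⟩) ?_
        exact hpP _ hl hinf ha hb)
    exact ⟨a, b, Or.inr hab⟩
  · obtain ⟨a, b, hab⟩ := exists_interval_of_not_alternating (Q := P) hP.1.nonempty (by
        rintro a ha b hb l hl ⟨h1, h2⟩
        have h3 : b.pos < (Label.infty : Label n).pos :=
          pos_lt_infty fun e => hinf (e ▸ hb)
        refine cr_ne_one_of_alternating hp (mkQuad a b l .infty (hpos (h1.trans h2)) (hpos h1)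
          (hpos (h1.trans (h2.trans h3))) (hpos h2).symm (hpos h3) (hpos (h2.trans h3)))
          (Or.inl ⟨h1, h2, h3⟩) ?_
        exact hpP _ ha hb hl hinf)
    exact ⟨a, b, Or.inl hab⟩

/-- No arc has a type with respect to a word that begins with `1` and ends with `0`. -/
theorem not_hasType_of_isArc (hn : 0 < n) {ε : Fin n → Fin 2} (hfirst : ε ⟨0, hn⟩ = 1)
    (hlast : ε ⟨n - 1, by omega⟩ = 0) {P : Set (Label n)} (hP : IsArc P) : ¬ HasType ε P := by
  rintro ⟨α, T, ⟨y, hy⟩, hT, hor⟩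
  obtain ⟨Q, hQ, a, b, hab⟩ : ∃ Q : Set (Label n), Q = insert α T ∧ ∃ a b : ℕ,
      (∀ l, l ∈ Q ↔ a ≤ l.pos ∧ l.pos ≤ b) ∨ (∀ l, l ∉ Q ↔ a ≤ l.pos ∧ l.pos ≤ b) := by
    obtain ⟨a, b, h⟩ := hP
    rcases hor with hor | hor
    · exact ⟨P, hor, a, b, h.imp (fun h l => by rw [h]; rfl)
        fun h l => by rw [← mem_compl_iff, h]; rfl⟩
    · exact ⟨Pᶜ, hor, a, b, h.symm.imp (fun h l => by rw [h]; rfl)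
        fun h l => by rw [← mem_compl_iff, compl_compl, h]; rfl⟩
  have hαQ : α ∈ Q := hQ ▸ mem_insert _ _
  have hyQ : y ∈ Q := hQ ▸ mem_insert_of_mem _ hy
  have hQT : ∀ l ∈ Q, l ≠ α → l ∈ typeSet ε α := fun l hl hne => by
    rw [hQ] at hl
    exact hT (hl.resolve_left hne)
  have hyT := hT hy
  cases α with
  -- An arc through `0` and some `sᵢ` that misses `1` and `∞` passes through `s₁`.
  | zero =>
    obtain ⟨i, rfl, -⟩ := hyT
    have h1 : .one ∉ Q := fun h => by simpa [typeSet] using hQT _ h (by simp)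
    have h2 : .infty ∉ Q := fun h => by simpa [typeSet] using hQT _ h (by simp)
    have h3 : .s ⟨0, by omega⟩ ∈ Q := by
      rcases hab with hab | hab
      · rw [hab] at hαQ hyQ ⊢
        simp only [Label.pos] at hαQ hyQ ⊢
        omega
      · by_contra h3
        rw [hab] at h1 h2 h3
        apply not_not.2 hyQ
        rw [hab]
        simp only [Label.pos] at h1 h2 h3 ⊢
        omega
    obtain ⟨j, hj, hj'⟩ := hQT _ h3 (by simp)
    cases hj
    simp [hfirst] at hj'
  -- Likewise, an arc through `1` and some `sᵢ` that misses `0` and `∞` passes through `sₙ`.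
  | one =>
    obtain ⟨i, rfl, -⟩ := hyT
    have hi := i.2
    have h1 : .zero ∉ Q := fun h => by simpa [typeSet] using hQT _ h (by simp)
    have h2 : .infty ∉ Q := fun h => by simpa [typeSet] using hQT _ h (by simp)
    have h3 : .s ⟨n - 1, by omega⟩ ∈ Q := by
      rcases hab with hab | hab
      · rw [hab] at hαQ hyQ ⊢
        simp only [Label.pos] at hαQ hyQ ⊢
        omega
      · exfalso
        rw [hab] at h1 h2
        apply not_not.2 hαQ
        rw [hab]
        simp only [Label.pos] at h1 h2 ⊢
        omega
    obtain ⟨j, hj, hj'⟩ := hQT _ h3 (by simp)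
    cases hj
    simp [hlast] at hj'
  -- On the circle `∞` is separated from each `sᵢ` by `0` on one side and `1` on the other.
  | infty =>
    obtain ⟨i, rfl⟩ := hyT
    have hi := i.2
    have h1 : .zero ∉ Q := fun h => by simpa [typeSet] using hQT _ h (by simp)
    have h2 : .one ∉ Q := fun h => by simpa [typeSet] using hQT _ h (by simp)
    rcases hab with hab | hab
    · rw [hab] at hαQ hyQ h2
      simp only [Label.pos] at hαQ hyQ h2
      omega
    · rw [hab] at h1 h2
      apply not_not.2 hyQ
      rw [hab]
      simp only [Label.pos] at h1 h2 ⊢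
      omega
  | s j => exact hyT

theorem closure_range_Phi_subset (hn : 0 < n) {ε : Fin n → Fin 2} (hfirst : ε ⟨0, hn⟩ = 1)
    (hlast : ε ⟨n - 1, by omega⟩ = 0) : closure (Set.range (Phi (n := n))) ⊆ (divA ε)ᶜ := by
  rintro p hp ⟨P, hP, hT, hpP⟩
  exact not_hasType_of_isArc hn hfirst hlast (isArc_of_mem_closure hp hP hpP) hT

theorem boundary_subset (hn : 0 < n) {ε : Fin n → Fin 2} (hfirst : ε ⟨0, hn⟩ = 1)
    (hlast : ε ⟨n - 1, by omega⟩ = 0) :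
    closure (Set.range (Phi (n := n))) \ Set.range (Phi (n := n)) ⊆
      divB n \ (divB n ∩ divA ε) := by
  rintro p ⟨hp, hp'⟩
  obtain ⟨P, hP, hpP⟩ := exists_boundaryDivisor fun h => hp' (mem_range_Phi_of_openStratum hp h)
  exact ⟨⟨P, hP, isArc_of_mem_closure hp hP hpP, hpP⟩,
    fun h => closure_range_Phi_subset hn hfirst hlast hp h.2⟩

end ZetaModuli

namespace ZetaModuli

variable {n : ℕ}

open MvPolynomial

/-! ### Cubes in the closed cell, indexed by the orderings of the gaps -/

/-- The gap `g` (between the positions `g` and `g + 1`) lies between the labels `a` and `b`. -/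
def Between (a b : Label n) (g : Fin (n + 1)) : Prop :=
  (a.pos ≤ g ∧ g.val < b.pos) ∨ (b.pos ≤ g ∧ g.val < a.pos)

theorem exists_between {a b : Label n} (ha : a ≠ .infty) (hb : b ≠ .infty) (hab : a ≠ b) :
    ∃ g, Between a b g := by
  have h1 := pos_lt_infty ha
  have h2 := pos_lt_infty hb
  rcases lt_or_gt_of_ne (fun h => hab (Label.pos_injective h)) with h | h
  · exact ⟨⟨a.pos, by omega⟩, Or.inl ⟨le_rfl, h⟩⟩
  · exact ⟨⟨b.pos, by omega⟩, Or.inr ⟨le_rfl, h⟩⟩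

/-- The gaps between `a` and `b` are small with respect to the gaps of rank greater than `k`. -/
def gapRel (π : Equiv.Perm (Fin (n + 1))) (k : Fin n) (a b : Label n) : Prop :=
  a ≠ .infty ∧ b ≠ .infty ∧ ∀ g, Between a b g → (π g).val ≤ k.val

open Classical in
/-- The difference of `a` and `b`, up to sign and without the common factors of the gaps. -/
noncomputable def gapUnit (π : Equiv.Perm (Fin (n + 1))) (a b : Label n) :
    MvPolynomial (Fin n) ℂ :=
  ∑ g with Between a b g, ∏ k with (π g).val ≤ k.val ∧ ¬ gapRel π k a b, X k

/-- The sum of the gaps up to a label, if the gap of rank `r` is the product of the parameters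
`k ≥ r`. -/
noncomputable def gapSum (π : Equiv.Perm (Fin (n + 1))) (l : Label n) : MvPolynomial (Fin n) ℂ :=
  ∑ g : Fin (n + 1) with g.val < l.pos, ∏ k : Fin n with (π g).val ≤ k.val, X k

theorem gapSum_sub (π : Equiv.Perm (Fin (n + 1))) {a b : Label n}
    (h : b.pos < a.pos) : gapSum π a - gapSum π b =
      (open Classical in ∏ k with gapRel π k a b, X k) * gapUnit π a b := by
  classical
  have h1 : gapSum π a - gapSum π b
      = ∑ g with Between a b g, ∏ k : Fin n with (π g).val ≤ k.val, X k := by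
    rw [sub_eq_iff_eq_add, gapSum, gapSum, ← Finset.sum_union]
    · congr 1
      ext g
      simp only [Finset.mem_filter, Finset.mem_univ, true_and, Finset.mem_union]
      unfold Between
      omega
    · rw [Finset.disjoint_left]
      intro g
      simp only [Finset.mem_filter, Finset.mem_univ, true_and]
      unfold Between
      omega
  rw [h1, gapUnit, Finset.mul_sum]
  refine Finset.sum_congr rfl fun g hg => ?_
  have hg := (Finset.mem_filter.1 hg).2
  rw [← Finset.prod_union]
  · congr 1
    ext k
    simp only [Finset.mem_filter, Finset.mem_univ, true_and, Finset.mem_union]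
    constructor
    · intro hk
      by_cases hr : gapRel π k a b
      · exact Or.inl hr
      · exact Or.inr ⟨hk, hr⟩
    · rintro (hr | hr)
      · exact hr.2.2 g hg
      · exact hr.1
  · rw [Finset.disjoint_left]
    intro k hk hk'
    exact (Finset.mem_filter.1 hk').2.2 (Finset.mem_filter.1 hk).2

theorem between_symm {a b : Label n} {g : Fin (n + 1)} : Between a b g ↔ Between b a g := or_comm

theorem gapRel_symm {π : Equiv.Perm (Fin (n + 1))} {k : Fin n} {a b : Label n} :
    gapRel π k a b ↔ gapRel π k b a := by
  unfold gapRel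
  simp only [between_symm (a := a)]
  tauto

theorem gapUnit_symm (π : Equiv.Perm (Fin (n + 1))) (a b : Label n) :
    gapUnit π a b = gapUnit π b a := by
  classical
  exact Finset.sum_congr (Finset.filter_congr fun g _ => between_symm) fun g _ =>
    Finset.prod_congr (Finset.filter_congr fun k _ => by rw [gapRel_symm]) fun _ _ => rfl

open Classical in
/-- The family of configurations whose gaps are ordered by the permutation. -/
noncomputable def gapSystem (π : Equiv.Perm (Fin (n + 1))) : DifSystem n where
  z := gapSum π
  r := gapRel π
  P a b := if a = .infty then 1 else if b = .infty then -1 else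
    if a.pos < b.pos then - gapUnit π a b else gapUnit π a b
  symm := gapRel_symm.1
  trans := by
    rintro j a b c ⟨ha, hb, h⟩ ⟨-, hc, h'⟩
    refine ⟨ha, hc, fun g hg => ?_⟩
    have : Between a b g ∨ Between b c g := by
      unfold Between at *
      omega
    exact this.elim (h g) (h' g)
  -- The relations grow with `k`, so only comparability of `j` and `k` is needed.
  nest := by
    rintro j k a b c ⟨ha, hb, h⟩ ⟨-, hc, h'⟩
    rcases le_total j k with hjk | hjk
    · exact Or.inr ⟨ha, hb, fun g hg => (h g hg).trans hjk⟩
    · exact Or.inl ⟨ha, hc, fun g hg => (h' g hg).trans hjk⟩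
  factor := by
    intro a b hab
    by_cases ha : a = .infty
    · subst ha
      simp [dif_infty_left _ hab.symm, gapRel]
    by_cases hb : b = .infty
    · subst hb
      simp [dif_infty_right _ hab, gapRel, ha]
    rw [dif_fin _ ha hb, if_neg ha, if_neg hb]
    split_ifs with h
    · have := gapSum_sub π h
      simp only [gapRel_symm (a := b), gapUnit_symm π b] at this
      linear_combination -this
    · exact gapSum_sub π (lt_of_le_of_ne (not_lt.1 h)
        fun e => hab (Label.pos_injective e).symm)

/-- All terms are nonnegative, and the term of the gap of highest rank between `a` and `b` is `1`,
as its whole monomial is a common factor. Hence the closed cube lies in the domain of the family. -/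
theorem eval_gapUnit_ne_zero (π : Equiv.Perm (Fin (n + 1))) {y : Fin n → ℝ} (hy : ∀ k, 0 ≤ y k)
    {a b : Label n} (ha : a ≠ .infty) (hb : b ≠ .infty) (hab : a ≠ b) :
    eval (fun k => (y k : ℂ)) (gapUnit π a b) ≠ 0 := by
  classical
  let f : Fin (n + 1) → ℝ := fun g => ∏ k with (π g).val ≤ k.val ∧ ¬ gapRel π k a b, y k
  have h1 : eval (fun k => (y k : ℂ)) (gapUnit π a b) = ((∑ g with Between a b g, f g : ℝ) : ℂ) := by
    simp only [gapUnit, map_sum, map_prod, eval_X, f]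
    push_cast
    rfl
  obtain ⟨g₀, hg₀⟩ := exists_between ha hb hab
  obtain ⟨g, hg, hmax⟩ := Finset.exists_max_image (Finset.univ.filter fun g => Between a b g)
    (fun g => (π g).val) ⟨g₀, Finset.mem_filter.2 ⟨Finset.mem_univ _, hg₀⟩⟩
  have hf0 : ∀ g, 0 ≤ f g := fun g => Finset.prod_nonneg fun k _ => hy k
  have hf1 : f g = 1 := by
    refine Finset.prod_eq_one fun k hk => ?_
    exfalso
    have hk := (Finset.mem_filter.1 hk).2
    exact hk.2 ⟨ha, hb, fun g' hg' =>
      (hmax g' (Finset.mem_filter.2 ⟨Finset.mem_univ _, hg'⟩)).trans hk.1⟩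
  have h2 : (0 : ℝ) < ∑ g with Between a b g, f g :=
    Finset.sum_pos' (fun g _ => hf0 g) ⟨g, hg, by rw [hf1]; exact one_pos⟩
  rw [h1]
  exact_mod_cast h2.ne'

theorem ofReal_mem_U (π : Equiv.Perm (Fin (n + 1))) {y : Fin n → ℝ} (hy : ∀ k, 0 ≤ y k) :
    (fun k => (y k : ℂ)) ∈ (gapSystem π).U := by
  intro a b hab
  simp only [gapSystem]
  split_ifs with h1 h2 h3
  · simp
  · simp
  · rw [map_neg]
    exact neg_ne_zero.2 (eval_gapUnit_ne_zero π hy h1 h2 hab)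
  · exact eval_gapUnit_ne_zero π hy h1 h2 hab

/-- The singular cube of the configurations whose gaps are ordered by the permutation. -/
noncomputable def gapCube (π : Equiv.Perm (Fin (n + 1))) : SingularCube (Mbar (Label n)) n where
  toFun y := (gapSystem π).psi ⟨fun k => ((y k : ℝ) : ℂ), ofReal_mem_U π fun k => (y k).2.1⟩
  continuous_toFun := by
    refine (gapSystem π).continuous_psi.comp (Continuous.subtype_mk ?_ _)
    exact continuous_pi fun k =>
      Complex.continuous_ofReal.comp (continuous_subtype_val.comp (continuous_apply k))

theorem cr_gapCube (π : Equiv.Perm (Fin (n + 1))) (y : Fin n → I) (q : Fin 4 ↪ Label n) :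
    (gapCube π y).cr q = (gapSystem π).crs (fun k => ((y k : ℝ) : ℂ)) q := rfl

theorem projIcc_coe_of_mem {y : Fin n → ℝ} (hy : y ∈ Icc (0 : Fin n → ℝ) 1) (k : Fin n) :
    ((Set.projIcc 0 1 zero_le_one (y k) : I) : ℝ) = y k := by
  rw [Set.projIcc_of_mem zero_le_one (show y k ∈ Icc (0 : ℝ) 1 from ⟨hy.1 k, hy.2 k⟩)]

theorem cr_cubeFun_gapCube (π : Equiv.Perm (Fin (n + 1))) {y : Fin n → ℝ}
    (hy : y ∈ Icc (0 : Fin n → ℝ) 1) (q : Fin 4 ↪ Label n) :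
    (cubeFun (gapCube π) y).cr q = (gapSystem π).crs (fun k => (y k : ℂ)) q := by
  rw [cubeFun, cr_gapCube]
  simp only [projIcc_coe_of_mem hy]

theorem isSmoothCube_gapCube (π : Equiv.Perm (Fin (n + 1))) : IsSmoothCube (gapCube π) := by
  intro y hy q hq
  rw [cr_cubeFun_gapCube π hy] at hq
  have h1 : ContDiffAt ℝ ∞ (fun v => finVal ((gapSystem π).crs v q)) (fun k => (y k : ℂ)) :=
    ((gapSystem π).analyticAt_crs q hq).contDiffAt.restrict_scalars ℝ
  have h2 : ContDiff ℝ ∞ (fun w : Fin n → ℝ => fun k => (w k : ℂ)) :=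
    contDiff_pi.2 fun k => Complex.ofRealCLM.contDiff.comp (contDiff_apply ℝ ℝ k)
  have h3 : ContDiffAt ℝ ∞ (fun w : Fin n → ℝ => finVal ((gapSystem π).crs (fun k => (w k : ℂ)) q))
      y := ContDiffAt.comp (f := fun w : Fin n → ℝ => fun k => (w k : ℂ)) y h1 h2.contDiffAt
  refine h3.contDiffWithinAt.congr (fun w hw => ?_) ?_
  · rw [cr_cubeFun_gapCube π hw]
  · rw [cr_cubeFun_gapCube π hy]

/-! ### Real coordinates of the cubes -/

/-- The gap of rank `r`. -/
noncomputable def gapOfRank (y : Fin n → ℝ) (r : Fin (n + 1)) : ℝ := ∏ k : Fin n with r.val ≤ k.val, y k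

theorem gapOfRank_last (y : Fin n → ℝ) : gapOfRank y (Fin.last n) = 1 := by
  refine Finset.prod_eq_one fun k hk => ?_
  have h1 := (Finset.mem_filter.1 hk).2
  have h2 := k.2
  simp only [Fin.val_last] at h1
  omega

theorem gapOfRank_castSucc (y : Fin n → ℝ) (k : Fin n) :
    gapOfRank y k.castSucc = y k * gapOfRank y k.succ := by
  unfold gapOfRank
  have : (Finset.univ.filter fun j : Fin n => (k.castSucc : ℕ) ≤ j)
      = insert k (Finset.univ.filter fun j : Fin n => (k.succ : ℕ) ≤ j) := by
    ext j
    simp only [Finset.mem_filter, Finset.mem_univ, true_and, Finset.mem_insert, Fin.val_castSucc,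
      Fin.val_succ, Fin.ext_iff]
    omega
  rw [this, Finset.prod_insert (by simp)]

theorem gapOfRank_pos {y : Fin n → ℝ} (hy : ∀ k, 0 < y k) (r : Fin (n + 1)) : 0 < gapOfRank y r :=
  Finset.prod_pos fun k _ => hy k

theorem gapOfRank_strictMono {y : Fin n → ℝ} (hy : y ∈ openCube n) : StrictMono (gapOfRank y) := by
  rw [Fin.strictMono_iff_lt_succ]
  intro k
  rw [gapOfRank_castSucc]
  have := gapOfRank_pos (fun k => (hy k).1) k.succ
  nlinarith [(hy k).2]

/-- The simplicial coordinates of a configuration with given gaps. -/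
noncomputable def gapT (d : Fin (n + 1) → ℝ) (i : Fin n) : ℝ :=
  (∑ g : Fin (n + 1) with g.val ≤ i.val, d g) / ∑ g, d g

theorem sum_filter_lt_castSucc (d : Fin (n + 1) → ℝ) (m : ℕ) (hm : m < n + 1) :
    ∑ g : Fin (n + 1) with g.val ≤ m, d g
      = (∑ g : Fin (n + 1) with g.val < m, d g) + d ⟨m, hm⟩ := by
  have : (Finset.univ.filter fun g : Fin (n + 1) => g.val ≤ m)
      = insert ⟨m, hm⟩ (Finset.univ.filter fun g : Fin (n + 1) => g.val < m) := by
    ext g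
    simp only [Finset.mem_filter, Finset.mem_univ, true_and, Finset.mem_insert, Fin.ext_iff]
    omega
  rw [this, Finset.sum_insert (by simp), add_comm]

theorem gapT_mem_openSimplex {d : Fin (n + 1) → ℝ} (hd : ∀ g, 0 < d g) : gapT d ∈ openSimplex n := by
  have hS : 0 < ∑ g, d g := Finset.sum_pos (fun g _ => hd g) Finset.univ_nonempty
  refine ⟨fun i j hij => ?_, fun i => ⟨?_, ?_⟩⟩
  · refine div_lt_div_of_pos_right ?_ hS
    refine Finset.sum_lt_sum_of_subset (i := j.castSucc) ?_ ?_ ?_ (hd _) fun g _ _ => (hd g).le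
    · intro g hg
      simp only [Finset.mem_filter, Finset.mem_univ, true_and] at hg ⊢
      have := Fin.lt_def.1 hij
      omega
    · simp
    · simpa using hij
  · refine div_pos (Finset.sum_pos (fun g _ => hd g) ⟨0, by simp⟩) hS
  · rw [gapT, div_lt_one hS]
    refine Finset.sum_lt_sum_of_subset (i := Fin.last n) (Finset.filter_subset _ _)
      (Finset.mem_univ _) ?_ (hd _) fun g _ _ => (hd g).le
    simp

/-- The partial sums are determined up to the ratio of the totals, and the gaps are their successive
differences. -/
theorem eq_mul_of_gapT_eq {d d' : Fin (n + 1) → ℝ} (hd : ∀ g, 0 < d g) (hd' : ∀ g, 0 < d' g)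
    (h : gapT d = gapT d') : ∃ c : ℝ, 0 < c ∧ ∀ g, d g = c * d' g := by
  have hS : 0 < ∑ g, d g := Finset.sum_pos (fun g _ => hd g) Finset.univ_nonempty
  have hS' : 0 < ∑ g, d' g := Finset.sum_pos (fun g _ => hd' g) Finset.univ_nonempty
  refine ⟨(∑ g, d g) / ∑ g, d' g, div_pos hS hS', ?_⟩
  have hle : ∀ m, m < n + 1 → ∑ g : Fin (n + 1) with g.val ≤ m, d g
      = (∑ g, d g) / (∑ g, d' g) * ∑ g : Fin (n + 1) with g.val ≤ m, d' g := by
    intro m hm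
    rcases lt_or_ge m n with hmn | hmn
    · have := congrFun h ⟨m, hmn⟩
      simp only [gapT] at this
      rw [div_eq_div_iff hS.ne' hS'.ne'] at this
      field_simp
      linear_combination this
    · have hall : (Finset.univ.filter fun g : Fin (n + 1) => g.val ≤ m) = Finset.univ := by
        ext g
        simp only [Finset.mem_filter, Finset.mem_univ, true_and, iff_true]
        omega
      rw [hall]
      field_simp
  intro g
  obtain ⟨m, hm⟩ := g
  have h1 := hle m hm
  rw [sum_filter_lt_castSucc d m hm, sum_filter_lt_castSucc d' m hm] at h1
  rcases Nat.eq_zero_or_pos m with rfl | hpos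
  · simpa using h1
  · have h2 := hle (m - 1) (by omega)
    have hset : (Finset.univ.filter fun g : Fin (n + 1) => g.val ≤ m - 1)
        = Finset.univ.filter fun g : Fin (n + 1) => g.val < m := by
      ext g
      simp only [Finset.mem_filter, Finset.mem_univ, true_and]
      omega
    rw [hset] at h2
    linear_combination h1 - h2

theorem eq_Phi_of_tCoord {p : Mbar (Label n)} (hp : p ∈ openStratum (Label n))
    (t : openSimplex n) (h : ∀ i, tCoord i p = (t.1 i : ℂ)) : p = Phi t := by
  obtain ⟨z, hz, h0, h1, rfl⟩ := exists_normalized hp (a₀ := .zero) (b₀ := .one) (by simp)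
    (by simp) (by simp)
  rw [Phi_eq]
  refine ofConfig_zConfig_congr _ _ fun a ha => ?_
  cases a with
  | zero => exact h0
  | one => exact h1
  | s i =>
    have := h i
    rw [tCoord_zConfig, h0, h1, sub_zero, sub_zero, div_one] at this
    exact this
  | infty => exact absurd rfl ha

theorem zv_gapSystem (π : Equiv.Perm (Fin (n + 1))) (y : Fin n → ℝ) (l : Label n) :
    (gapSystem π).zv (fun k => (y k : ℂ)) l
      = ((∑ g : Fin (n + 1) with g.val < l.pos, gapOfRank y (π g) : ℝ) : ℂ) := by
  change eval _ (gapSum π l) = _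
  simp only [gapSum, gapOfRank, map_sum, map_prod, eval_X]
  push_cast
  rfl

theorem gapCube_eq_Phi (π : Equiv.Perm (Fin (n + 1))) {y : Fin n → I} (hy : ∀ k, 0 < (y k : ℝ)) :
    gapCube π y = Phi ⟨gapT fun g => gapOfRank (fun k => (y k : ℝ)) (π g),
      gapT_mem_openSimplex fun _ => gapOfRank_pos hy _⟩ := by
  have hU := ofReal_mem_U π fun k => (hy k).le
  have hz := (gapSystem π).dif_zv_ne_zero hU fun k => by exact_mod_cast (hy k).ne'
  have he : gapCube π y = Mbar.ofConfig (zConfig _ hz) := (gapSystem π).psi_eq ⟨_, hU⟩ hz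
  refine eq_Phi_of_tCoord (he ▸ ⟨_, rfl⟩) _ fun i => ?_
  rw [he, tCoord_zConfig, zv_gapSystem, zv_gapSystem, zv_gapSystem]
  simp only [Label.pos, gapT, Nat.not_lt_zero, Finset.filter_false, Finset.sum_empty,
    Complex.ofReal_zero, sub_zero, Nat.lt_succ_iff]
  have : (Finset.univ.filter fun g : Fin (n + 1) => g.val ≤ n) = Finset.univ := by
    ext g
    simp only [Finset.mem_filter, Finset.mem_univ, true_and, iff_true]
    omega
  rw [this, ← Complex.ofReal_div]

theorem openCube_subset_Icc : openCube n ⊆ Icc (0 : Fin n → ℝ) 1 :=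
  fun _ hy => ⟨fun k => (hy k).1.le, fun k => (hy k).2.le⟩

theorem cubeFun_gapCube_eq_Phi (π : Equiv.Perm (Fin (n + 1))) {y : Fin n → ℝ}
    (hy : y ∈ openCube n) : cubeFun (gapCube π) y = Phi ⟨gapT fun g => gapOfRank y (π g),
      gapT_mem_openSimplex fun _ => gapOfRank_pos (fun k => (hy k).1) _⟩ := by
  have hp := projIcc_coe_of_mem (openCube_subset_Icc hy)
  rw [cubeFun, gapCube_eq_Phi π fun k => by rw [hp]; exact (hy k).1]
  simp only [hp]

theorem gapT_eq_of_Phi_eq {t t' : openSimplex n} (h : Phi t = Phi t') : t = t' := by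
  refine Subtype.ext (funext fun i => ?_)
  have := congrArg (tCoord i) h
  rw [tCoord_Phi, tCoord_Phi] at this
  exact_mod_cast this

/-- The `tᵢ` give the gaps up to scale. On the open cube their sizes are distinct, so their order is
the permutation; the largest gap is `1`, which fixes the scale, and the parameters are ratios of
gaps of consecutive rank. -/
theorem eq_of_gapCube_eq {π π' : Equiv.Perm (Fin (n + 1))} {y y' : Fin n → ℝ}
    (hy : y ∈ openCube n) (hy' : y' ∈ openCube n)
    (h : cubeFun (gapCube π) y = cubeFun (gapCube π') y') : π = π' ∧ y = y' := by
  rw [cubeFun_gapCube_eq_Phi π hy, cubeFun_gapCube_eq_Phi π' hy'] at h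
  have ht := congrArg Subtype.val (gapT_eq_of_Phi_eq h)
  obtain ⟨c, hc, hg⟩ := eq_mul_of_gapT_eq (fun g => gapOfRank_pos (fun k => (hy k).1) _)
    (fun g => gapOfRank_pos (fun k => (hy' k).1) _) ht
  have hm := gapOfRank_strictMono hy
  have hm' := gapOfRank_strictMono hy'
  have hππ : π = π' := by
    have hmono : StrictMono (π.symm.trans π') := by
      intro r s hrs
      have h1 := hm hrs
      rw [← π.apply_symm_apply r, ← π.apply_symm_apply s, hg, hg, mul_lt_mul_iff_right₀ hc] at h1
      exact hm'.lt_iff_lt.1 h1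
    -- An order automorphism of a finite chain is the identity.
    have hid : (hmono.orderIsoOfSurjective _ (π.symm.trans π').surjective) = OrderIso.refl _ :=
      Subsingleton.elim _ _
    ext g
    have := congrArg (fun f : Fin (n + 1) ≃o Fin (n + 1) => f (π g)) hid
    simp at this
    rw [this]
  subst hππ
  refine ⟨rfl, ?_⟩
  have hr : ∀ r, gapOfRank y r = c * gapOfRank y' r := fun r => by
    have := hg (π.symm r)
    rwa [π.apply_symm_apply] at this
  have hc1 : c = 1 := by
    have := hr (Fin.last n)
    rw [gapOfRank_last, gapOfRank_last, mul_one] at this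
    exact this.symm
  funext k
  have h1 := hr k.castSucc
  rw [gapOfRank_castSucc, gapOfRank_castSucc, hr, hc1, one_mul, one_mul] at h1
  exact mul_right_cancel₀ (gapOfRank_pos (fun k => (hy' k).1) k.succ).ne' h1

/-- Sort the gaps of `t` by size. Equal gaps are allowed; they give parameters equal to `1`. -/
theorem Phi_mem_range_gapCube (t : openSimplex n) :
    ∃ (π : Equiv.Perm (Fin (n + 1))) (y : Fin n → I), gapCube π y = Phi t := by
  obtain ⟨t, ht⟩ := t
  -- the end points of the gaps
  let T : ℕ → ℝ := fun j => if h : j = 0 then 0 else if h' : j ≤ n then t ⟨j - 1, by omega⟩ else 1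
  have hT : ∀ j, j ≤ n → T j < T (j + 1) := by
    intro j hj
    rcases Nat.eq_zero_or_pos j with rfl | hj0
    · have h0 : T 0 = 0 := dif_pos rfl
      rw [h0]
      simp only [T, dif_neg (Nat.succ_ne_zero 0)]
      split_ifs
      · exact (ht.2 _).1
      · norm_num
    · simp only [T, dif_neg hj0.ne', dif_pos hj, dif_neg (Nat.succ_ne_zero j)]
      split_ifs
      · exact ht.1 (Fin.lt_def.2 (by simp; omega))
      · exact (ht.2 _).2
  let d : Fin (n + 1) → ℝ := fun g => T (g + 1) - T g
  have hd : ∀ g, 0 < d g := fun g => sub_pos.2 (hT g (by omega))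
  have hsum : ∀ m, m ≤ n → ∑ g : Fin (n + 1) with g.val ≤ m, d g = T (m + 1) := by
    intro m hm
    induction m with
    | zero =>
      rw [sum_filter_lt_castSucc d 0 (by omega)]
      have h0 : T 0 = 0 := dif_pos rfl
      simp [d, h0]
    | succ m ih =>
      rw [sum_filter_lt_castSucc d (m + 1) (by omega)]
      simp only [Nat.lt_succ_iff]
      rw [ih (by omega)]
      simp [d]
  have hgapT : gapT d = t := by
    funext i
    have hall : ∑ g, d g = 1 := by
      have := hsum n le_rfl
      rw [Finset.filter_true_of_mem fun g _ => by omega] at this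
      rw [this]
      simp [T]
    rw [gapT, hall, div_one, hsum i (by omega)]
    simp [T]
  let ρ := Tuple.sort d
  have hmono : Monotone (d ∘ ρ) := Tuple.monotone_sort d
  -- Ratios of consecutive sorted gaps; their products telescope to the gaps divided by the largest
  -- one.
  let y : Fin n → ℝ := fun k => d (ρ k.castSucc) / d (ρ k.succ)
  have hy0 : ∀ k, 0 < y k := fun k => div_pos (hd _) (hd _)
  have hy1 : ∀ k, y k ≤ 1 := fun k =>
    (div_le_one (hd _)).2 (hmono (Fin.castSucc_lt_succ).le)
  have hrank : ∀ r, gapOfRank y r = d (ρ r) / d (ρ (Fin.last n)) := by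
    intro r
    induction r using Fin.reverseInduction with
    | last => rw [gapOfRank_last, div_self (hd _).ne']
    | cast k ih =>
      rw [gapOfRank_castSucc, ih]
      have h1 := (hd (ρ k.succ)).ne'
      have h2 := (hd (ρ (Fin.last n))).ne'
      simp only [y]
      field_simp
  refine ⟨ρ.symm, fun k => ⟨y k, (hy0 k).le, hy1 k⟩, ?_⟩
  rw [gapCube_eq_Phi _ hy0]
  congr 1
  apply Subtype.ext
  simp only [hrank, Equiv.apply_symm_apply]
  rw [← hgapT]
  funext i
  have hl := (hd (ρ (Fin.last n))).ne'
  simp only [gapT, ← Finset.sum_div]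
  rw [div_div_div_cancel_right₀ hl]

theorem dense_Ioo_pi : Dense {y : Fin n → I | ∀ k, 0 < y k ∧ y k < 1} := by
  have h : Dense (Ioo (0 : I) 1) := by
    rw [dense_iff_closure_eq, closure_Ioo zero_ne_one]
    exact eq_univ_of_forall fun x => ⟨x.2.1, x.2.2⟩
  refine (dense_pi (Set.univ : Set (Fin n)) (s := fun _ => Ioo (0 : I) 1) fun _ _ => h).mono ?_
  intro y hy k
  exact hy k (mem_univ k)

theorem range_gapCube_subset (π : Equiv.Perm (Fin (n + 1))) :
    Set.range (gapCube π) ⊆ closure (Set.range (Phi (n := n))) := by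
  rintro _ ⟨y, rfl⟩
  refine closure_mono ?_ ((gapCube π).continuous.continuousAt.continuousWithinAt.mem_closure_image
    (dense_Ioo_pi y))
  rintro _ ⟨y', hy', rfl⟩
  rw [gapCube_eq_Phi π fun k => (hy' k).1]
  exact ⟨_, rfl⟩

/-- The cubes are finitely many compact sets that cover the open cell, so their union contains its
closure. -/
theorem iUnion_range_gapCube :
    ⋃ π : Equiv.Perm (Fin (n + 1)), Set.range (gapCube π) = closure (Set.range (Phi (n := n))) := by
  apply Subset.antisymm
  · exact iUnion_subset range_gapCube_subset
  · refine closure_minimal ?_ (isClosed_iUnion_of_finite fun π =>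
      (isCompact_range (gapCube π).continuous).isClosed)
    rintro _ ⟨t, rfl⟩
    obtain ⟨π, y, h⟩ := Phi_mem_range_gapCube t
    exact mem_iUnion.2 ⟨π, y, h⟩

end ZetaModuli

namespace ZetaModuli

variable {n : ℕ}

/-! ### The orientation of the cubes -/

/-- A gap is a product of distinct parameters, hence affine in each of them. -/
theorem gapOfRank_add_smul_single {y : Fin n → ℝ} {k : Fin n} (hk : y k ≠ 0) (s : ℝ)
    (r : Fin (n + 1)) : gapOfRank (y + s • Pi.single k 1) r
      = gapOfRank y r + s * (gapOfRank y r * (if r.val ≤ k.val then 1 else 0) / y k) := by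
  unfold gapOfRank
  split_ifs with h
  · have hmem : k ∈ Finset.univ.filter fun j : Fin n => r.val ≤ j.val := by simpa using h
    rw [← Finset.mul_prod_erase _ _ hmem, ← Finset.mul_prod_erase _ y hmem]
    have : ∏ j ∈ (Finset.univ.filter fun j : Fin n => r.val ≤ j.val).erase k,
        (y + s • Pi.single k (1 : ℝ) : Fin n → ℝ) j
        = ∏ j ∈ (Finset.univ.filter fun j : Fin n => r.val ≤ j.val).erase k, y j := by
      refine Finset.prod_congr rfl fun j hj => ?_
      simp [Pi.single_eq_of_ne (Finset.ne_of_mem_erase hj)]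
    rw [this]
    simp only [Pi.add_apply, Pi.smul_apply, Pi.single_eq_same, smul_eq_mul, mul_one]
    field_simp
  · have : ∏ j : Fin n with r.val ≤ j.val, (y + s • Pi.single k (1 : ℝ) : Fin n → ℝ) j
        = ∏ j : Fin n with r.val ≤ j.val, y j := by
      refine Finset.prod_congr rfl fun j hj => ?_
      have hj := (Finset.mem_filter.1 hj).2
      have hjk : j ≠ k := by rintro rfl; exact h hj
      simp [Pi.single_eq_of_ne hjk]
    rw [this]
    simp

theorem differentiable_gapOfRank (r : Fin (n + 1)) :
    Differentiable ℝ fun y : Fin n → ℝ => gapOfRank y r := by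
  unfold gapOfRank
  fun_prop

theorem hasDerivAt_quotient (A A' B B' : ℝ) (hB : B ≠ 0) :
    HasDerivAt (fun s : ℝ => (A + s * A') / (B + s * B')) ((A' - A * B' / B) / B) 0 := by
  have h1 : HasDerivAt (fun s : ℝ => A + s * A') A' 0 := by
    simpa using ((hasDerivAt_id (0 : ℝ)).mul_const A').const_add A
  have h2 : HasDerivAt (fun s : ℝ => B + s * B') B' 0 := by
    simpa using ((hasDerivAt_id (0 : ℝ)).mul_const B').const_add B
  have := h1.div h2 (by simpa using hB)
  refine this.congr_deriv ?_
  simp only [zero_mul, add_zero]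
  field_simp

theorem isOpen_openCube : IsOpen (openCube n) := by
  have : openCube n = Set.pi Set.univ fun _ => Ioo (0 : ℝ) 1 := by
    ext y
    simp [openCube]
  rw [this]
  exact isOpen_set_pi Set.finite_univ fun _ _ => isOpen_Ioo

theorem re_tCoord_gapCube (π : Equiv.Perm (Fin (n + 1))) {y : Fin n → ℝ} (hy : y ∈ openCube n)
    (i : Fin n) : (tCoord i (cubeFun (gapCube π) y)).re = gapT (fun g => gapOfRank y (π g)) i := by
  rw [cubeFun_gapCube_eq_Phi π hy, tCoord_Phi, Complex.ofReal_re]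

theorem fderiv_tCoord_gapCube (π : Equiv.Perm (Fin (n + 1))) {y : Fin n → ℝ}
    (hy : y ∈ openCube n) (i k : Fin n) :
    fderiv ℝ (fun v => (tCoord i (cubeFun (gapCube π) v)).re) y (Pi.single k 1) =
      ((∑ g : Fin (n + 1) with g.val ≤ i.val,
          gapOfRank y (π g) * (if (π g).val ≤ k.val then 1 else 0) / y k) -
        (∑ g : Fin (n + 1) with g.val ≤ i.val, gapOfRank y (π g)) *
          (∑ g, gapOfRank y (π g) * (if (π g).val ≤ k.val then 1 else 0) / y k) /
          ∑ g, gapOfRank y (π g)) / ∑ g, gapOfRank y (π g) := by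
  have hS : (∑ g, gapOfRank y (π g)) ≠ 0 := (Finset.sum_pos
    (fun g _ => gapOfRank_pos (fun k => (hy k).1) _) Finset.univ_nonempty).ne'
  have hev : (fun v => (tCoord i (cubeFun (gapCube π) v)).re)
      =ᶠ[𝓝 y] fun v => gapT (fun g => gapOfRank v (π g)) i :=
    (isOpen_openCube.eventually_mem hy).mono fun v hv => re_tCoord_gapCube π hv i
  rw [hev.fderiv_eq]
  have hd : DifferentiableAt ℝ (fun v : Fin n → ℝ => gapT (fun g => gapOfRank v (π g)) i) y := by
    have hs : ∀ s : Finset (Fin (n + 1)),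
        DifferentiableAt ℝ (fun v : Fin n → ℝ => ∑ g ∈ s, gapOfRank v (π g)) y := fun s =>
      DifferentiableAt.fun_sum fun g _ => (differentiable_gapOfRank (π g)).differentiableAt
    have h1 := hs (Finset.univ.filter fun g => g.val ≤ i.val)
    have h2 := hs Finset.univ
    have h3 := h2.fun_inv hS
    simpa only [gapT, div_eq_mul_inv] using h1.fun_mul h3
  rw [← hd.lineDeriv_eq_fderiv]
  refine HasDerivAt.deriv ?_
  simp only [gapT, gapOfRank_add_smul_single (hy k).1.ne', Finset.sum_add_distrib,
    ← Finset.mul_sum]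
  exact hasDerivAt_quotient _ _ _ _ hS

/-- The Jacobian matrix of quotients by a common denominator is a Schur complement: border the
derivatives of the numerators and the denominator by their values in the last column. -/
theorem det_block_quotient (Q : Matrix (Fin (n + 1)) (Fin (n + 1)) ℝ)
    (hS : Q (Fin.last n) (Fin.last n) ≠ 0) :
    Q.det = Q (Fin.last n) (Fin.last n) ^ (n + 1) * Matrix.det (Matrix.of fun i k : Fin n =>
      (Q i.castSucc k.castSucc - Q i.castSucc (Fin.last n) * Q (Fin.last n) k.castSucc /
        Q (Fin.last n) (Fin.last n)) / Q (Fin.last n) (Fin.last n)) := by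
  set S := Q (Fin.last n) (Fin.last n) with hSdef
  let e : Fin n ⊕ Fin 1 ≃ Fin (n + 1) := finSumFinEquiv
  have h0 : ∀ i : Fin n, e (Sum.inl i) = i.castSucc := fun i => rfl
  have h1 : ∀ i : Fin 1, e (Sum.inr i) = Fin.last n := fun i => by
    rw [Subsingleton.elim i 0]; rfl
  let D : Matrix (Fin 1) (Fin 1) ℝ := Matrix.of fun _ _ => S
  let D' : Matrix (Fin 1) (Fin 1) ℝ := Matrix.of fun _ _ => S⁻¹
  let B : Matrix (Fin n) (Fin 1) ℝ := Matrix.of fun i _ => Q i.castSucc (Fin.last n)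
  let C : Matrix (Fin 1) (Fin n) ℝ := Matrix.of fun _ k => Q (Fin.last n) k.castSucc
  let A : Matrix (Fin n) (Fin n) ℝ := Matrix.of fun i k => Q i.castSucc k.castSucc
  have h1' : ∀ i j : Fin 1, (1 : Matrix (Fin 1) (Fin 1) ℝ) i j = 1 := fun i j => by
    rw [Subsingleton.elim i j, Matrix.one_apply_eq]
  let _ : Invertible D := ⟨D', by ext i j; simp [D, D', Matrix.mul_apply, hS, h1'],
    by ext i j; simp [D, D', Matrix.mul_apply, hS, h1']⟩
  have hb : Q.submatrix e e = Matrix.fromBlocks A B C D := by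
    ext i j
    cases i <;> cases j <;> simp [h0, h1, A, B, C, D, hSdef]
  rw [← Matrix.det_submatrix_equiv_self e Q, hb, Matrix.det_fromBlocks₂₂]
  have hD : D.det = S := by simp [D]
  have hm : A - B * ⅟D * C = S • Matrix.of fun i k : Fin n =>
      (Q i.castSucc k.castSucc - Q i.castSucc (Fin.last n) * Q (Fin.last n) k.castSucc / S) / S := by
    have hinv : ⅟D = D' := rfl
    ext i k
    simp only [Matrix.sub_apply, Matrix.mul_apply, Finset.univ_unique, Finset.sum_singleton, hinv,
      Matrix.smul_apply, Matrix.of_apply, smul_eq_mul, A, B, C, D']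
    field_simp
  rw [hm, hD, Matrix.det_smul, Fintype.card_fin, pow_succ]
  ring

theorem det_le_indicator : Matrix.det (Matrix.of fun r k : Fin n =>
    if r.val ≤ k.val then (1 : ℝ) else 0) = 1 := by
  rw [Matrix.det_of_isUpperTriangular]
  · simp
  · intro i j hij
    have : j.val < i.val := hij
    simp only [Matrix.of_apply]
    rw [if_neg (by omega)]

/-- The bordered matrix factors into a transposed triangular matrix, the positive gaps, a
row-permuted triangular matrix and positive weights, so its determinant has the sign of `π`. -/
theorem sign_tJacobian_gapCube (π : Equiv.Perm (Fin (n + 1))) {y : Fin n → ℝ}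
    (hy : y ∈ openCube n) :
    (SignType.sign (tJacobian (gapCube π) y) : ℤ) = Equiv.Perm.sign π := by
  have hG : ∀ g, 0 < gapOfRank y (π g) := fun g => gapOfRank_pos (fun k => (hy k).1) _
  have hS : 0 < ∑ g, gapOfRank y (π g) := Finset.sum_pos (fun g _ => hG g) Finset.univ_nonempty
  -- The columns for `k < n` are derivatives, with the factor `1 / y k`; the last column holds the
  -- undifferentiated sums, with the factor `1`.
  let w : Fin (n + 1) → ℝ := Fin.snoc (fun k => (y k)⁻¹) 1
  have hw : ∀ k, 0 < w k := by
    intro k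
    induction k using Fin.lastCases with
    | last => simp [w]
    | cast k => simpa [w] using (hy k).1
  let L : Matrix (Fin (n + 1)) (Fin (n + 1)) ℝ := Matrix.of fun r k => if r.val ≤ k.val then 1 else 0
  have hL : L.det = 1 := det_le_indicator
  let Q : Matrix (Fin (n + 1)) (Fin (n + 1)) ℝ :=
    L.transpose * Matrix.diagonal (fun g => gapOfRank y (π g)) * L.submatrix π id * Matrix.diagonal w
  have hQ : ∀ i k, Q i k = ∑ g : Fin (n + 1) with g.val ≤ i.val,
      gapOfRank y (π g) * (if (π g).val ≤ k.val then 1 else 0) * w k := by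
    intro i k
    simp only [Q]
    rw [Matrix.mul_diagonal, Matrix.mul_apply, Finset.sum_mul, Finset.sum_filter]
    simp only [Matrix.mul_diagonal, Matrix.transpose_apply,
      Matrix.submatrix_apply, L, Matrix.of_apply, id]
    refine Finset.sum_congr rfl fun g _ => ?_
    split_ifs <;> simp
  have hlast : ∀ f : Fin (n + 1) → ℝ, ∑ g : Fin (n + 1) with g.val ≤ (Fin.last n).val, f g
      = ∑ g, f g := by
    intro f
    rw [Finset.filter_true_of_mem fun g _ => by simp only [Fin.val_last]; omega]
  have hcol : ∀ i, Q i (Fin.last n) = ∑ g : Fin (n + 1) with g.val ≤ i.val, gapOfRank y (π g) := by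
    intro i
    rw [hQ]
    refine Finset.sum_congr rfl fun g _ => ?_
    have : (π g).val ≤ (Fin.last n).val := by simp only [Fin.val_last]; omega
    rw [if_pos this]
    simp [w]
  have hQS : Q (Fin.last n) (Fin.last n) = ∑ g, gapOfRank y (π g) := by rw [hcol, hlast]
  have hQdet : Q.det = (∏ g, gapOfRank y (π g)) * (∏ k, w k) * (Equiv.Perm.sign π : ℤ) := by
    simp only [Q, Matrix.det_mul, Matrix.det_transpose, Matrix.det_diagonal, Matrix.det_permute, hL]
    ring
  have h := det_block_quotient Q (hQS ▸ hS.ne')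
  have hJ : tJacobian (gapCube π) y = Matrix.det (Matrix.of fun i k : Fin n =>
      (Q i.castSucc k.castSucc - Q i.castSucc (Fin.last n) * Q (Fin.last n) k.castSucc /
        Q (Fin.last n) (Fin.last n)) / Q (Fin.last n) (Fin.last n)) := by
    unfold tJacobian
    congr 1
    ext i k
    simp only [Matrix.of_apply]
    rw [fderiv_tCoord_gapCube π hy, hQS, hcol, hQ, hQ, hlast]
    simp [w, div_eq_mul_inv]
  rw [← hJ, hQdet, hQS] at h
  have hP : 0 < (∏ g, gapOfRank y (π g)) * ∏ k, w k :=
    mul_pos (Finset.prod_pos fun g _ => hG g) (Finset.prod_pos fun k _ => hw k)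
  have hs := congrArg SignType.sign h
  rw [sign_mul, sign_pos hP, sign_mul, sign_pos (pow_pos hS _), one_mul, one_mul] at hs
  rw [← hs]
  rcases Int.units_eq_one_or (Equiv.Perm.sign π) with h1 | h1 <;> rw [h1] <;> simp

end ZetaModuli

namespace ZetaModuli

variable {n : ℕ}

/-! ### The relative cycle -/

/-- The gaps of rank at most `k` collapse and the one of rank `n` does not. Two neighbouring gaps of
different behaviour yield three consecutive labels whose cross-ratio with `∞` is `1`. -/
theorem gapCube_notMem_openStratum (π : Equiv.Perm (Fin (n + 1))) {y : Fin n → I} {k : Fin n}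
    (hk : y k = 0) : gapCube π y ∉ openStratum (Label n) := by
  -- Otherwise all ranks would be on the same side of `k`, but `0` and `n` are both ranks.
  obtain ⟨i, hi⟩ : ∃ i : Fin n,
      ¬ ((π i.castSucc).val ≤ k.val ↔ (π i.succ).val ≤ k.val) := by
    by_contra! h
    have hc : ∀ g : Fin (n + 1), (π g).val ≤ k.val ↔ (π 0).val ≤ k.val := by
      intro g
      induction g using Fin.induction with
      | zero => rfl
      | succ i ih => rw [← h i, ih]
    have h0 := hc (π.symm 0)
    have h1 := hc (π.symm (Fin.last n))
    rw [π.apply_symm_apply] at h0 h1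
    have := k.2
    simp only [Fin.val_zero, Fin.val_last] at h0 h1
    omega
  let lab : (m : ℕ) → m < n + 3 → Label n := fun m hm => (labelEquiv n).symm ⟨m, hm⟩
  have hlab : ∀ m (hm : m < n + 3), (lab m hm).pos = m := fun m hm =>
    congrArg Fin.val ((labelEquiv n).apply_symm_apply ⟨m, hm⟩)
  have hpinf : (Label.infty : Label n).pos = n + 2 := rfl
  have hne : ∀ {a b : Label n}, a.pos ≠ b.pos → a ≠ b := fun h e => h (congrArg _ e)
  intro hmem
  -- three consecutive labels, of which the first two are close and the third is not
  have key : ∀ a b c : Label n, a.pos < n + 2 → b.pos < n + 2 → c.pos < n + 2 → a.pos ≠ b.pos →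
      a.pos ≠ c.pos → b.pos ≠ c.pos →
      (∀ g, Between a b g → (π g).val ≤ k.val) →
      (∃ g, Between a c g ∧ ¬ (π g).val ≤ k.val) → False := by
    intro a b c ha hb hc hab hac hbc h1 h2
    have hai : a ≠ .infty := hne (by omega)
    have hbi : b ≠ .infty := hne (by omega)
    have hci : c ≠ .infty := hne (by omega)
    have := (gapSystem π).crs_eq_one (ofReal_mem_U π fun k => (y k).2.1) (j := k)
      (by simp [hk]) (mkQuad a b c .infty (hne hab) (hne hac) hai (hne hbc) hbi hci)
      (show gapRel π k a b from ⟨hai, hbi, h1⟩)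
      (show ¬ gapRel π k a c from fun h => h2.elim fun g hg => hg.2 (h.2.2 g hg.1))
      (show ¬ gapRel π k a .infty from fun h => h.2.1 rfl)
    rw [← cr_gapCube] at this
    exact (cr_openStratum hmem _).2.2 this
  have hi2 := i.2
  by_cases h1 : (π i.castSucc).val ≤ k.val
  · have h2 : ¬ (π i.succ).val ≤ k.val := fun h => hi ⟨fun _ => h, fun _ => h1⟩
    refine key (lab i (by omega)) (lab (i + 1) (by omega)) (lab (i + 2) (by omega))
      (by rw [hlab]; omega) (by rw [hlab]; omega) (by rw [hlab]; omega) (by simp [hlab])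
      (by simp [hlab]) (by simp [hlab]) (fun g hg => ?_) ⟨i.succ, ?_, h2⟩
    · have : g = i.castSucc := by
        simp only [Between, hlab] at hg
        apply Fin.ext
        simp only [Fin.val_castSucc]
        omega
      rwa [this]
    · simp [Between, hlab]
  · have h2 : (π i.succ).val ≤ k.val := by
      by_contra h
      exact hi ⟨fun h' => absurd h' h1, fun h' => absurd h' h⟩
    refine key (lab (i + 2) (by omega)) (lab (i + 1) (by omega)) (lab i (by omega))
      (by rw [hlab]; omega) (by rw [hlab]; omega) (by rw [hlab]; omega) (by simp [hlab])
      (by simp [hlab]) (by simp [hlab]) (fun g hg => ?_) ⟨i.castSucc, ?_, h1⟩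
    · have : g = i.succ := by
        simp only [Between, hlab] at hg
        apply Fin.ext
        simp only [Fin.val_succ]
        omega
      rwa [this]
    · simp [Between, hlab]

theorem gapOfRank_swap {y : Fin n → ℝ} {k : Fin n} (hk : y k = 1) (r : Fin (n + 1)) :
    gapOfRank y (Equiv.swap k.castSucc k.succ r) = gapOfRank y r := by
  have h : gapOfRank y k.castSucc = gapOfRank y k.succ := by rw [gapOfRank_castSucc, hk, one_mul]
  rw [Equiv.swap_apply_def]
  split_ifs with h1 h2
  · rw [h1, h]
  · rw [h2, h]
  · rfl

/-- At `y k = 1` the gaps of rank `k` and `k + 1` are equal, so exchanging their ranks changes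
nothing. -/
theorem face_one_gapCube {m : ℕ} (k : Fin (m + 1)) (π : Equiv.Perm (Fin (m + 2))) :
    face k 1 (gapCube (Equiv.swap k.castSucc k.succ * π)) = face k 1 (gapCube π) := by
  -- The formula for the cube through `Phi` needs positive parameters; density supplies the rest of
  -- the face.
  refine ContinuousMap.ext fun y => congrFun (Continuous.ext_on (dense_Ioo_pi (n := m))
    (face k 1 (gapCube (Equiv.swap k.castSucc k.succ * π))).continuous
    (face k 1 (gapCube π)).continuous fun y hy => ?_) y
  have hpos : ∀ j, 0 < ((k.insertNth 1 y : Fin (m + 1) → I) j : ℝ) := by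
    intro j
    induction j using Fin.succAboveCases k with
    | x => simp
    | p j => simpa using (hy j).1
  change gapCube _ (k.insertNth 1 y : Fin (m + 1) → I) = gapCube _ (k.insertNth 1 y : Fin (m + 1) → I)
  rw [gapCube_eq_Phi _ hpos, gapCube_eq_Phi _ hpos]
  congr 1
  apply Subtype.ext
  simp only [Equiv.Perm.mul_apply]
  congr 1
  funext g
  exact gapOfRank_swap (by simp) _

/-- The sum, with signs, of the cubes of all orderings of the gaps. -/
noncomputable def gapChain (n : ℕ) : CubicalChain (Mbar (Label n)) n :=
  ∑ π : Equiv.Perm (Fin (n + 1)), Finsupp.single (gapCube π) (Equiv.Perm.sign π : ℤ)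

theorem openCube_nonempty : (openCube n).Nonempty := ⟨fun _ => 1 / 2, fun _ => by norm_num⟩

theorem gapCube_injective : Function.Injective (gapCube (n := n)) := by
  intro π π' h
  obtain ⟨y, hy⟩ := openCube_nonempty (n := n)
  exact (eq_of_gapCube_eq hy hy (by rw [h])).1

theorem gapChain_apply (π : Equiv.Perm (Fin (n + 1))) :
    gapChain n (gapCube π) = Equiv.Perm.sign π := by
  rw [gapChain, Finsupp.finsetSum_apply, Finset.sum_eq_single π]
  · simp
  · intro π' _ h
    rw [Finsupp.single_eq_of_ne]
    exact fun e => h (gapCube_injective e.symm)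
  · simp

theorem mem_support_gapChain {τ : SingularCube (Mbar (Label n)) n} :
    τ ∈ (gapChain n).support ↔ ∃ π, τ = gapCube π := by
  constructor
  · intro h
    by_contra! h'
    refine Finsupp.mem_support_iff.1 h ?_
    rw [gapChain, Finsupp.finsetSum_apply]
    refine Finset.sum_eq_zero fun π _ => ?_
    rw [Finsupp.single_eq_of_ne]
    exact h' π
  · rintro ⟨π, rfl⟩
    rw [Finsupp.mem_support_iff, gapChain_apply]
    exact Units.ne_zero _

theorem isCellSubdivision_gapChain : IsCellSubdivision (gapChain n) where
  smooth τ hτ := by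
    obtain ⟨π, rfl⟩ := mem_support_gapChain.1 hτ
    exact isSmoothCube_gapCube π
  mapsTo τ hτ y hy := by
    obtain ⟨π, rfl⟩ := mem_support_gapChain.1 hτ
    exact ⟨_, (cubeFun_gapCube_eq_Phi π hy).symm⟩
  injOn τ hτ y hy y' hy' h := by
    obtain ⟨π, rfl⟩ := mem_support_gapChain.1 hτ
    exact (eq_of_gapCube_eq hy hy' h).2
  disjoint τ hτ τ' hτ' h := by
    obtain ⟨π, rfl⟩ := mem_support_gapChain.1 hτ
    obtain ⟨π', rfl⟩ := mem_support_gapChain.1 hτ'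
    rw [Set.disjoint_left]
    rintro _ ⟨y, hy, rfl⟩ ⟨y', hy', e⟩
    exact h (by rw [(eq_of_gapCube_eq hy' hy e).1])
  cover := by
    rw [← iUnion_range_gapCube]
    ext p
    simp only [mem_iUnion, mem_support_gapChain, exists_prop]
    constructor
    · rintro ⟨_, ⟨π, rfl⟩, h⟩
      exact ⟨π, h⟩
    · rintro ⟨π, h⟩
      exact ⟨_, ⟨π, rfl⟩, h⟩
  sign τ hτ y hy := by
    obtain ⟨π, rfl⟩ := mem_support_gapChain.1 hτ
    rw [sign_tJacobian_gapCube π hy, gapChain_apply]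

/-- The adjacent transposition is a fixed-point-free involution that keeps the face and reverses the
sign. -/
theorem sum_face_one_gapCube {m : ℕ} (k : Fin (m + 1)) :
    ∑ π : Equiv.Perm (Fin (m + 2)),
      (Equiv.Perm.sign π : ℤ) • Finsupp.single (face k 1 (gapCube π)) (1 : ℤ) = 0 := by
  have hne : k.castSucc ≠ k.succ := Fin.castSucc_lt_succ.ne
  refine Finset.sum_involution (fun π _ => Equiv.swap k.castSucc k.succ * π) (fun π _ => ?_)
    (fun π _ _ h => ?_) (fun _ _ => Finset.mem_univ _) (fun π _ => ?_)
  · rw [face_one_gapCube, Equiv.Perm.sign_mul, Equiv.Perm.sign_swap hne]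
    simp
  · rw [mul_eq_right, Equiv.swap_eq_one_iff] at h
    exact hne h
  · rw [← mul_assoc, Equiv.swap_mul_self, one_mul]

theorem bdry_gapChain {m : ℕ} : bdry (m + 1) (gapChain (m + 1)) =
    -∑ k : Fin (m + 1), (-1 : ℤ) ^ (k : ℕ) • ∑ π : Equiv.Perm (Fin (m + 2)),
      (Equiv.Perm.sign π : ℤ) • Finsupp.single (face k 0 (gapCube π)) (1 : ℤ) := by
  rw [bdry, gapChain, ← Finsupp.sum_finsetSum_index (by simp) (by simp [add_smul])]
  have h : ∀ π : Equiv.Perm (Fin (m + 2)),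
      ((Finsupp.single (gapCube π) (Equiv.Perm.sign π : ℤ)).sum fun τ a =>
        a • ∑ i : Fin (m + 1), (-1 : ℤ) ^ (i : ℕ) •
          (Finsupp.single (face i 1 τ) (1 : ℤ) - Finsupp.single (face i 0 τ) (1 : ℤ)))
      = ∑ i : Fin (m + 1), (Equiv.Perm.sign π : ℤ) • (-1 : ℤ) ^ (i : ℕ) •
          (Finsupp.single (face i 1 (gapCube π)) (1 : ℤ) -
            Finsupp.single (face i 0 (gapCube π)) (1 : ℤ)) := fun π => by
    rw [Finsupp.sum_single_index (by simp), Finset.smul_sum]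
  rw [Finset.sum_congr rfl fun π _ => h π, Finset.sum_comm, ← Finset.sum_neg_distrib]
  refine Finset.sum_congr rfl fun k _ => ?_
  simp only [smul_comm _ ((-1 : ℤ) ^ (k : ℕ)), ← Finset.smul_sum, smul_sub,
    Finset.sum_sub_distrib]
  rw [sum_face_one_gapCube]
  simp

/-- Only faces at `0` survive. They lie in the closed cell but off the open stratum, hence in `B`;
no degenerate cubes are needed. -/
theorem isRelativeCycle_gapChain (hn : 0 < n) {ε : Fin n → Fin 2} (hfirst : ε ⟨0, hn⟩ = 1)
    (hlast : ε ⟨n - 1, by omega⟩ = 0) :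
    IsRelativeCycle (divA ε)ᶜ (divB n \ (divB n ∩ divA ε)) (gapChain n) := by
  constructor
  · intro τ hτ
    obtain ⟨π, rfl⟩ := mem_support_gapChain.1 hτ
    exact (range_gapCube_subset π).trans (closure_range_Phi_subset hn hfirst hlast)
  · have hb := boundary_subset hn hfirst hlast
    obtain ⟨m, rfl⟩ : ∃ m, n = m + 1 := ⟨n - 1, by omega⟩
    intro τ hτ
    left
    by_cases h : ∃ k π, τ = face k 0 (gapCube (n := m + 1) π)
    · obtain ⟨k, π, rfl⟩ := h
      rintro _ ⟨y, rfl⟩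
      refine hb ⟨range_gapCube_subset π ⟨_, rfl⟩, ?_⟩
      rintro ⟨t, ht⟩
      refine gapCube_notMem_openStratum π (y := k.insertNth 0 y) (k := k) (by simp) ?_
      change face k 0 (gapCube π) y ∈ _
      rw [← ht]
      exact Phi_mem_openStratum t
    · exfalso
      push Not at h
      refine Finsupp.mem_support_iff.1 hτ ?_
      rw [bdry_gapChain, Finsupp.neg_apply, Finsupp.finsetSum_apply, neg_eq_zero]
      refine Finset.sum_eq_zero fun k _ => ?_
      rw [Finsupp.smul_apply, Finsupp.finsetSum_apply, Finset.sum_eq_zero, smul_zero]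
      intro π _
      rw [Finsupp.smul_apply, Finsupp.single_eq_of_ne (h k π), smul_zero]

end ZetaModuli

namespace ZetaModuli

variable {n : ℕ}

/-! ### Integrals over subdivisions of the cell -/

/-- The real simplicial coordinates of a cube. -/
noncomputable def realT (τ : SingularCube (Mbar (Label n)) n) (y : Fin n → ℝ) (i : Fin n) : ℝ :=
  (tCoord i (cubeFun τ y)).re

theorem realT_of_eq_Phi {τ : SingularCube (Mbar (Label n)) n} {y : Fin n → ℝ} {t : openSimplex n}
    (h : Phi t = cubeFun τ y) : realT τ y = t.1 := by
  funext i
  rw [realT, ← h, tCoord_Phi, Complex.ofReal_re]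

theorem realT_mem_openSimplex {τ : SingularCube (Mbar (Label n)) n} {y : Fin n → ℝ}
    (h : cubeFun τ y ∈ Set.range (Phi (n := n))) : realT τ y ∈ openSimplex n := by
  obtain ⟨t, h⟩ := h
  rw [realT_of_eq_Phi h]
  exact t.2

theorem tCoord_eq_realT {τ : SingularCube (Mbar (Label n)) n} {y : Fin n → ℝ}
    (h : cubeFun τ y ∈ Set.range (Phi (n := n))) (i : Fin n) :
    tCoord i (cubeFun τ y) = (realT τ y i : ℂ) := by
  obtain ⟨t, h⟩ := h
  rw [realT_of_eq_Phi h, ← h, tCoord_Phi]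

theorem cubeFun_eq_of_realT_eq {τ τ' : SingularCube (Mbar (Label n)) n} {y y' : Fin n → ℝ}
    (h : cubeFun τ y ∈ Set.range (Phi (n := n))) (h' : cubeFun τ' y' ∈ Set.range (Phi (n := n)))
    (he : realT τ y = realT τ' y') : cubeFun τ y = cubeFun τ' y' := by
  obtain ⟨t, h⟩ := h
  obtain ⟨t', h'⟩ := h'
  rw [realT_of_eq_Phi h, realT_of_eq_Phi h'] at he
  rw [← h, ← h', Subtype.ext he]

theorem differentiableWithinAt_realT {τ : SingularCube (Mbar (Label n)) n} (hτ : IsSmoothCube τ)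
    {y : Fin n → ℝ} (hy : y ∈ Icc (0 : Fin n → ℝ) 1)
    (h : cubeFun τ y ∈ Set.range (Phi (n := n))) :
    DifferentiableWithinAt ℝ (realT τ) (Icc 0 1) y := by
  have hs : cubeFun τ y ∈ openStratum (Label n) := by
    obtain ⟨t, h⟩ := h
    exact h ▸ Phi_mem_openStratum t
  rw [differentiableWithinAt_pi]
  intro i
  have h1 : ContDiffWithinAt ℝ ∞ (fun w => tCoord i (cubeFun τ w)) (Icc 0 1) y :=
    hτ y hy (tQuad i) (cr_openStratum hs _).1
  exact (Complex.reCLM.contDiff.contDiffAt.comp_contDiffWithinAt y h1).differentiableWithinAt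
    (by simp)

theorem differentiableAt_realT {τ : SingularCube (Mbar (Label n)) n} (hτ : IsSmoothCube τ)
    {y : Fin n → ℝ} (hy : y ∈ openCube n) (h : cubeFun τ y ∈ Set.range (Phi (n := n))) :
    DifferentiableAt ℝ (realT τ) y :=
  (differentiableWithinAt_realT hτ (openCube_subset_Icc hy) h).differentiableAt
    (mem_of_superset (isOpen_openCube.mem_nhds hy) openCube_subset_Icc)

theorem det_fderiv_realT {τ : SingularCube (Mbar (Label n)) n} {y : Fin n → ℝ}
    (h : DifferentiableAt ℝ (realT τ) y) : (fderiv ℝ (realT τ) y).det = tJacobian τ y := by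
  rw [ContinuousLinearMap.det, ← LinearMap.det_toMatrix', tJacobian]
  congr 1
  ext i j
  rw [LinearMap.toMatrix'_apply, Matrix.of_apply]
  have : fderiv ℝ (fun v => (tCoord i (cubeFun τ v)).re) y
      = (ContinuousLinearMap.proj i).comp (fderiv ℝ (realT τ) y) :=
    (((ContinuousLinearMap.proj (R := ℝ) (φ := fun _ : Fin n => ℝ) i).hasFDerivAt).comp y
      h.hasFDerivAt).fderiv
  rw [this]
  have hp : (Pi.single j 1 : Fin n → ℝ) = fun j' => if j' = j then 1 else 0 := by
    ext j'
    simp [Pi.single_apply]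
  simp [hp]

/-- On the cell the coordinates are real, so the complex determinant is the real Jacobian with row
`i` multiplied by `1 / (tᵢ - εᵢ)`. -/
theorem omegaCoeff_cubeFun (ε : Fin n → Fin 2) {τ : SingularCube (Mbar (Label n)) n}
    (hmaps : Set.MapsTo (cubeFun τ) (openCube n) (Set.range (Phi (n := n))))
    (hτ : IsSmoothCube τ) {y : Fin n → ℝ} (hy : y ∈ openCube n) :
    omegaCoeff ℝ ε (cubeFun τ) y
      = tJacobian τ y * ∏ i, 1 / ((realT τ y i : ℂ) - ((ε i : ℕ) : ℂ)) := by
  have hd := differentiableAt_realT hτ hy (hmaps hy)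
  have h1 : ∀ i j : Fin n, fderiv ℝ (fun v => tCoord i (cubeFun τ v)) y (Pi.single j 1)
      = ((fderiv ℝ (fun v => (tCoord i (cubeFun τ v)).re) y (Pi.single j 1) : ℝ) : ℂ) := by
    intro i j
    have hev : (fun v => tCoord i (cubeFun τ v)) =ᶠ[𝓝 y] fun v => (realT τ v i : ℂ) :=
      (isOpen_openCube.eventually_mem hy).mono fun v hv => tCoord_eq_realT (hmaps hv) i
    have hdi : DifferentiableAt ℝ (fun v => realT τ v i) y := differentiableAt_pi.1 hd i
    have hcomp : fderiv ℝ (fun v => (realT τ v i : ℂ)) y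
        = Complex.ofRealCLM.comp (fderiv ℝ (fun v => realT τ v i) y) :=
      (Complex.ofRealCLM.hasFDerivAt.comp y hdi.hasFDerivAt).fderiv
    rw [hev.fderiv_eq, hcomp]
    rfl
  unfold omegaCoeff tJacobian
  simp only [h1, tCoord_eq_realT (hmaps hy)]
  rw [mul_comm, ← Complex.ofRealHom_eq_coe, RingHom.map_det, ← Matrix.det_mul_column]
  congr 1
  ext i j
  simp [div_eq_inv_mul]

theorem volume_Icc_diff_openCube : volume (Icc (0 : Fin n → ℝ) 1 \ openCube n) = 0 := by
  have h : openCube n = Set.pi Set.univ fun _ => Ioo (0 : ℝ) 1 := by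
    ext y
    simp [openCube]
  rw [h]
  exact (ae_le_set.1 (Measure.univ_pi_Ioo_ae_eq_Icc (μ := fun _ : Fin n => (volume : Measure ℝ))
    (f := 0) (g := 1)).symm.le)

/-- Change variables on each open cube; the coefficient of the cube turns the Jacobian into its
absolute value. The images are disjoint and fill the simplex up to a null set. -/
theorem chainIntegral_eq_integral {ε : Fin n → Fin 2} {c : CubicalChain (Mbar (Label n)) n}
    (hc : IsCellSubdivision c) (hform : IntegrableOn
      (fun t : Fin n → ℝ => ∏ i, 1 / ((t i : ℂ) - ((ε i : ℕ) : ℂ))) (openSimplex n)) :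
    (∀ τ ∈ c.support, IntegrableOn (omegaCoeff ℝ ε (cubeFun τ)) (openCube n)) ∧
      chainIntegral ε c = ∫ t in openSimplex n, ∏ i, 1 / ((t i : ℂ) - ((ε i : ℕ) : ℂ)) := by
  set g : (Fin n → ℝ) → ℂ := fun t => ∏ i, 1 / ((t i : ℂ) - ((ε i : ℕ) : ℂ)) with hg
  have hd : ∀ τ ∈ c.support, ∀ y ∈ openCube n,
      HasFDerivWithinAt (realT τ) (fderiv ℝ (realT τ) y) (openCube n) y := fun τ hτ y hy =>
    (differentiableAt_realT (hc.smooth τ hτ) hy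
      (hc.mapsTo τ hτ hy)).hasFDerivAt.hasFDerivWithinAt
  have hinj : ∀ τ ∈ c.support, InjOn (realT τ) (openCube n) := fun τ hτ y hy y' hy' h =>
    hc.injOn τ hτ hy hy' (cubeFun_eq_of_realT_eq (hc.mapsTo τ hτ hy) (hc.mapsTo τ hτ hy') h)
  have hmeas : ∀ τ ∈ c.support, MeasurableSet (realT τ '' openCube n) := fun τ hτ =>
    measurable_image_of_fderivWithin isOpen_openCube.measurableSet (hd τ hτ) (hinj τ hτ)
  have hsub : ∀ τ ∈ c.support, realT τ '' openCube n ⊆ openSimplex n := by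
    rintro τ hτ _ ⟨y, hy, rfl⟩
    exact realT_mem_openSimplex (hc.mapsTo τ hτ hy)
  have hcoef : ∀ τ ∈ c.support, ∀ y ∈ openCube n,
      |(fderiv ℝ (realT τ) y).det| • g (realT τ y) = (c τ : ℂ) * omegaCoeff ℝ ε (cubeFun τ) y := by
    intro τ hτ y hy
    rw [det_fderiv_realT (differentiableAt_realT (hc.smooth τ hτ) hy (hc.mapsTo τ hτ hy)),
      omegaCoeff_cubeFun ε (hc.mapsTo τ hτ) (hc.smooth τ hτ) hy, hc.sign τ hτ y hy,
      Complex.real_smul, ← mul_assoc]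
    congr 1
    rcases lt_trichotomy (tJacobian τ y) 0 with h | h | h
    · simp [sign_neg h, abs_of_neg h]
    · simp [h]
    · simp [sign_pos h, abs_of_pos h]
  have hformτ : ∀ τ ∈ c.support, IntegrableOn
      (fun y => (c τ : ℂ) * omegaCoeff ℝ ε (cubeFun τ) y) (openCube n) := by
    intro τ hτ
    have := (integrableOn_image_iff_integrableOn_abs_det_fderiv_smul volume
      isOpen_openCube.measurableSet (hd τ hτ) (hinj τ hτ) g).1 (hform.mono_set (hsub τ hτ))
    exact this.congr_fun (hcoef τ hτ) isOpen_openCube.measurableSet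
  have hτint : ∀ τ ∈ c.support, (c τ : ℂ) * ∫ y in openCube n, omegaCoeff ℝ ε (cubeFun τ) y
      = ∫ t in realT τ '' openCube n, g t := by
    intro τ hτ
    rw [integral_image_eq_integral_abs_det_fderiv_smul volume isOpen_openCube.measurableSet
      (hd τ hτ) (hinj τ hτ) g, ← integral_const_mul]
    exact (setIntegral_congr_fun isOpen_openCube.measurableSet (hcoef τ hτ)).symm
  refine ⟨fun τ hτ => ?_, ?_⟩
  · have h0 : (c τ : ℂ) ≠ 0 := by exact_mod_cast Finsupp.mem_support_iff.1 hτ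
    refine ((hformτ τ hτ).const_mul (c τ : ℂ)⁻¹).congr (Eventually.of_forall fun y => ?_)
    simp only
    rw [← mul_assoc, inv_mul_cancel₀ h0, one_mul]
  · have hdisj : Set.Pairwise (c.support : Set (SingularCube (Mbar (Label n)) n))
        (Function.onFun Disjoint fun τ => realT τ '' openCube n) := by
      intro τ hτ τ' hτ' hne
      rw [Function.onFun, Set.disjoint_left]
      rintro _ ⟨y, hy, rfl⟩ ⟨y', hy', h⟩
      refine Set.disjoint_left.1 (hc.disjoint τ hτ τ' hτ' hne) ⟨y, hy, rfl⟩ ⟨y', hy', ?_⟩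
      exact cubeFun_eq_of_realT_eq (hc.mapsTo τ' hτ' hy') (hc.mapsTo τ hτ hy) h
    rw [chainIntegral, Finsupp.sum, Finset.sum_congr rfl hτint,
      ← integral_biUnion_finset c.support hmeas hdisj fun τ hτ => hform.mono_set (hsub τ hτ)]
    refine setIntegral_congr_set ?_
    refine (LE.le.eventuallyLE (iUnion₂_subset hsub)).antisymm (ae_le_set.2 ?_)
    -- A point of the simplex missed by the open cubes is the image of a boundary point of a cube.
    -- The cubes are smooth up to the boundary, and differentiable maps send null sets to null sets.
    let Z : SingularCube (Mbar (Label n)) n → Set (Fin n → ℝ) := fun τ =>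
      {y | y ∈ Icc (0 : Fin n → ℝ) 1 \ openCube n ∧ cubeFun τ y ∈ Set.range (Phi (n := n))}
    have hZ : ∀ τ ∈ c.support, volume (realT τ '' Z τ) = 0 := by
      intro τ hτ
      refine addHaar_image_eq_zero_of_differentiableOn_of_addHaar_eq_zero volume (fun y hy => ?_)
        (measure_mono_null (fun y hy => hy.1) volume_Icc_diff_openCube)
      exact (differentiableWithinAt_realT (hc.smooth τ hτ) hy.1.1 hy.2).mono fun y hy => hy.1.1
    refine measure_mono_null ?_ ((measure_biUnion_null_iff c.support.countable_toSet).2 hZ)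
    rintro t ⟨ht, ht'⟩
    have hmem : Phi ⟨t, ht⟩ ∈ ⋃ τ ∈ c.support, Set.range τ := by
      rw [hc.cover]
      exact subset_closure ⟨_, rfl⟩
    obtain ⟨τ, hτ, y, hy⟩ := mem_iUnion₂.1 hmem
    refine mem_iUnion₂.2 ⟨τ, hτ, ?_⟩
    let v : Fin n → ℝ := fun k => (y k : ℝ)
    have hv : cubeFun τ v = Phi ⟨t, ht⟩ := by
      rw [← hy, cubeFun]
      congr 1
      funext k
      exact Set.projIcc_val zero_le_one (y k)
    have hvt : realT τ v = t := realT_of_eq_Phi hv.symm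
    refine ⟨v, ⟨⟨⟨fun k => (y k).2.1, fun k => (y k).2.2⟩, fun ho => ht' ?_⟩, _, hv.symm⟩, hvt⟩
    exact mem_iUnion₂.2 ⟨τ, hτ, v, ho, hvt⟩

end ZetaModuli

namespace ZetaModuli

variable {n : ℕ}

/-! ### Iterated integrals as nested sums -/

/-- The absolute value of `1 / (t - e)`. -/
noncomputable def weight (e : Fin 2) (t : ℝ) : ENNReal := ENNReal.ofReal |1 / (t - (e : ℕ))|

theorem measurable_weight (e : Fin 2) : Measurable (weight e) := by
  unfold weight
  fun_prop

/-- The open simplex `0 < t₁ < … < tₙ < x`. -/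
def simplexBelow (n : ℕ) (x : ℝ) : Set (Fin n → ℝ) := {t | StrictMono t ∧ ∀ i, 0 < t i ∧ t i < x}

theorem snoc_mem_simplexBelow {x s : ℝ} {t : Fin n → ℝ} :
    (Fin.snoc t s : Fin (n + 1) → ℝ) ∈ simplexBelow (n + 1) x ↔
      s ∈ Ioo 0 x ∧ t ∈ simplexBelow n s := by
  constructor
  · rintro ⟨hm, h⟩
    have hs := h (Fin.last n)
    rw [Fin.snoc_last] at hs
    refine ⟨hs, fun i j hij => ?_, fun i => ⟨?_, ?_⟩⟩
    · have := hm (Fin.castSucc_lt_castSucc_iff.2 hij)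
      rwa [Fin.snoc_castSucc, Fin.snoc_castSucc] at this
    · have := (h i.castSucc).1
      rwa [Fin.snoc_castSucc] at this
    · have := hm (Fin.castSucc_lt_last i)
      rwa [Fin.snoc_castSucc, Fin.snoc_last] at this
  · rintro ⟨hs, hm, h⟩
    constructor
    · intro i j hij
      induction j using Fin.lastCases with
      | last =>
        induction i using Fin.lastCases with
        | last => exact absurd hij (lt_irrefl _)
        | cast i =>
          rw [Fin.snoc_castSucc, Fin.snoc_last]
          exact (h i).2
      | cast j =>
        induction i using Fin.lastCases with
        | last => exact absurd hij (not_lt.2 (Fin.castSucc_lt_last j).le)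
        | cast i =>
          rw [Fin.snoc_castSucc, Fin.snoc_castSucc]
          exact hm (Fin.castSucc_lt_castSucc_iff.1 hij)
    · intro i
      induction i using Fin.lastCases with
      | last => rw [Fin.snoc_last]; exact hs
      | cast i =>
        rw [Fin.snoc_castSucc]
        exact ⟨(h i).1, (h i).2.trans hs.2⟩

theorem measurableSet_simplexBelow (x : ℝ) : MeasurableSet (simplexBelow n x) := by
  have : simplexBelow n x = (⋂ i, ⋂ j, ⋂ (_ : i < j), {t | t i < t j}) ∩
      ⋂ i, {t | 0 < t i} ∩ {t | t i < x} := by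
    ext t
    simp only [simplexBelow, mem_ofPred_eq, mem_inter_iff, mem_iInter]
    rfl
  rw [this]
  refine MeasurableSet.inter ?_ ?_
  · exact MeasurableSet.iInter fun i => MeasurableSet.iInter fun j => MeasurableSet.iInter fun _ =>
      measurableSet_lt (measurable_pi_apply i) (measurable_pi_apply j)
  · exact MeasurableSet.iInter fun i => (measurableSet_lt measurable_const
      (measurable_pi_apply i)).inter (measurableSet_lt (measurable_pi_apply i) measurable_const)

/-- The iterated integral of a word, with upper limit `x`. -/
noncomputable def iterInt (ε : Fin n → Fin 2) (x : ℝ) : ENNReal :=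
  ∫⁻ t in simplexBelow n x, ∏ i, weight (ε i) (t i)

theorem iterInt_zero (ε : Fin 0 → Fin 2) (x : ℝ) : iterInt ε x = 1 := by
  have : simplexBelow 0 x = univ :=
    eq_univ_of_forall fun t => ⟨fun i => i.elim0, fun i => i.elim0⟩
  rw [iterInt, this, volume_pi, Measure.pi_of_empty]
  simp

/-- Tonelli, with the last and largest variable integrated last. -/
theorem iterInt_succ (ε : Fin (n + 1) → Fin 2) (x : ℝ) :
    iterInt ε x = ∫⁻ s in Ioo 0 x,
      weight (ε (Fin.last n)) s * iterInt (fun i : Fin n => ε i.castSucc) s := by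
  let e := MeasurableEquiv.piFinSuccAbove (fun _ : Fin (n + 1) => ℝ) (Fin.last n)
  have he : MeasurePreserving e.symm :=
    (volume_preserving_piFinSuccAbove (fun _ : Fin (n + 1) => ℝ) (Fin.last n)).symm
  have hsymm : ∀ p : ℝ × (Fin n → ℝ), e.symm p = Fin.snoc p.2 p.1 := fun p => by
    change (Fin.last n).insertNth (α := fun _ => ℝ) p.1 p.2 = _
    rw [Fin.insertNth_last']
  let F : (Fin (n + 1) → ℝ) → ENNReal :=
    (simplexBelow (n + 1) x).indicator fun t => ∏ i, weight (ε i) (t i)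
  have hF : Measurable F := by
    refine Measurable.indicator ?_ (measurableSet_simplexBelow x)
    exact Finset.measurable_fun_prod _ fun i _ =>
      (measurable_weight _).comp (measurable_pi_apply i)
  have hFs : ∀ s t, F (Fin.snoc t s) = (Ioo 0 x).indicator (fun s =>
      weight (ε (Fin.last n)) s * (simplexBelow n s).indicator
        (fun t => ∏ i : Fin n, weight (ε i.castSucc) (t i)) t) s := by
    intro s t
    by_cases h : s ∈ Ioo 0 x
    · rw [indicator_of_mem h]
      by_cases h' : t ∈ simplexBelow n s
      · rw [indicator_of_mem h', show F _ = _ from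
          indicator_of_mem (snoc_mem_simplexBelow.2 ⟨h, h'⟩) _, Fin.prod_univ_castSucc, mul_comm]
        simp
      · rw [indicator_of_notMem h', mul_zero, show F _ = _ from
          indicator_of_notMem (fun hh => h' (snoc_mem_simplexBelow.1 hh).2) _]
    · rw [indicator_of_notMem h, show F _ = _ from
          indicator_of_notMem (fun hh => h (snoc_mem_simplexBelow.1 hh).1) _]
  rw [iterInt, ← lintegral_indicator (measurableSet_simplexBelow x),
    ← he.lintegral_comp hF, Measure.volume_eq_prod, lintegral_prod (fun p => F (e.symm p))
      (hF.comp e.symm.measurable).aemeasurable, ← lintegral_indicator measurableSet_Ioo]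
  refine lintegral_congr fun s => ?_
  simp only [hsymm, hFs]
  by_cases h : s ∈ Ioo 0 x
  · simp only [indicator_of_mem h]
    rw [lintegral_const_mul, iterInt, lintegral_indicator (measurableSet_simplexBelow s)]
    refine Measurable.indicator ?_ (measurableSet_simplexBelow s)
    exact Finset.measurable_fun_prod _ fun i _ =>
      (measurable_weight _).comp (measurable_pi_apply i)
  · simp only [indicator_of_notMem h, lintegral_zero]

/-- The relation between consecutive summation indices. -/
def Step (e : Fin 2) (m j : ℕ) : Prop := if e = 1 then m < j else m = j

instance (e : Fin 2) (m j : ℕ) : Decidable (Step e m j) := by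
  unfold Step
  infer_instance

theorem lintegral_pow {x : ℝ} (hx : 0 ≤ x) (k : ℕ) :
    ∫⁻ s in Ioo 0 x, ENNReal.ofReal (s ^ k)
      = ENNReal.ofReal (1 / ((k + 1 : ℕ) : ℝ)) * ENNReal.ofReal (x ^ (k + 1)) := by
  rw [← ofReal_integral_eq_lintegral_ofReal, ← integral_Ioc_eq_integral_Ioo,
    ← intervalIntegral.integral_of_le hx, integral_pow, ← ENNReal.ofReal_mul (by positivity)]
  · congr 1
    push_cast
    simp
    ring
  · exact ((continuous_pow k).integrableOn_Icc (a := 0) (b := x)).mono_set Ioo_subset_Icc_self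
  · exact (ae_restrict_mem measurableSet_Ioo).mono fun s hs => pow_nonneg hs.1.le k

/-- For the letter `1`, `s ^ m / (1 - s)` is a geometric series whose terms integrate to `x ^ j / j`
with `j > m`. For the letter `0`, `s ^ m / s` integrates to `x ^ m / m`, which needs `m ≠ 0`. -/
theorem lintegral_weight_mul_pow (e : Fin 2) {x : ℝ} (hx : 0 ≤ x) (hx1 : x ≤ 1) (m : ℕ)
    (hm : e = 1 ∨ m ≠ 0) :
    ∫⁻ s in Ioo 0 x, weight e s * ENNReal.ofReal (s ^ m)
      = ∑' j : ℕ, if Step e m j then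
          ENNReal.ofReal (1 / (j : ℝ)) * ENNReal.ofReal (x ^ j) else 0 := by
  by_cases he : e = 1
  · subst he
    have h1 : ∀ s ∈ Ioo 0 x, weight 1 s * ENNReal.ofReal (s ^ m)
        = ∑' i : ℕ, ENNReal.ofReal (s ^ (m + i)) := by
      intro s hs
      have hs1 : s < 1 := hs.2.trans_le hx1
      have hgeo := (hasSum_geometric_of_lt_one hs.1.le hs1).mul_left (s ^ m)
      simp only [← pow_add] at hgeo
      rw [← ENNReal.ofReal_tsum_of_nonneg (fun i => pow_nonneg hs.1.le _) hgeo.summable,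
        hgeo.tsum_eq, weight, ← ENNReal.ofReal_mul (abs_nonneg _)]
      congr 1
      have : s - ((1 : Fin 2) : ℕ) < 0 := by simpa using hs1
      rw [abs_of_neg (one_div_neg.2 this), mul_comm]
      congr 1
      rw [← one_div_neg_eq_neg_one_div, one_div]
      simp
    rw [setLIntegral_congr_fun measurableSet_Ioo h1, lintegral_tsum]
    · simp only [lintegral_pow hx]
      have hinj : Function.Injective fun i : ℕ => m + i + 1 := fun i j h => by simpa using h
      rw [← hinj.tsum_eq (f := fun j : ℕ => if Step 1 m j then
          ENNReal.ofReal (1 / (j : ℝ)) * ENNReal.ofReal (x ^ j) else 0)]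
      · refine tsum_congr fun i => ?_
        rw [if_pos]
        simp only [Step, if_true]
        omega
      · intro j hj
        have : Step 1 m j := by
          by_contra h
          exact hj (if_neg h)
        simp only [Step, if_true] at this
        exact ⟨j - m - 1, by simp only; omega⟩
    · exact fun i => (ENNReal.measurable_ofReal.comp (measurable_id.pow_const _)).aemeasurable
  · have he0 : e = 0 := by omega
    subst he0
    have hm := hm.resolve_left he
    obtain ⟨k, rfl⟩ := Nat.exists_eq_succ_of_ne_zero hm
    have h1 : ∀ s ∈ Ioo 0 x, weight 0 s * ENNReal.ofReal (s ^ (k + 1))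
        = ENNReal.ofReal (s ^ k) := by
      intro s hs
      rw [weight, ← ENNReal.ofReal_mul (abs_nonneg _)]
      congr 1
      simp only [Fin.val_zero, Nat.cast_zero, sub_zero]
      rw [abs_of_pos (one_div_pos.2 hs.1), pow_succ]
      have := hs.1.ne'
      field_simp
    rw [setLIntegral_congr_fun measurableSet_Ioo h1, lintegral_pow hx, tsum_eq_single (k + 1)]
    · simp [Step]
    · intro j hj
      rw [if_neg]
      simpa [Step] using hj.symm

/-- The summation index before the `i`-th one. -/
def prevIndex (κ : Fin n → ℕ) (i : Fin n) : ℕ := if i.val = 0 then 0 else κ ⟨i.val - 1, by omega⟩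

/-- The last summation index. -/
def lastIndex (κ : Fin n → ℕ) : ℕ := if h : n = 0 then 0 else κ ⟨n - 1, by omega⟩

/-- A term of the nested sum of a word. -/
noncomputable def nestedTerm (ε : Fin n → Fin 2) (κ : Fin n → ℕ) : ENNReal :=
  ∏ i, if Step (ε i) (prevIndex κ i) (κ i) then ENNReal.ofReal (1 / (κ i : ℝ)) else 0

theorem lastIndex_snoc (κ : Fin n → ℕ) (j : ℕ) :
    lastIndex (Fin.snoc κ j : Fin (n + 1) → ℕ) = j := by
  have : (⟨n + 1 - 1, by omega⟩ : Fin (n + 1)) = Fin.last n := rfl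
  rw [lastIndex, dif_neg (Nat.succ_ne_zero n), this, Fin.snoc_last]

theorem nestedTerm_snoc (ε : Fin (n + 1) → Fin 2) (κ : Fin n → ℕ) (j : ℕ) :
    nestedTerm ε (Fin.snoc κ j) = nestedTerm (fun i : Fin n => ε i.castSucc) κ *
      if Step (ε (Fin.last n)) (lastIndex κ) j then ENNReal.ofReal (1 / (j : ℝ)) else 0 := by
  have h1 : ∀ i : Fin n, prevIndex (Fin.snoc κ j : Fin (n + 1) → ℕ) i.castSucc = prevIndex κ i := by
    intro i
    simp only [prevIndex, Fin.val_castSucc]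
    split_ifs with h
    · rfl
    · have : (⟨i.val - 1, by omega⟩ : Fin (n + 1)) = Fin.castSucc ⟨i.val - 1, by omega⟩ := rfl
      rw [this, Fin.snoc_castSucc]
  have h2 : prevIndex (Fin.snoc κ j : Fin (n + 1) → ℕ) (Fin.last n) = lastIndex κ := by
    simp only [prevIndex, lastIndex, Fin.val_last]
    split_ifs with h
    · rfl
    · have : (⟨n - 1, by omega⟩ : Fin (n + 1)) = Fin.castSucc ⟨n - 1, by omega⟩ := rfl
      rw [this, Fin.snoc_castSucc]
  rw [nestedTerm, Fin.prod_univ_castSucc, nestedTerm]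
  simp only [Fin.snoc_castSucc, Fin.snoc_last, h1, h2]

/-- Since `1 / 0 = 0`, a vanishing index kills the term. -/
theorem ne_zero_of_nestedTerm_ne_zero {ε : Fin n → Fin 2} {κ : Fin n → ℕ}
    (h : nestedTerm ε κ ≠ 0) (i : Fin n) : Step (ε i) (prevIndex κ i) (κ i) ∧ κ i ≠ 0 := by
  have := Finset.prod_ne_zero_iff.1 h i (Finset.mem_univ i)
  by_cases hs : Step (ε i) (prevIndex κ i) (κ i)
  · refine ⟨hs, fun h0 => this ?_⟩
    rw [h0]
    simp
  · exact absurd (if_neg hs) this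

/-- Summation over the indices that can follow `m`. -/
noncomputable def stepSum (e : Fin 2) (φ : ℕ → ENNReal) (m : ℕ) : ENNReal :=
  ∑' j : ℕ, if Step e m j then ENNReal.ofReal (1 / (j : ℝ)) * φ j else 0

/-- Summing over the last index first turns the last letter into an operator on `φ`. This drives the
induction for both the integral and the bound. -/
theorem tsum_nestedTerm_succ (ε : Fin (n + 1) → Fin 2) (φ : ℕ → ENNReal) :
    ∑' κ, nestedTerm ε κ * φ (lastIndex κ) = ∑' κ : Fin n → ℕ,
      nestedTerm (fun i : Fin n => ε i.castSucc) κ *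
        stepSum (ε (Fin.last n)) φ (lastIndex κ) := by
  rw [← (Fin.snocEquiv fun _ : Fin (n + 1) => ℕ).tsum_eq, ENNReal.tsum_prod', ENNReal.tsum_comm]
  refine tsum_congr fun κ => ?_
  rw [stepSum, ← ENNReal.tsum_mul_left]
  refine tsum_congr fun j => ?_
  change nestedTerm ε (Fin.snoc κ j) * φ (lastIndex (Fin.snoc κ j : Fin (n + 1) → ℕ)) = _
  rw [nestedTerm_snoc, lastIndex_snoc, mul_assoc]
  split_ifs <;> simp

theorem tsum_nestedTerm_zero (ε : Fin 0 → Fin 2) (φ : ℕ → ENNReal) :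
    ∑' κ, nestedTerm ε κ * φ (lastIndex κ) = φ 0 := by
  rw [tsum_eq_single (fun i => i.elim0) fun κ h => absurd (Subsingleton.elim _ _) h]
  simp [nestedTerm, lastIndex]

/-- Term-by-term integration, legitimate in `ENNReal` without convergence. A letter `0` never meets
the power `s ^ 0`: the word begins with `1`, and nonzero terms have nonzero indices. -/
theorem iterInt_eq_tsum (ε : Fin n → Fin 2) (hε : ∀ h : 0 < n, ε ⟨0, h⟩ = 1) {x : ℝ}
    (hx : 0 ≤ x) (hx1 : x ≤ 1) :
    iterInt ε x = ∑' κ, nestedTerm ε κ * ENNReal.ofReal (x ^ lastIndex κ) := by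
  induction n generalizing x with
  | zero =>
    rw [iterInt_zero, tsum_nestedTerm_zero ε fun m => ENNReal.ofReal (x ^ m)]
    simp
  | succ n ih =>
    rw [iterInt_succ, tsum_nestedTerm_succ ε fun m => ENNReal.ofReal (x ^ m)]
    have h1 : ∀ s ∈ Ioo 0 x,
        weight (ε (Fin.last n)) s * iterInt (fun i : Fin n => ε i.castSucc) s
          = ∑' κ : Fin n → ℕ, nestedTerm (fun i : Fin n => ε i.castSucc) κ *
            (weight (ε (Fin.last n)) s * ENNReal.ofReal (s ^ lastIndex κ)) := by
      intro s hs
      rw [ih _ (fun h => hε (Nat.succ_pos n)) hs.1.le (hs.2.le.trans hx1), ← ENNReal.tsum_mul_left]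
      exact tsum_congr fun κ => by ring
    have hmeas : ∀ m : ℕ, Measurable fun s : ℝ =>
        weight (ε (Fin.last n)) s * ENNReal.ofReal (s ^ m) := fun m =>
      (measurable_weight _).mul (ENNReal.measurable_ofReal.comp (measurable_id.pow_const _))
    rw [setLIntegral_congr_fun measurableSet_Ioo h1,
      lintegral_tsum fun κ => ((hmeas _).const_mul _).aemeasurable]
    refine tsum_congr fun κ => ?_
    rw [lintegral_const_mul _ (hmeas _)]
    by_cases hκ : nestedTerm (fun i : Fin n => ε i.castSucc) κ = 0
    · rw [hκ, zero_mul, zero_mul]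
    · rw [lintegral_weight_mul_pow _ hx hx1]
      · rfl
      · rcases Nat.eq_zero_or_pos n with rfl | hn
        · exact Or.inl (hε (Nat.succ_pos 0))
        · right
          rw [lastIndex, dif_neg hn.ne']
          exact (ne_zero_of_nestedTerm_ne_zero hκ _).2

end ZetaModuli

namespace ZetaModuli

variable {n : ℕ}

/-! ### Convergence -/

/-- A sequence that dominates, up to constants, the coefficients of the iterated integrals. -/
noncomputable def domSeq (j : ℕ) : ℝ := if j = 0 then 1 else 1 / √(j : ℝ)

theorem domSeq_nonneg (j : ℕ) : 0 ≤ domSeq j := by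
  unfold domSeq
  split_ifs
  · exact zero_le_one
  · positivity

/-- For `m ≥ 1`, `3 (√(m + 1) - √m) = 3 / (√(m + 1) + √m) ≥ 1 / √m`, because `√(m + 1) ≤ 2 √m`. -/
theorem sum_range_domSeq_le (m : ℕ) : ∑ j ∈ Finset.range m, domSeq j ≤ 3 * √(m : ℝ) := by
  induction m with
  | zero => simp
  | succ m ih =>
    rw [Finset.sum_range_succ]
    rcases Nat.eq_zero_or_pos m with rfl | hm
    · simp [domSeq]
    · rw [domSeq, if_neg hm.ne']
      have hm1 : (1 : ℝ) ≤ m := by exact_mod_cast hm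
      have hs : 0 < √(m : ℝ) := Real.sqrt_pos.2 (by linarith)
      have hs' : √(m : ℝ) ^ 2 = m := Real.sq_sqrt (by linarith)
      have ht' : √((m + 1 : ℕ) : ℝ) ^ 2 = m + 1 := by
        rw [Real.sq_sqrt (by positivity)]
        push_cast
        rfl
      have ht : 0 ≤ √((m + 1 : ℕ) : ℝ) := Real.sqrt_nonneg _
      set s := √(m : ℝ)
      set t := √((m + 1 : ℕ) : ℝ)
      have h2 : t ≤ 2 * s := by nlinarith
      have hst : s < t := by nlinarith
      have : 1 / s ≤ 3 * (t - s) := by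
        rw [div_le_iff₀ hs]
        have h3 : (t - s) * (t + s) = 1 := by linear_combination ht' - hs'
        nlinarith
      linarith

/-- The letter `1` turns `domSeq` into its partial sum divided by `m`, at most `3 √m / m`; the
letter `0` merely divides by `m`. -/
theorem tsum_step_domSeq_le (e : Fin 2) (m : ℕ) :
    (∑' j, if Step e j m then ENNReal.ofReal (domSeq j) else 0) * ENNReal.ofReal (1 / (m : ℝ))
      ≤ 3 * ENNReal.ofReal (domSeq m) := by
  rcases Nat.eq_zero_or_pos m with rfl | hm
  · simp
  have h3 : (3 : ENNReal) = ENNReal.ofReal 3 := by simp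
  have hm1 : (1 : ℝ) ≤ m := by exact_mod_cast hm
  have hs : 0 < √(m : ℝ) := Real.sqrt_pos.2 (by linarith)
  have hs' : √(m : ℝ) ^ 2 = m := Real.sq_sqrt (by linarith)
  by_cases he : e = 1
  · have : ∑' j, (if Step e j m then ENNReal.ofReal (domSeq j) else 0)
        = ENNReal.ofReal (∑ j ∈ Finset.range m, domSeq j) := by
      rw [tsum_eq_sum (s := Finset.range m), ENNReal.ofReal_sum_of_nonneg fun j _ => domSeq_nonneg j]
      · refine Finset.sum_congr rfl fun j hj => if_pos ?_
        simpa [Step, he] using hj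
      · intro j hj
        refine if_neg ?_
        simpa [Step, he] using hj
    rw [this, ← ENNReal.ofReal_mul (Finset.sum_nonneg fun j _ => domSeq_nonneg j), h3,
      ← ENNReal.ofReal_mul (by norm_num)]
    refine ENNReal.ofReal_le_ofReal ?_
    refine (mul_le_mul_of_nonneg_right (sum_range_domSeq_le m) (by positivity)).trans_eq ?_
    rw [domSeq, if_neg hm.ne']
    field_simp
    rw [hs']
  · rw [tsum_eq_single m]
    · rw [if_pos (by simp [Step, he]), h3, ← ENNReal.ofReal_mul (domSeq_nonneg m),
        ← ENNReal.ofReal_mul (by norm_num)]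
      refine ENNReal.ofReal_le_ofReal ?_
      have h1 : 1 / (m : ℝ) ≤ 1 := by
        rw [div_le_one (by linarith)]
        exact hm1
      nlinarith [domSeq_nonneg m]
    · intro j hj
      refine if_neg ?_
      simpa [Step, he] using hj

/-- Move the last letter into `φ`, apply induction, and exchange the sums so that this letter acts
on `domSeq` instead. -/
theorem tsum_nestedTerm_le (ε : Fin n → Fin 2) (φ : ℕ → ENNReal) :
    ∑' κ, nestedTerm ε κ * φ (lastIndex κ)
      ≤ 3 ^ n * ∑' m, ENNReal.ofReal (domSeq m) * φ m := by
  induction n generalizing φ with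
  | zero =>
    rw [tsum_nestedTerm_zero, pow_zero, one_mul]
    refine le_trans ?_ (ENNReal.le_tsum 0)
    simp [domSeq]
  | succ n ih =>
    rw [tsum_nestedTerm_succ]
    refine (ih _ _).trans ?_
    rw [pow_succ, mul_assoc]
    refine mul_le_mul_right ?_ _
    simp only [stepSum, ← ENNReal.tsum_mul_left]
    rw [ENNReal.tsum_comm]
    refine ENNReal.tsum_le_tsum fun m => ?_
    refine le_trans (le_of_eq ?_) ((mul_le_mul_left
      (tsum_step_domSeq_le (ε (Fin.last n)) m) (φ m)).trans_eq (mul_assoc _ _ _))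
    rw [mul_assoc, ← ENNReal.tsum_mul_right]
    refine tsum_congr fun j => ?_
    split_ifs <;> simp

theorem summable_domSeq_div : Summable fun m : ℕ => domSeq m * (1 / (m : ℝ)) := by
  refine (Real.summable_one_div_nat_rpow (p := 3 / 2) |>.2 (by norm_num)).congr fun m => ?_
  rcases Nat.eq_zero_or_pos m with rfl | hm
  · simp
  · have hm0 : (0 : ℝ) < m := by exact_mod_cast hm
    rw [domSeq, if_neg hm.ne', one_div_mul_one_div, Real.sqrt_eq_rpow,
      show (3 / 2 : ℝ) = 1 / 2 + 1 by norm_num, Real.rpow_add hm0, Real.rpow_one]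

/-- A final letter `0` contributes a further factor `1 / m`, and `∑ m ^ (-3/2)` converges. -/
theorem tsum_nestedTerm_ne_top (ε : Fin (n + 1) → Fin 2) (hε : ε (Fin.last n) = 0) :
    ∑' κ, nestedTerm ε κ ≠ ⊤ := by
  have h := tsum_nestedTerm_succ ε fun _ => 1
  simp only [mul_one] at h
  rw [h]
  refine ne_top_of_le_ne_top ?_ (tsum_nestedTerm_le _ _)
  refine ENNReal.mul_ne_top (by simp) ?_
  have : ∀ m : ℕ, ENNReal.ofReal (domSeq m) * stepSum (ε (Fin.last n)) (fun _ => 1) m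
      = ENNReal.ofReal (domSeq m * (1 / (m : ℝ))) := by
    intro m
    rw [stepSum, hε, tsum_eq_single m, if_pos (by simp [Step]), mul_one,
      ENNReal.ofReal_mul (domSeq_nonneg m)]
    intro j hj
    refine if_neg ?_
    simpa [Step] using hj.symm
  simp only [this]
  rw [← ENNReal.ofReal_tsum_of_nonneg (fun m => mul_nonneg (domSeq_nonneg m) (by positivity))
    summable_domSeq_div]
  exact ENNReal.ofReal_ne_top

/-! ### The integral over the simplex -/

theorem openSimplex_eq : openSimplex n = simplexBelow n 1 := rfl

theorem enorm_form (ε : Fin n → Fin 2) (t : Fin n → ℝ) :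
    ‖∏ i, 1 / ((t i : ℂ) - ((ε i : ℕ) : ℂ))‖ₑ = ∏ i, weight (ε i) (t i) := by
  rw [enorm_eq_nnnorm, nnnorm_prod]
  push_cast
  refine Finset.prod_congr rfl fun i _ => ?_
  rw [weight, ← Real.enorm_eq_ofReal_abs, enorm_eq_nnnorm]
  congr 1
  rw [← Complex.nnnorm_real]
  push_cast
  rfl

theorem measurable_form (ε : Fin n → Fin 2) :
    Measurable fun t : Fin n → ℝ => ∏ i, 1 / ((t i : ℂ) - ((ε i : ℕ) : ℂ)) := by
  fun_prop

theorem lintegral_enorm_form (ε : Fin n → Fin 2) (hε : ∀ h : 0 < n, ε ⟨0, h⟩ = 1) :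
    ∫⁻ t in openSimplex n, ‖∏ i, 1 / ((t i : ℂ) - ((ε i : ℕ) : ℂ))‖ₑ
      = ∑' κ, nestedTerm ε κ := by
  have := iterInt_eq_tsum ε hε zero_le_one le_rfl
  simp only [one_pow, ENNReal.ofReal_one, mul_one] at this
  rw [← this, iterInt, openSimplex_eq]
  simp only [enorm_form]

theorem integrableOn_form (hn : 0 < n) (ε : Fin n → Fin 2) (hfirst : ε ⟨0, hn⟩ = 1)
    (hlast : ε ⟨n - 1, by omega⟩ = 0) : IntegrableOn
      (fun t : Fin n → ℝ => ∏ i, 1 / ((t i : ℂ) - ((ε i : ℕ) : ℂ))) (openSimplex n) ∧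
      ∑' κ, nestedTerm ε κ ≠ ⊤ := by
  have hfin : ∑' κ, nestedTerm ε κ ≠ ⊤ := by
    obtain ⟨m, rfl⟩ : ∃ m, n = m + 1 := ⟨n - 1, by omega⟩
    exact tsum_nestedTerm_ne_top ε hlast
  refine ⟨⟨(measurable_form ε).aestronglyMeasurable, ?_⟩, hfin⟩
  rw [HasFiniteIntegral, lintegral_enorm_form ε fun _ => hfirst]
  exact hfin.lt_top

/-- On the simplex each letter `1` gives a negative factor and each letter `0` a positive one, so
the integrand is its norm times a constant sign. -/
theorem integral_form (ε : Fin n → Fin 2) (hε : ∀ h : 0 < n, ε ⟨0, h⟩ = 1) :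
    ∫ t in openSimplex n, ∏ i, 1 / ((t i : ℂ) - ((ε i : ℕ) : ℂ))
      = (-1) ^ (Finset.univ.filter fun i => ε i = 1).card *
        ((∑' κ, nestedTerm ε κ).toReal : ℂ) := by
  have hm : MeasurableSet (openSimplex n) := measurableSet_simplexBelow 1
  have h1 : ∀ t ∈ openSimplex n, ∏ i, 1 / ((t i : ℂ) - ((ε i : ℕ) : ℂ))
      = (-1) ^ (Finset.univ.filter fun i => ε i = 1).card *
        ((‖∏ i, 1 / ((t i : ℂ) - ((ε i : ℕ) : ℂ))‖ : ℝ) : ℂ) := by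
    intro t ht
    rw [norm_prod, ← Finset.prod_const, Finset.prod_filter]
    push_cast
    rw [← Finset.prod_mul_distrib]
    refine Finset.prod_congr rfl fun i _ => ?_
    have h2 : (1 / ((t i : ℂ) - ((ε i : ℕ) : ℂ))) = ((1 / (t i - (ε i : ℕ)) : ℝ) : ℂ) := by
      push_cast
      rfl
    rw [h2, Complex.norm_real, Real.norm_eq_abs]
    split_ifs with h
    · have : t i - ((ε i : ℕ) : ℝ) < 0 := by
        rw [h]
        simpa using (ht.2 i).2
      rw [abs_of_neg (one_div_neg.2 this)]
      push_cast
      ring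
    · have h0 : ε i = 0 := by omega
      have : 0 < t i - ((ε i : ℕ) : ℝ) := by
        rw [h0]
        simpa using (ht.2 i).1
      rw [abs_of_pos (one_div_pos.2 this), one_mul]
  rw [setIntegral_congr_fun hm h1, integral_const_mul, integral_complex_ofReal,
    integral_norm_eq_lintegral_enorm (measurable_form ε).aestronglyMeasurable,
    lintegral_enorm_form ε hε]

end ZetaModuli

namespace ZetaModuli

variable {n : ℕ}

/-! ### Compositions and multiple zeta values -/

theorem le_index_iff (e : Composition n) (j : Fin e.length) (i : Fin n) :
    j ≤ e.index i ↔ e.sizeUpTo j ≤ i := by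
  constructor
  · intro h
    exact (e.monotone_sizeUpTo (Fin.le_def.1 h)).trans (e.sizeUpTo_index_le i)
  · intro h
    by_contra hlt
    have h1 : ((e.index i).succ : ℕ) ≤ j := by
      have := Fin.lt_def.1 (not_le.1 hlt)
      simpa using this
    have h2 := e.lt_sizeUpTo_index_succ i
    have h3 := e.monotone_sizeUpTo h1
    omega

/-- The first element of a block. -/
def blockStart (e : Composition n) (j : Fin e.length) : Fin n :=
  e.embedding j ⟨0, e.one_le_blocksFun j⟩

theorem val_blockStart (e : Composition n) (j : Fin e.length) :
    (blockStart e j).val = e.sizeUpTo j := by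
  simp [blockStart]

theorem index_blockStart (e : Composition n) (j : Fin e.length) : e.index (blockStart e j) = j :=
  e.index_embedding _ _

theorem blockStart_injective (e : Composition n) : Function.Injective (blockStart e) :=
  fun j j' h => by rw [← index_blockStart e j, h, index_blockStart]

theorem IsWordOf.eq_one_iff {ε : Fin n → Fin 2} {e : Composition n} (h : IsWordOf ε e)
    (i : Fin n) : ε i = 1 ↔ ∃ j, i = blockStart e j := by
  rw [h i]
  exact exists_congr fun j => by rw [← val_blockStart, Fin.ext_iff]

theorem IsWordOf.card_eq {ε : Fin n → Fin 2} {e : Composition n} (h : IsWordOf ε e) :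
    (Finset.univ.filter fun i => ε i = 1).card = e.length := by
  have : (Finset.univ.filter fun i => ε i = 1)
      = Finset.univ.map ⟨blockStart e, blockStart_injective e⟩ := by
    ext i
    simp only [Finset.mem_filter, Finset.mem_univ, true_and, Finset.mem_map, h.eq_one_iff,
      Function.Embedding.coeFn_mk, eq_comm]
  rw [this, Finset.card_map, Finset.card_univ, Fintype.card_fin]

theorem val_ne_zero_of_ne_blockStart {e : Composition n} {i : Fin n}
    (hi : ∀ j, i ≠ blockStart e j) : i.val ≠ 0 := by
  intro h0
  refine hi ⟨0, lt_of_le_of_lt (Nat.zero_le _) (e.index i).2⟩ (Fin.ext ?_)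
  rw [val_blockStart, h0, e.sizeUpTo_zero]

/-- An element that does not start a block lies in the block of its predecessor. -/
theorem index_pred {e : Composition n} {i : Fin n} (hi : ∀ j, i ≠ blockStart e j) :
    e.index ⟨i.val - 1, by omega⟩ = e.index i := by
  have h0 := val_ne_zero_of_ne_blockStart hi
  have h1 : e.sizeUpTo (e.index i) ≠ i := fun h =>
    hi (e.index i) (Fin.ext (by rw [val_blockStart, h]))
  have h2 := e.sizeUpTo_index_le i
  apply le_antisymm
  · rw [le_index_iff]
    have := e.sizeUpTo_index_le ⟨i.val - 1, by omega⟩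
    simp only at this
    omega
  · rw [le_index_iff]
    simp only
    omega

/-- The nested sum index that is constant on the blocks. -/
def blockIndex (e : Composition n) (k : Fin e.length → ℕ) (i : Fin n) : ℕ := k (e.index i)

theorem blockIndex_injective (e : Composition n) : Function.Injective (blockIndex e) := by
  intro k k' h
  funext j
  have := congrFun h (blockStart e j)
  rwa [blockIndex, blockIndex, index_blockStart] at this

theorem step_blockIndex {ε : Fin n → Fin 2} {e : Composition n} (h : IsWordOf ε e)
    {k : Fin e.length → ℕ} (hk : StrictMono k) (hk0 : ∀ j, 0 < k j) (i : Fin n) :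
    Step (ε i) (prevIndex (blockIndex e k) i) (blockIndex e k i) := by
  unfold Step
  split_ifs with hi
  · obtain ⟨j, rfl⟩ := (h.eq_one_iff i).1 hi
    simp only [prevIndex, blockIndex, index_blockStart]
    split_ifs with h0
    · exact hk0 j
    · refine hk (not_le.1 fun hle => ?_)
      rw [le_index_iff, ← val_blockStart] at hle
      simp only at hle
      omega
  · have hi' : ∀ j, i ≠ blockStart e j := fun j hj => hi ((h.eq_one_iff i).2 ⟨j, hj⟩)
    rw [prevIndex, if_neg (val_ne_zero_of_ne_blockStart hi'), blockIndex, blockIndex,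
      index_pred hi']

theorem nestedTerm_blockIndex {ε : Fin n → Fin 2} {e : Composition n} (h : IsWordOf ε e)
    {k : Fin e.length → ℕ} (hk : StrictMono k) (hk0 : ∀ j, 0 < k j) :
    nestedTerm ε (blockIndex e k) = ENNReal.ofReal (∏ j, 1 / (k j : ℝ) ^ e.blocksFun j) := by
  rw [nestedTerm, Finset.prod_congr rfl fun i _ => if_pos (step_blockIndex h hk hk0 i),
    ← ENNReal.ofReal_prod_of_nonneg fun i _ => by positivity, ← e.prod_prod_apply_embedding]
  congr 1
  refine Finset.prod_congr rfl fun j _ => ?_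
  simp only [blockIndex, e.index_embedding, Finset.prod_const, Finset.card_univ, Fintype.card_fin,
    one_div, inv_pow]

/-- A letter `0` forces equality with the preceding index and a letter `1` strict growth, so the
index is constant on blocks and increases from block to block. -/
theorem exists_blockIndex_eq {ε : Fin n → Fin 2} {e : Composition n} (h : IsWordOf ε e)
    {κ : Fin n → ℕ} (hκ : nestedTerm ε κ ≠ 0) :
    ∃ k : Fin e.length → ℕ, StrictMono k ∧ (∀ j, 0 < k j) ∧ blockIndex e k = κ := by
  have hstep := fun i => (ne_zero_of_nestedTerm_ne_zero hκ i).1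
  have hpos := fun i => (ne_zero_of_nestedTerm_ne_zero hκ i).2
  have hle : ∀ i, prevIndex κ i ≤ κ i := by
    intro i
    have := hstep i
    unfold Step at this
    split_ifs at this <;> omega
  have hmono : ∀ (b : ℕ) (hb : b < n) (a : ℕ) (hab : a ≤ b), κ ⟨a, by omega⟩ ≤ κ ⟨b, hb⟩ := by
    intro b
    induction b with
    | zero =>
      intro hb a hab
      obtain rfl : a = 0 := by omega
      rfl
    | succ b ih =>
      intro hb a hab
      rcases Nat.lt_or_ge b a with h1 | h1
      · obtain rfl : a = b + 1 := by omega
        rfl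
      · refine (ih (by omega) a h1).trans ?_
        simpa [prevIndex] using hle ⟨b + 1, hb⟩
  refine ⟨fun j => κ (blockStart e j), fun j j' hjj' => ?_, fun j => Nat.pos_of_ne_zero (hpos _), ?_⟩
  · have hlt : e.sizeUpTo j < e.sizeUpTo j' :=
      (e.sizeUpTo_strict_mono j.2).trans_le (e.monotone_sizeUpTo (Fin.lt_def.1 hjj'))
    rw [← val_blockStart, ← val_blockStart] at hlt
    have h1 := hstep (blockStart e j')
    rw [Step, if_pos ((h.eq_one_iff _).2 ⟨j', rfl⟩), prevIndex, if_neg (by omega)] at h1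
    exact (hmono _ (by omega) (blockStart e j).val (by omega)).trans_lt h1
  · have key : ∀ (a : ℕ) (ha : a < n), κ (blockStart e (e.index ⟨a, ha⟩)) = κ ⟨a, ha⟩ := by
      intro a
      induction a with
      | zero =>
        intro ha
        by_cases hi : ∃ j, (⟨0, ha⟩ : Fin n) = blockStart e j
        · obtain ⟨j, hj⟩ := hi
          rw [hj, index_blockStart]
        · push Not at hi
          exact absurd rfl (val_ne_zero_of_ne_blockStart hi)
      | succ a ih =>
        intro ha
        by_cases hi : ∃ j, (⟨a + 1, ha⟩ : Fin n) = blockStart e j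
        · obtain ⟨j, hj⟩ := hi
          rw [hj, index_blockStart]
        · have h1 := hstep ⟨a + 1, ha⟩
          rw [Step, if_neg fun h1 => hi ((h.eq_one_iff _).1 h1)] at h1
          push Not at hi
          have h2 := index_pred hi
          simp only [prevIndex, Nat.add_sub_cancel, Nat.succ_ne_zero, if_false] at h1 h2
          rw [← h2, ih, h1]
    funext i
    exact key i.val i.2

/-- The support of the nested sum is the image of the increasing positive sequences, one entry per
block; repetition within a block produces the exponent. -/
theorem isMultipleZeta_tsum {ε : Fin n → Fin 2} {e : Composition n} (h : IsWordOf ε e)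
    (hfin : ∑' κ, nestedTerm ε κ ≠ ⊤) :
    IsMultipleZeta e.blocksFun ((∑' κ, nestedTerm ε κ).toReal : ℂ) := by
  let K := {k : Fin e.length → ℕ // StrictMono k ∧ ∀ j, 0 < k j}
  let f : K → ENNReal := fun k => nestedTerm ε (blockIndex e k.1)
  have hinj : Function.Injective fun k : K => blockIndex e k.1 :=
    fun k k' hk => Subtype.ext (blockIndex_injective e hk)
  have hsum : ∑' k, f k = ∑' κ, nestedTerm ε κ := by
    refine hinj.tsum_eq (f := nestedTerm ε) fun κ hκ => ?_
    obtain ⟨k, hk, hk0, rfl⟩ := exists_blockIndex_eq h hκ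
    exact ⟨⟨k, hk, hk0⟩, rfl⟩
  have hs := ENNReal.hasSum_toReal (hsum ▸ hfin)
  rw [← ENNReal.tsum_toReal_eq (ENNReal.ne_top_of_tsum_ne_top (hsum ▸ hfin)), hsum] at hs
  have hfun : (fun k : K => (((f k).toReal : ℝ) : ℂ))
      = fun k : K => ∏ j, 1 / ((k.1 j : ℕ) : ℂ) ^ e.blocksFun j := by
    funext k
    simp only [f]
    rw [nestedTerm_blockIndex h k.2.1 k.2.2,
      ENNReal.toReal_ofReal (Finset.prod_nonneg fun j _ => by positivity)]
    push_cast
    rfl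
  have hc := Complex.hasSum_ofReal.2 hs
  rwa [hfun] at hc

theorem isMultipleZeta_integral {ε : Fin n → Fin 2} {e : Composition n} (h : IsWordOf ε e)
    (hε : ∀ h : 0 < n, ε ⟨0, h⟩ = 1) (hfin : ∑' κ, nestedTerm ε κ ≠ ⊤) :
    IsMultipleZeta e.blocksFun ((-1) ^ e.length *
      ∫ t in openSimplex n, ∏ i, 1 / ((t i : ℂ) - ((ε i : ℕ) : ℂ))) := by
  rw [integral_form ε hε, h.card_eq, ← mul_assoc, ← mul_pow, neg_one_mul, neg_neg, one_pow, one_mul]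
  exact isMultipleZeta_tsum h hfin

end ZetaModuli

/-! ### The theorem -/

theorem corollary3p2 (n : ℕ) (hn : 2 ≤ n) (ε : Fin n → Fin 2)
    (hfirst : ε ⟨0, by omega⟩ = 1) (hlast : ε ⟨n - 1, by omega⟩ = 0) :
    -- the cell is the image of the open simplex, and its boundary does not meet `A(ε)`
    Set.range (Phi (n := n)) = realCell n ∧
    Disjoint (divA ε) (closure (realCell n) \ realCell n) ∧
    -- `Ω(ε)` is holomorphic off `A(ε)`
    (∀ p ∉ divA ε, IsHolomorphicOmegaAt ε p) ∧
    -- the closed cell is a relative cycle of `(M̄ - A, B - B ∩ A)`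
    closure (Set.range (Phi (n := n))) ⊆ (divA ε)ᶜ ∧
    closure (Set.range (Phi (n := n))) \ Set.range (Phi (n := n)) ⊆ divB n \ (divB n ∩ divA ε) ∧
    (∃ c : CubicalChain (Mbar (Label n)) n, IsCellSubdivision c ∧
      IsRelativeCycle (divA ε)ᶜ (divB n \ (divB n ∩ divA ε)) c) ∧
    -- the zeta integral is the integral of `Ω(ε)` over this relative cycle
    (∀ c : CubicalChain (Mbar (Label n)) n, IsCellSubdivision c →
      IsRelativeCycle (divA ε)ᶜ (divB n \ (divB n ∩ divA ε)) c →
      (∀ τ ∈ c.support, MeasureTheory.IntegrableOn (omegaCoeff ℝ ε (cubeFun τ)) (openCube n)) ∧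
      MeasureTheory.IntegrableOn
        (fun t : Fin n → ℝ => ∏ i, 1 / ((t i : ℂ) - ((ε i : ℕ) : ℂ))) (openSimplex n) ∧
      chainIntegral ε c =
        ∫ t in openSimplex n, ∏ i, 1 / ((t i : ℂ) - ((ε i : ℕ) : ℂ)) ∧
      ∀ e : Composition n, IsWordOf ε e →
        IsMultipleZeta e.blocksFun ((-1) ^ e.length * chainIntegral ε c)) := by
  have h0 : 0 < n := by omega
  have hcl := closure_range_Phi_subset h0 hfirst hlast
  have hbd := boundary_subset h0 hfirst hlast
  obtain ⟨hform, hfin⟩ := integrableOn_form h0 ε hfirst hlast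
  refine ⟨range_Phi, ?_, fun p hp => isHolomorphicOmegaAt ε hp, hcl, hbd,
    ⟨gapChain n, isCellSubdivision_gapChain, isRelativeCycle_gapChain h0 hfirst hlast⟩,
    fun c hc _ => ?_⟩
  · rw [← range_Phi, Set.disjoint_left]
    exact fun p hp hp' => hcl hp'.1 hp
  · obtain ⟨h1, h2⟩ := chainIntegral_eq_integral hc hform
    refine ⟨h1, hform, h2, fun e he => ?_⟩
    rw [h2]
    exact isMultipleZeta_integral he (fun _ => hfirst) hfin
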